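/- Let $\mu\ge 0$ be real and $n\ge 0$ an integer. Put $[j]_\mu=j+\mu(1-(-1)^j)$, $[m]_\mu!=\prod_{j=1}^m[j]_\mu$, $E_\mu(z)=\sum_{m\ge0}z^m/[m]_\mu!$, and let $J_n(z)=\sum_{k\ge0}\frac{(-1)^k}{k!(k+n)!}(z/2)^{2k+n}$ be the classical Bessel function. Let $V_\mu$ be the Dunkl intertwining operator on entire functions, $$V_\mu f(x)=\frac1{B(\frac12,\mu)}\int_{-1}^1 f(xt)(1-t)^{\mu-1}(1+t)^{\mu}\,dt\quad(\mu>0),\qquad V_0f=f,$$ where $B$ is the Beta function. For $x\in\mathbb C$ define the deformed Bessel functions $$J_n^\mu(x)=V_\mu(J_n)(x),\qquad \mathcal J_n^\mu(x)=\frac{(x/2)^n}{\Gamma(\frac12)\Gamma(n+\frac12)}\int_{-1}^1E_\mu(isx)(1-s^2)^{n-\frac12}\,ds .$$ Then for every $\varepsilon>0$, as $|x|\to\infty$ in the sector $|\arg x|\le\frac\pi2-\varepsilon$, $$J_n^\mu(x)=C(x)+A(x)+O\!\left(|x|^{-\mu-\frac32}e^{|\operatorname{Im}x|}+|x|^{-2}|A(x)|\right),$$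 $$\mathcal J_n^\mu(x)=C(x)+\mathcal A(x)+O\!\left(|x|^{-\mu-\frac32}e^{|\operatorname{Im}x|}+|x|^{-2}|\mathcal A(x)|\right),$$ where, with principal powers and the convention $1/\Gamma(0)=0$, $$C(x)=\frac{\Gamma(\mu+\frac12)}{\pi}\Big(\frac x2\Big)^{-\mu-\frac12}\cos\!\Big(x-\frac\pi2\big(\tfrac12+n+\mu\big)\Big),$$ $$A(x)=\frac{\Gamma(\lfloor\frac{n+1}2\rfloor+\frac12)\,\Gamma(\mu+\frac12)}{\Gamma(n+\frac12-\lfloor\frac{n+1}2\rfloor)\,\Gamma(\mu)\,\Gamma(\frac12)}\Big(\frac x2\Big)^{n-2\lfloor\frac{n+1}2\rfloor-1},\qquad \mathcal A(x)=\frac{\Gamma(\mu+\frac12)}{\Gamma(n+\frac12)\,\Gamma(\mu)}\Big(\frac x2\Big)^{n-1}.$$ The implied constants depend only on $\mu$, $n$ and $\varepsilon$. -/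

import Mathlib

open scoped Real Topology Filter

noncomputable section

namespace DeformedBessel

/-- The classical Bessel function `J_n` of integer order `n ≥ 0`, as an entire function. -/
def besselJ (n : ℕ) (z : ℂ) : ℂ :=
  ∑' k : ℕ, (-1 : ℂ) ^ k / ((k.factorial : ℂ) * ((k + n).factorial : ℂ)) * (z / 2) ^ (2 * k + n)

/-- The deformed integer `[n]_μ = n + μ (1 - (-1)^n)`. -/
def dunklNat (μ : ℝ) (n : ℕ) : ℝ := n + μ * (1 - (-1) ^ n)

/-- The deformed factorial `[n]_μ! = [n]_μ [n-1]_μ ⋯ [1]_μ`, with `[0]_μ! = 1`. -/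
def dunklFactorial (μ : ℝ) (n : ℕ) : ℝ := ∏ j ∈ Finset.range n, dunklNat μ (j + 1)

/-- The deformed exponential `E_μ(z) = ∑ z^n / [n]_μ!`. -/
def dunklExp (μ : ℝ) (z : ℂ) : ℂ := ∑' n : ℕ, z ^ n / (dunklFactorial μ n : ℂ)

/-- The Dunkl intertwining operator `V_μ`, `μ ≥ 0`, on entire functions. For `μ > 0` it is given by
its integral representation, which for real `z` is the operator on smooth functions on the line and
for complex `z` is its entire extension. For `μ = 0`, where the Dunkl operator is the ordinary
derivative, it is the identity. -/
def dunklV (μ : ℝ) (f : ℂ → ℂ) (z : ℂ) : ℂ :=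
  if μ = 0 then f z
  else (Complex.betaIntegral (1 / 2) (μ : ℂ))⁻¹ *
    ∫ t in (-1 : ℝ)..1, f (z * (t : ℂ)) * (((1 - t) ^ (μ - 1) * (1 + t) ^ μ : ℝ) : ℂ)

/-- The first deformation `J_n^μ = V_μ (J_n)`. -/
def firstBessel (μ : ℝ) (n : ℕ) (z : ℂ) : ℂ := dunklV μ (besselJ n) z

/-- The second deformation, by the Poisson integral with `E_μ` as kernel. -/
def secondBessel (μ : ℝ) (n : ℕ) (z : ℂ) : ℂ :=
  (z / 2) ^ n / ((Real.Gamma (1 / 2) * Real.Gamma (n + 1 / 2) : ℝ) : ℂ) *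
    ∫ s in (-1 : ℝ)..1,
      dunklExp μ (Complex.I * (s : ℂ) * z) * (((1 - s ^ 2) ^ ((n : ℝ) - 1 / 2) : ℝ) : ℂ)

/-- The oscillatory leading term, common to both deformations. -/
def cosTerm (μ : ℝ) (n : ℕ) (z : ℂ) : ℂ :=
  ((Real.Gamma (μ + 1 / 2) / π : ℝ) : ℂ) * (z / 2) ^ ((-μ - 1 / 2 : ℝ) : ℂ) *
    Complex.cos (z - ((π / 2 * (1 / 2 + n + μ) : ℝ) : ℂ))

/-- The algebraic leading term of `J_n^μ`; here `(n + 1) / 2` is the integer part of `(n+1)/2`.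
For `μ = 0` it is `0`, according to the convention `1 / Γ(0) = 0`. -/
def firstAlgTerm (μ : ℝ) (n : ℕ) (z : ℂ) : ℂ :=
  ((Real.Gamma (((n + 1) / 2 : ℕ) + 1 / 2) * Real.Gamma (μ + 1 / 2) /
      (Real.Gamma (n + 1 / 2 - ((n + 1) / 2 : ℕ)) * Real.Gamma μ * Real.Gamma (1 / 2)) : ℝ) : ℂ) *
    (z / 2) ^ ((n : ℤ) - 2 * ((n + 1) / 2 : ℕ) - 1)

/-- The algebraic leading term of the second deformation, `0` for `μ = 0` by the same
convention. -/
def secondAlgTerm (μ : ℝ) (n : ℕ) (z : ℂ) : ℂ :=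
  ((Real.Gamma (μ + 1 / 2) / (Real.Gamma (n + 1 / 2) * Real.Gamma μ) : ℝ) : ℂ) *
    (z / 2) ^ ((n : ℤ) - 1)

/-- The filter `|x| → ∞` within the closed sector `|arg x| ≤ π/2 - ε`. -/
def sectorAtInfinity (ε : ℝ) : Filter ℂ :=
  Bornology.cobounded ℂ ⊓ Filter.principal {z : ℂ | |z.arg| ≤ π / 2 - ε}

end DeformedBessel

end

/-!
Both deformed Bessel functions are, for `μ > 0`, a constant times `(x / 2) ^ n` times one and the
same kind of integral,

  `∫₀¹ (1 - s²) ^ (n - 1/2) (W (x s) + W (-x s)) ds`,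
  `W ζ = ∫₀¹ t ^ (2 q) (1 - t²) ^ (μ - 1) e ^ (i ζ t) dt`,

where `W` is `weightTransform μ q`, with `q = ⌊(n + 1) / 2⌋` for the first deformation
(`firstBessel_eq`: Poisson's integral `besselJ_eq` for `J_n`, the parity of `J_n` and Fubini) and
`q = 0` for the second (`secondBessel_eq`: the even part of the deformed exponential on the
imaginary axis is a cosine transform, `dunklExp_add_neg`). For `μ = 0` both reduce to the same
integral with `W ζ = e ^ (i ζ)`.

The function `W` has two contributions, one from each endpoint of `[0, 1]`: an algebraic one
`α ζ ^ (-(2 q + 1))` from `t = 0` and an oscillatory one `m e ^ (i ζ) ζ ^ (-μ)` from `t = 1`. They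
are found by rotating the path into `0 → i → 1 + i → 1` (`integral_jac_mul_eq`, Cauchy's theorem with
a power singularity at a corner) and applying `watson` to the vertical sides
(`weightTransform_asymp`). In sectors about the positive imaginary axis the oscillatory part is small
and only the endpoint `0` matters (`weightTransform_asymp_upper`). These properties are collected in
`HasExpAlgAsymptotics`.

The outer integral cannot be expanded under the integral sign, since `x s` is small near `s = 0`.
But the contour can be moved off the origin, to `0 → i b → 1 + i b → 1` with a small `b > 0`, and the
two integrals over the imaginary axis that come from `W (x s)` and `W (-x s)` cancel, because the
weight is even (`integral_symm_eq`). What remains is an integral over the corner path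
`i b → 1 + i b → 1` and its complex conjugate. On that path `x s` is large and stays in sectors where
the expansion of `W` holds (`re_or_im_large`), so that it may be inserted: the side
`i b → 1 + i b` yields only an algebraic term (`HasExpAlgAsymptotics.top`), and the side `1 + i b → 1`
also yields the oscillatory term, by Watson's lemma at `s = 1` (`HasExpAlgAsymptotics.leg`). The sum
with the conjugate is `HasExpAlgAsymptotics.symm_integral`; there the oscillatory terms combine to a
cosine.

The constant of the algebraic term is a multiple of the imaginary part of the moment `cornerMoment` of
`(1 - s²) ^ (n - 1/2) s ^ (-(2 q + 1))` along the corner path, a finite-part integral. Integration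
by parts, where the boundary terms are real, reduces it to `n = q = 0`, where
`log s - log (1 + √(1 - s²))` is a primitive (`cornerMoment_im`). Comparison of the constants
(`cosTerm_eq`, `algTerm_eq`) concludes.
-/

noncomputable section

namespace DeformedBessel

open scoped Real Topology Filter ComplexConjugate

open MeasureTheory Set Complex

/-! ### Euler's integral for complex rates and Watson's lemma -/

theorem integrableOn_rpow_mul_exp {a r : ℝ} (ha : 0 < a) (hr : 0 < r) :
    IntegrableOn (fun t : ℝ => t ^ (a - 1) * Real.exp (-(r * t))) (Ioi 0) := by
  have h := Real.GammaIntegral_convergent ha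
  have h2 := (integrableOn_Ioi_comp_mul_left_iff
    (fun x => Real.exp (-x) * x ^ (a - 1)) 0 hr).mpr (by simpa using h)
  have h3 : IntegrableOn (fun t : ℝ => (r ^ (a - 1))⁻¹ *
      (Real.exp (-(r * t)) * (r * t) ^ (a - 1))) (Ioi 0) := h2.const_mul _
  refine h3.congr_fun (fun t ht => ?_) measurableSet_Ioi
  simp only [Real.mul_rpow hr.le (le_of_lt ht)]
  field_simp

theorem norm_cexp_neg_mul (p : ℂ) (t : ℝ) : ‖cexp (-(p * t))‖ = Real.exp (-(p.re * t)) := by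
  simp [Complex.norm_exp]

theorem integrableOn_rpow_mul_cexp {a : ℝ} (ha : 0 < a) {p : ℂ} (hp : 0 < p.re) :
    IntegrableOn (fun t : ℝ => ((t ^ (a - 1) : ℝ) : ℂ) * cexp (-(p * t))) (Ioi 0) := by
  refine (integrableOn_rpow_mul_exp ha hp).mono' ?_ ?_
  · refine ContinuousOn.aestronglyMeasurable (fun t ht => ContinuousAt.continuousWithinAt ?_)
      measurableSet_Ioi
    have : ContinuousAt (fun t : ℝ => t ^ (a - 1)) t :=
      Real.continuousAt_rpow_const _ _ (Or.inl (ne_of_gt ht))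
    fun_prop
  · filter_upwards [ae_restrict_mem measurableSet_Ioi] with t ht
    rw [norm_mul, norm_cexp_neg_mul, Complex.norm_real, Real.norm_of_nonneg]
    exact Real.rpow_nonneg (le_of_lt ht) _

/-- Euler's integral for `Γ(a) p ^ (-a)`, for complex `p` in the right half-plane. Both sides are
holomorphic in `p` and agree for `p > 0`. -/
theorem integral_rpow_mul_cexp {a : ℝ} (ha : 0 < a) {p : ℂ} (hp : 0 < p.re) :
    ∫ t in Ioi (0 : ℝ), ((t ^ (a - 1) : ℝ) : ℂ) * cexp (-(p * t)) =
      (Real.Gamma a : ℂ) * p ^ (-a : ℂ) := by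
  set U : Set ℂ := {p : ℂ | 0 < p.re} with hU
  have hUo : IsOpen U := isOpen_lt continuous_const Complex.continuous_re
  have hF : DifferentiableOn ℂ
      (fun p : ℂ => ∫ t in Ioi (0 : ℝ), ((t ^ (a - 1) : ℝ) : ℂ) * cexp (-(p * t))) U := by
    intro q hq
    have hq' : 0 < q.re := hq
    have hm (b : ℝ) (r : ℂ) : AEStronglyMeasurable
        (fun t : ℝ => ((t ^ (b - 1) : ℝ) : ℂ) * cexp (-(r * t))) (volume.restrict (Ioi 0)) := by
      refine ContinuousOn.aestronglyMeasurable (fun t ht => ContinuousAt.continuousWithinAt ?_)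
        measurableSet_Ioi
      have : ContinuousAt (fun t : ℝ => t ^ (b - 1)) t :=
        Real.continuousAt_rpow_const _ _ (Or.inl (ne_of_gt ht))
      fun_prop
    have hs : {p : ℂ | q.re / 2 < p.re} ∈ 𝓝 q :=
      (isOpen_lt continuous_const Complex.continuous_re).mem_nhds (by simp; linarith)
    have key := hasDerivAt_integral_of_dominated_loc_of_deriv_le (𝕜 := ℂ)
      (μ := volume.restrict (Ioi (0 : ℝ))) (x₀ := q) (s := {p : ℂ | q.re / 2 < p.re})
      (F := fun p t => ((t ^ (a - 1) : ℝ) : ℂ) * cexp (-(p * t)))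
      (F' := fun p t => -(((t ^ ((a + 1) - 1) : ℝ) : ℂ) * cexp (-(p * t))))
      (bound := fun t => t ^ ((a + 1) - 1) * Real.exp (-(q.re / 2 * t)))
      hs (Filter.Eventually.of_forall fun r => hm a r) (integrableOn_rpow_mul_cexp ha hq')
      (hm (a + 1) q).neg ?_ (integrableOn_rpow_mul_exp (by linarith) (by linarith)) ?_
    · exact key.2.differentiableAt.differentiableWithinAt
    · filter_upwards [ae_restrict_mem measurableSet_Ioi] with t ht r hr
      have ht' : (0 : ℝ) < t := ht
      rw [norm_neg, norm_mul, norm_cexp_neg_mul, Complex.norm_real,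
        Real.norm_of_nonneg (Real.rpow_nonneg ht'.le _)]
      gcongr
    · filter_upwards [ae_restrict_mem measurableSet_Ioi] with t ht r hr
      have ht' : (0 : ℝ) < t := ht
      have h1 : HasDerivAt (fun p : ℂ => -(p * (t : ℂ))) (-(t : ℂ)) r := by
        exact (((hasDerivAt_id' r).mul_const (t : ℂ)).fun_neg).congr_deriv (by simp)
      refine (h1.cexp.const_mul _).congr_deriv ?_
      have : t ^ ((a + 1) - 1) = t ^ (a - 1) * t := by
        rw [← Real.rpow_add_one ht'.ne']; ring_nf
      rw [this]; push_cast; ring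
  have hG : DifferentiableOn ℂ (fun p : ℂ => (Real.Gamma a : ℂ) * p ^ (-a : ℂ)) U := by
    intro q hq
    refine DifferentiableAt.differentiableWithinAt ?_
    refine DifferentiableAt.const_mul ?_ _
    exact (differentiableAt_id).cpow_const (Or.inl hq)
  have hconv : IsPreconnected U := (convex_halfSpace_re_gt 0).isPreconnected
  refine (hF.analyticOnNhd hUo).eqOn_of_preconnected_of_frequently_eq (hG.analyticOnNhd hUo) hconv
    (z₀ := 1) (by simp [hU]) ?_ hp
  -- the points `1 + 1 / (k + 1)` are positive and accumulate at `1`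
  have h1 : Filter.Tendsto (fun k : ℕ => (1 : ℂ) + (((1 : ℝ) / (k + 1) : ℝ) : ℂ)) Filter.atTop
      (𝓝[≠] 1) := by
    refine tendsto_nhdsWithin_iff.mpr ⟨?_, Filter.Eventually.of_forall fun k => ?_⟩
    · have := (Complex.continuous_ofReal.tendsto 0).comp (tendsto_one_div_add_atTop_nhds_zero_nat)
      simpa using this.const_add 1
    · have : ((1 : ℝ) / (k + 1)) ≠ 0 := by positivity
      simpa only [mem_compl_iff, mem_singleton_iff, add_eq_left, Complex.ofReal_eq_zero] using this
  refine h1.frequently (Filter.Frequently.of_forall fun k => ?_)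
  set r : ℝ := 1 + 1 / (k + 1) with hr
  have hr0 : 0 < r := by positivity
  have e : (1 : ℂ) + (((1 : ℝ) / (k + 1) : ℝ) : ℂ) = (r : ℂ) := by rw [hr]; push_cast; ring
  rw [e]
  have h2 := Real.integral_rpow_mul_exp_neg_mul_Ioi ha hr0
  have h3 : ∀ t : ℝ, ((t ^ (a - 1) : ℝ) : ℂ) * cexp (-((r : ℂ) * t)) =
      ((t ^ (a - 1) * Real.exp (-(r * t)) : ℝ) : ℂ) := fun t => by push_cast; rfl
  simp_rw [h3]
  rw [integral_complex_ofReal, h2, one_div, Real.inv_rpow hr0.le, ← Real.rpow_neg hr0.le]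
  rw [Complex.ofReal_mul, Complex.ofReal_cpow hr0.le]
  push_cast; ring

/-- Watson's lemma with one term, on a finite interval and uniformly in a closed subsector of the
right half-plane. -/
theorem watson {a r b : ℝ} (ha : 0 < a) (hr : 0 < r) (hb : 0 < b) {g : ℝ → ℂ} {G : ℂ} {C : ℝ}
    (hC : 0 ≤ C) (hg : IntervalIntegrable g volume 0 b)
    (hgC : ∀ t ∈ Ioo 0 b, ‖g t - G * ((t ^ (a - 1) : ℝ) : ℂ)‖ ≤ C * t ^ (a + r - 1))
    {c : ℝ} (hc : 0 < c) :
    ∃ K, 0 ≤ K ∧ ∀ p : ℂ, p ≠ 0 → c * ‖p‖ ≤ p.re →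
      ‖(∫ t in (0 : ℝ)..b, cexp (-(p * t)) * g t) - G * ((Real.Gamma a : ℂ) * p ^ (-a : ℂ))‖ ≤
        K * ‖p‖ ^ (-a - r) := by
  have har : 0 < a + r := by linarith
  have hbr : 0 < b ^ (-r) := Real.rpow_pos_of_pos hb _
  -- on `(b, ∞)` the model term `G t ^ (a - 1)` is itself at most `‖G‖ b ^ (-r) t ^ (a + r - 1)`
  set D : ℝ := C + ‖G‖ * b ^ (-r) with hD
  refine ⟨D * ((1 / c) ^ (a + r) * Real.Gamma (a + r)), ?_, fun p hp hpc => ?_⟩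
  · have := Real.Gamma_pos_of_pos har; positivity
  have hp0 : 0 < ‖p‖ := norm_pos_iff.mpr hp
  have hcp : 0 < c * ‖p‖ := by positivity
  have hpre : 0 < p.re := hcp.trans_le hpc
  set h : ℝ → ℂ := (Ioo 0 b).indicator (fun t => cexp (-(p * t)) * g t) with hh
  have hgi : IntegrableOn (fun t : ℝ => cexp (-(p * t)) * g t) (Ioo 0 b) := by
    have : IntervalIntegrable (fun t : ℝ => cexp (-(p * t)) * g t) volume 0 b :=
      hg.continuousOn_mul (by fun_prop)
    rwa [intervalIntegrable_iff_integrableOn_Ioo_of_le hb.le] at this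
  have hhi : IntegrableOn h (Ioi 0) := by
    refine Integrable.integrableOn ?_
    rw [hh, integrable_indicator_iff measurableSet_Ioo]; exact hgi
  have e1 : (∫ t in (0 : ℝ)..b, cexp (-(p * t)) * g t) = ∫ t in Ioi (0 : ℝ), h t := by
    rw [hh, setIntegral_indicator measurableSet_Ioo, intervalIntegral.integral_of_le hb.le,
      integral_Ioc_eq_integral_Ioo, inter_eq_self_of_subset_right Ioo_subset_Ioi_self]
  have hi2 := (integrableOn_rpow_mul_cexp ha hpre).const_mul G
  rw [e1, ← integral_rpow_mul_cexp ha hpre, ← integral_const_mul, ← integral_sub hhi hi2]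
  have hbd : ∀ t ∈ Ioi (0 : ℝ), ‖h t - G * (((t ^ (a - 1) : ℝ) : ℂ) * cexp (-(p * t)))‖ ≤
      D * (t ^ (a + r - 1) * Real.exp (-(c * ‖p‖ * t))) := by
    intro t ht
    have ht' : (0 : ℝ) < t := ht
    by_cases htb : t < b
    · have e : h t - G * (((t ^ (a - 1) : ℝ) : ℂ) * cexp (-(p * t))) =
          cexp (-(p * t)) * (g t - G * ((t ^ (a - 1) : ℝ) : ℂ)) := by
        rw [hh, indicator_of_mem (show t ∈ Ioo 0 b from ⟨ht', htb⟩)]; ring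
      rw [e, norm_mul, norm_cexp_neg_mul]
      calc _ ≤ Real.exp (-(c * ‖p‖ * t)) * (C * t ^ (a + r - 1)) := by
              gcongr; exact hgC t ⟨ht', htb⟩
        _ ≤ Real.exp (-(c * ‖p‖ * t)) * (D * t ^ (a + r - 1)) := by
              gcongr; rw [hD]; nlinarith [norm_nonneg G]
        _ = _ := by ring
    · have htb' : b ≤ t := not_lt.mp htb
      have e : h t - G * (((t ^ (a - 1) : ℝ) : ℂ) * cexp (-(p * t))) =
          -(cexp (-(p * t)) * (G * ((t ^ (a - 1) : ℝ) : ℂ))) := by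
        rw [hh, indicator_of_notMem (fun hx : t ∈ Ioo 0 b => htb hx.2)]; ring
      rw [e, norm_neg, norm_mul, norm_cexp_neg_mul, norm_mul, Complex.norm_real,
        Real.norm_of_nonneg (Real.rpow_nonneg ht'.le _)]
      have e2 : t ^ (a - 1) = t ^ (a + r - 1) * t ^ (-r) := by
        rw [← Real.rpow_add ht']; ring_nf
      have e3 : t ^ (-r) ≤ b ^ (-r) := Real.rpow_le_rpow_of_nonpos hb htb' (by linarith)
      calc _ ≤ Real.exp (-(c * ‖p‖ * t)) * (‖G‖ * (t ^ (a + r - 1) * b ^ (-r))) := by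
              rw [e2]; gcongr
        _ = Real.exp (-(c * ‖p‖ * t)) * ((‖G‖ * b ^ (-r)) * t ^ (a + r - 1)) := by ring
        _ ≤ Real.exp (-(c * ‖p‖ * t)) * (D * t ^ (a + r - 1)) := by
              gcongr; rw [hD]; linarith
        _ = _ := by ring
  have hint := (integrableOn_rpow_mul_exp har hcp).const_mul D
  calc _ ≤ ∫ t in Ioi (0 : ℝ), D * (t ^ (a + r - 1) * Real.exp (-(c * ‖p‖ * t))) :=
        norm_integral_le_of_norm_le hint
          ((ae_restrict_mem measurableSet_Ioi).mono fun t ht => hbd t ht)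
    _ = D * ((1 / (c * ‖p‖)) ^ (a + r) * Real.Gamma (a + r)) := by
        rw [integral_const_mul, Real.integral_rpow_mul_exp_neg_mul_Ioi har hcp]
    _ = _ := by
        have : (1 / (c * ‖p‖)) ^ (a + r) = (1 / c) ^ (a + r) * ‖p‖ ^ (-a - r) := by
          rw [← one_div_mul_one_div_rev, Real.mul_rpow (by positivity) (by positivity),
            one_div ‖p‖, Real.inv_rpow hp0.le, ← Real.rpow_neg hp0.le, neg_add', mul_comm]
        rw [this]; ring

/-! ### The Jacobi weight and Cauchy's theorem on a rectangle with a singular corner -/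

/-- The Jacobi weight `(1 - s²) ^ a`, with the principal power. It is holomorphic on the strip
`|Re s| ≤ 1` away from `±1`. -/
def jac (a : ℝ) (s : ℂ) : ℂ := (1 - s ^ 2) ^ (a : ℂ)

/-- The integral of `φ` along the polygonal path `i b → 1 + i b → 1`. -/
def cornerIntegral (b : ℝ) (φ : ℂ → ℂ) : ℂ :=
  (∫ σ in (0 : ℝ)..1, φ (σ + b * I)) - I * ∫ y in (0 : ℝ)..b, φ (1 + y * I)

theorem jac_ofReal (a : ℝ) {s : ℝ} (h0 : -1 ≤ s) (h1 : s ≤ 1) :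
    jac a s = (((1 - s ^ 2) ^ a : ℝ) : ℂ) := by
  rw [jac, Complex.ofReal_cpow (by nlinarith)]; push_cast; rfl

theorem jac_mul_I (a y : ℝ) : jac a (y * I) = (((1 + y ^ 2) ^ a : ℝ) : ℂ) := by
  rw [jac, Complex.ofReal_cpow (by positivity), mul_pow, I_sq]; push_cast; ring_nf

theorem jac_neg (a : ℝ) (s : ℂ) : jac a (-s) = jac a s := by simp [jac]

theorem ofReal_mul_cpow {y : ℝ} (hy : 0 < y) {z : ℂ} (a : ℂ) :
    ((y : ℂ) * z) ^ a = (y : ℂ) ^ a * z ^ a := by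
  rcases eq_or_ne z 0 with rfl | hz
  · by_cases ha : a = 0
    · simp [ha]
    · simp [Complex.zero_cpow ha]
  · rw [Complex.cpow_def_of_ne_zero (by simp [hy.ne', hz]), Complex.cpow_def_of_ne_zero hz,
      Complex.cpow_def_of_ne_zero (by simp [hy.ne']), Complex.log_ofReal_mul hy hz, ← Complex.exp_add,
      ← Complex.ofReal_log hy.le]
    ring_nf

/-- On the leg `s = 1 + i y` the weight factors as `y ^ a` times a smooth function of `y`. -/
theorem jac_one_add_mul_I (a : ℝ) {y : ℝ} (hy : 0 < y) :
    jac a (1 + y * I) = ((y ^ a : ℝ) : ℂ) * ((y : ℂ) - 2 * I) ^ (a : ℂ) := by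
  rw [jac, show 1 - (1 + (y : ℂ) * I) ^ 2 = y * (y - 2 * I) by ring_nf; rw [I_sq]; ring,
    ofReal_mul_cpow hy, Complex.ofReal_cpow hy.le]

theorem one_sub_sq_re (s : ℂ) : (1 - s ^ 2).re = 1 - s.re ^ 2 + s.im ^ 2 := by
  simp [pow_two]; ring

theorem one_sub_sq_re_pos {s : ℂ} (h0 : 0 ≤ s.re) (h1 : s.re ≤ 1) (h : s.re < 1 ∨ s.im ≠ 0) :
    0 < (1 - s ^ 2).re := by
  rw [one_sub_sq_re]
  rcases h with h | h
  · nlinarith [sq_nonneg s.im]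
  · have := pow_pos (abs_pos.mpr h) 2
    rw [sq_abs] at this; nlinarith

theorem differentiableAt_jac (a : ℝ) {s : ℂ} (h : 0 < (1 - s ^ 2).re) :
    DifferentiableAt ℂ (jac a) s :=
  DifferentiableAt.cpow_const (by fun_prop) (Or.inl h)

theorem intervalIntegrable_ofReal {f : ℝ → ℝ} {a b : ℝ} (h : IntervalIntegrable f volume a b) :
    IntervalIntegrable (fun x => (f x : ℂ)) volume a b :=
  ⟨h.1.ofReal, h.2.ofReal⟩

theorem intervalIntegrable_one_sub_sq {a : ℝ} (ha : -1 < a) :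
    IntervalIntegrable (fun s : ℝ => (1 - s ^ 2) ^ a) volume 0 1 := by
  have h1 : IntervalIntegrable (fun s : ℝ => (1 - s) ^ a) volume 0 1 := by
    simpa using ((intervalIntegral.intervalIntegrable_rpow' (a := 0) (b := 1) ha).comp_sub_left 1).symm
  have h2 : ContinuousOn (fun s : ℝ => (1 + s) ^ a) (uIcc 0 1) := by
    rw [uIcc_of_le zero_le_one]
    intro s hs
    exact (ContinuousAt.rpow_const (by fun_prop) (Or.inl (by linarith [hs.1]))).continuousWithinAt
  refine (h1.mul_continuousOn h2).congr ?_
  intro s hs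
  rw [uIoc_of_le zero_le_one] at hs
  simp only
  rw [← Real.mul_rpow (by linarith [hs.2]) (by linarith [hs.1])]; ring_nf

theorem intervalIntegrable_jac {a : ℝ} (ha : -1 < a) :
    IntervalIntegrable (fun s : ℝ => jac a s) volume 0 1 := by
  have h : IntervalIntegrable (fun s : ℝ => (((1 - s ^ 2) ^ a : ℝ) : ℂ)) volume 0 1 :=
    intervalIntegrable_ofReal (intervalIntegrable_one_sub_sq ha)
  refine h.congr fun s hs => ?_
  rw [uIoc_of_le zero_le_one] at hs
  exact (jac_ofReal a (by linarith [hs.1]) hs.2).symm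

theorem sub_two_I_mem_slitPlane (y : ℝ) : ((y : ℂ) - 2 * I) ∈ slitPlane := by
  right; simp

theorem continuous_sub_two_I_cpow (a : ℂ) : Continuous fun y : ℝ => ((y : ℂ) - 2 * I) ^ a :=
  Continuous.cpow (by fun_prop) continuous_const sub_two_I_mem_slitPlane

theorem intervalIntegrable_jac_leg {a : ℝ} (ha : -1 < a) {b : ℝ} (hb : 0 < b) :
    IntervalIntegrable (fun y : ℝ => jac a (1 + y * I)) volume 0 b := by
  have h1 : IntervalIntegrable (fun y : ℝ => ((y ^ a : ℝ) : ℂ)) volume 0 b :=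
    intervalIntegrable_ofReal (intervalIntegral.intervalIntegrable_rpow' ha)
  refine (h1.mul_continuousOn (continuous_sub_two_I_cpow a).continuousOn).congr fun y hy => ?_
  rw [uIoc_of_le hb.le] at hy
  exact (jac_one_add_mul_I a hy.1).symm

theorem continuousOn_jac_top (a : ℝ) {b : ℝ} (hb : 0 < b) :
    ContinuousOn (fun σ : ℝ => jac a (σ + b * I)) (Icc 0 1) := by
  intro σ hσ
  refine ContinuousAt.continuousWithinAt ?_
  have := (differentiableAt_jac a (s := (σ : ℂ) + b * I) (one_sub_sq_re_pos (by simpa using hσ.1)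
    (by simpa using hσ.2) (Or.inr (by simp [hb.ne'])))).continuousAt
  exact ContinuousAt.comp (f := fun σ : ℝ => (σ : ℂ) + b * I) this (by fun_prop)

/-- Near the endpoint `1` the weight has an integrable singularity, controlled along vertical
lines. -/
theorem norm_jac_le (a : ℝ) {b : ℝ} (hb : 0 < b) : ∃ K, ∀ u ∈ Icc (0 : ℝ) 1, ∀ y ∈ Ioc 0 b,
    ‖jac a (u + y * I)‖ ≤ K + y ^ a := by
  refine ⟨(2 + (1 + b) ^ 2) ^ |a|, fun u hu y hy => ?_⟩
  rw [jac, Complex.norm_cpow_real]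
  have hlo : y ≤ ‖1 - ((u : ℂ) + y * I) ^ 2‖ := by
    have e : 1 - ((u : ℂ) + y * I) ^ 2 = (1 - (u + y * I)) * (1 + (u + y * I)) := by ring
    have h1 : y ≤ ‖1 - ((u : ℂ) + y * I)‖ := by
      have := Complex.abs_im_le_norm (1 - ((u : ℂ) + y * I))
      simp only [sub_im, one_im, add_im, ofReal_im, mul_im, I_im, ofReal_re, I_re] at this
      rw [show |(0 : ℝ) - (0 + (y * 1 + 0 * 0))| = y by simp [abs_of_pos hy.1]] at this
      exact this
    have h2 : 1 ≤ ‖1 + ((u : ℂ) + y * I)‖ := by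
      have := Complex.abs_re_le_norm (1 + ((u : ℂ) + y * I))
      simp only [add_re, one_re, ofReal_re, mul_re, I_re, ofReal_im, I_im] at this
      have h3 := le_abs_self (1 + (u + (y * 0 - 0 * 1)) : ℝ)
      have := hu.1
      linarith
    rw [e, norm_mul]
    nlinarith [hy.1]
  have hhi : ‖1 - ((u : ℂ) + y * I) ^ 2‖ ≤ 2 + (1 + b) ^ 2 := by
    have h1 : ‖(u : ℂ) + y * I‖ ≤ 1 + b := by
      refine (norm_add_le _ _).trans ?_
      simp only [norm_mul, Complex.norm_real, Complex.norm_I, Real.norm_eq_abs, abs_of_nonneg hu.1,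
        abs_of_pos hy.1, mul_one]
      linarith [hu.2, hy.2]
    refine (norm_sub_le _ _).trans ?_
    rw [norm_one, norm_pow]
    have := pow_le_pow_left₀ (norm_nonneg _) h1 2
    linarith
  set N := ‖1 - ((u : ℂ) + y * I) ^ 2‖
  have hN : 0 < N := hy.1.trans_le hlo
  rcases le_total 0 a with h | h
  · have h1 : N ^ a ≤ (2 + (1 + b) ^ 2) ^ a := Real.rpow_le_rpow hN.le hhi h
    rw [abs_of_nonneg h]
    linarith [Real.rpow_nonneg hy.1.le a]
  · have h1 : N ^ a ≤ y ^ a := Real.rpow_le_rpow_of_nonpos hy.1 hlo h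
    have : 0 ≤ (2 + (1 + b) ^ 2) ^ |a| := by positivity
    linarith

/-- Cauchy's theorem for the rectangle with corners `0`, `1`, `1 + i b`, `i b`, for an integrand
with an integrable power singularity at the corner `1`. -/
theorem integral_jac_mul_eq {a : ℝ} (ha : -1 < a) {b : ℝ} (hb : 0 < b) {H : ℂ → ℂ}
    (hH : Differentiable ℂ H) :
    ∫ s in (0 : ℝ)..1, jac a s * H s =
      I * (∫ y in (0 : ℝ)..b, jac a (y * I) * H (y * I)) +
        cornerIntegral b (fun s => jac a s * H s) := by
  set φ : ℂ → ℂ := fun s => jac a s * H s with hφ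
  have hφd : ∀ s : ℂ, 0 < (1 - s ^ 2).re → DifferentiableAt ℂ φ s := fun s hs =>
    (differentiableAt_jac a hs).mul (hH s)
  -- the rectangle with right side at `Re s = u < 1` avoids the singularity; then `u → 1`
  have hrect : ∀ u ∈ Ioo (0 : ℝ) 1, (∫ x in (0 : ℝ)..u, φ x) - (∫ x in (0 : ℝ)..u, φ (x + b * I))
      + I * (∫ y in (0 : ℝ)..b, φ (u + y * I)) - I * (∫ y in (0 : ℝ)..b, φ (y * I)) = 0 := by
    intro u hu
    have h := Complex.integral_boundary_rect_eq_zero_of_differentiableOn φ 0 (u + b * I) ?_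
    · simpa using h
    · intro s hs
      refine (hφd s ?_).differentiableWithinAt
      simp only [zero_re, zero_im, add_re, add_im, ofReal_re, ofReal_im, mul_re, mul_im, I_re, I_im,
        mul_zero, mul_one, sub_zero, add_zero, zero_add, uIcc_of_le hu.1.le,
        uIcc_of_le hb.le] at hs
      have h1 := hs.1
      simp only [mem_preimage, mem_Icc] at h1
      exact one_sub_sq_re_pos h1.1 (h1.2.trans hu.2.le) (Or.inl (h1.2.trans_lt hu.2))
  have i1 : IntervalIntegrable (fun x : ℝ => φ x) volume 0 1 :=
    (intervalIntegrable_jac ha).mul_continuousOn (hH.continuous.comp continuous_ofReal).continuousOn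
  have i2 : IntervalIntegrable (fun x : ℝ => φ (x + b * I)) volume 0 1 := by
    refine ContinuousOn.intervalIntegrable ?_
    rw [uIcc_of_le zero_le_one]
    exact (continuousOn_jac_top a hb).mul (hH.continuous.comp (by fun_prop)).continuousOn
  have lim : ∀ {f : ℝ → ℂ}, IntervalIntegrable f volume 0 1 →
      Filter.Tendsto (fun u => ∫ x in (0 : ℝ)..u, f x) (𝓝[<] 1) (𝓝 (∫ x in (0 : ℝ)..1, f x)) := by
    intro f hf
    have := intervalIntegral.continuousOn_primitive_interval' hf left_mem_uIcc 1 right_mem_uIcc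
    refine Filter.Tendsto.mono_left this ?_
    rw [uIcc_of_le zero_le_one, nhdsWithin_Icc_eq_nhdsLE zero_lt_one]
    exact nhdsWithin_mono _ Iio_subset_Iic_self
  have hu1 : ∀ᶠ u in 𝓝[<] (1 : ℝ), u ∈ Ioo (0 : ℝ) 1 := Ioo_mem_nhdsLT zero_lt_one
  have i3 : Filter.Tendsto (fun u : ℝ => ∫ y in (0 : ℝ)..b, φ (u + y * I)) (𝓝[<] 1)
      (𝓝 (∫ y in (0 : ℝ)..b, φ (1 + y * I))) := by
    obtain ⟨K, hK⟩ := norm_jac_le a hb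
    obtain ⟨M, hM⟩ := (isCompact_Icc (a := (0 : ℝ)) (b := 1)).prod (isCompact_Icc (a := (0 : ℝ)) (b := b))
      |>.exists_bound_of_continuousOn (f := fun p : ℝ × ℝ => H (p.1 + p.2 * I))
        (hH.continuous.comp (by fun_prop)).continuousOn
    have hpos : ∀ u ∈ Ioc (0 : ℝ) 1, ∀ y ∈ Ioc 0 b, 0 < (1 - ((u : ℂ) + y * I) ^ 2).re :=
      fun u hu y hy => one_sub_sq_re_pos (by simpa using hu.1.le) (by simpa using hu.2)
        (Or.inr (by simp [hy.1.ne']))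
    refine intervalIntegral.tendsto_integral_filter_of_dominated_convergence
      (fun y => (K + y ^ a) * M) ?_ ?_ ?_ ?_
    · filter_upwards [hu1] with u hu
      rw [uIoc_of_le hb.le]
      refine ContinuousOn.aestronglyMeasurable (fun y hy => ?_) measurableSet_Ioc
      have := (hφd _ (hpos u ⟨hu.1, hu.2.le⟩ y hy)).continuousAt
      exact (ContinuousAt.comp (f := fun y : ℝ => (u : ℂ) + y * I) this
        (by fun_prop)).continuousWithinAt
    · filter_upwards [hu1] with u hu
      refine Filter.Eventually.of_forall fun y hy => ?_
      rw [uIoc_of_le hb.le] at hy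
      rw [hφ, norm_mul]
      refine mul_le_mul (hK u ⟨hu.1.le, hu.2.le⟩ y hy)
        (hM (u, y) ⟨⟨hu.1.le, hu.2.le⟩, ⟨hy.1.le, hy.2⟩⟩) (norm_nonneg _) ?_
      exact (norm_nonneg _).trans (hK u ⟨hu.1.le, hu.2.le⟩ y hy)
    · exact (intervalIntegrable_const.add (intervalIntegral.intervalIntegrable_rpow' ha)).mul_const M
    · refine Filter.Eventually.of_forall fun y hy => ?_
      rw [uIoc_of_le hb.le] at hy
      have := (hφd _ (hpos 1 ⟨zero_lt_one, le_rfl⟩ y hy)).continuousAt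
      have h2 : ContinuousAt (fun u : ℝ => φ ((u : ℂ) + y * I)) 1 :=
        ContinuousAt.comp (f := fun u : ℝ => (u : ℂ) + y * I) this (by fun_prop)
      have h3 := h2.tendsto.mono_left (nhdsWithin_le_nhds (s := Iio 1))
      simpa using h3
  have hlim := (((lim i1).sub (lim i2)).add (i3.const_mul I)).sub_const
    (I * (∫ y in (0 : ℝ)..b, φ (y * I)))
  have hzero := tendsto_nhds_unique (hlim.congr' (f₂ := fun _ => (0 : ℂ))
    (hu1.mono fun u hu => hrect u hu)) tendsto_const_nhds
  rw [cornerIntegral]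
  linear_combination hzero

/-! ### The Fourier transform of a Jacobi weight on `[0, 1]` -/

theorem exists_norm_sub_le_mul {f : ℝ → ℂ} {b : ℝ} (hf : ContDiffOn ℝ 1 f (Icc 0 b)) (hb : 0 < b) :
    ∃ C, 0 ≤ C ∧ ∀ t ∈ Icc 0 b, ‖f t - f 0‖ ≤ C * t := by
  obtain ⟨K, hK⟩ := hf.exists_lipschitzOnWith (by norm_num) (convex_Icc 0 b) isCompact_Icc
  refine ⟨K, K.2, fun t ht => ?_⟩
  have := hK.dist_le_mul t ht 0 ⟨le_rfl, hb.le⟩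
  rwa [dist_eq_norm, Real.dist_eq, sub_zero, abs_of_nonneg ht.1] at this

theorem exists_exp_neg_le_rpow {c : ℝ} (hc : 0 < c) (s : ℝ) :
    ∃ K, 0 ≤ K ∧ ∀ x : ℝ, 1 ≤ x → Real.exp (-(c * x)) ≤ K * x ^ (-s) := by
  obtain ⟨N, hN⟩ := exists_nat_ge s
  refine ⟨N.factorial / c ^ N, by positivity, fun x hx => ?_⟩
  have hx0 : 0 < x := by linarith
  have h1 := Real.pow_div_factorial_le_exp (c * x) (by positivity) N
  have h2 : x ^ s ≤ x ^ N := by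
    rw [← Real.rpow_natCast]; exact Real.rpow_le_rpow_of_exponent_le hx hN
  rw [Real.exp_neg, Real.rpow_neg hx0.le, ← div_eq_mul_inv, inv_le_comm₀ (Real.exp_pos _) (by positivity)]
  refine le_trans ?_ h1
  rw [mul_pow, inv_div, div_div_eq_mul_div, mul_comm (x ^ s)]
  gcongr

theorem norm_cexp_I_mul (z : ℂ) : ‖cexp (I * z)‖ = Real.exp (-z.im) := by
  simp [Complex.norm_exp]

/-- The Fourier transform on `[0, 1]` of the weight `t ^ (2 q) (1 - t²) ^ (μ - 1)`. -/
def weightTransform (μ : ℝ) (q : ℕ) (ζ : ℂ) : ℂ :=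
  ∫ t in (0 : ℝ)..1, jac (μ - 1) t * ((t : ℂ) ^ (2 * q) * cexp (I * (ζ * t)))

/-- The coefficient of the contribution of the endpoint `0` to `weightTransform`. -/
def algCoeff (q : ℕ) : ℂ := I * (-1) ^ q * ((2 * q).factorial : ℂ)

/-- The coefficient of the contribution of the endpoint `1` to `weightTransform`. -/
def expCoeff (μ : ℝ) : ℂ := -(I * ((-2 * I) ^ ((μ - 1 : ℝ) : ℂ) * (Real.Gamma μ : ℂ)))

/-- The local expansion at the endpoint `1` of the integrand on the leg `1 + i t`, in the form that
`watson` requires. -/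
theorem exists_leg_bound (a : ℝ) {h : ℝ → ℂ} (hh : ContDiff ℝ 1 h) {b : ℝ} (hb : 0 < b) :
    ∃ C, 0 ≤ C ∧ ∀ t ∈ Ioo 0 b, ‖jac (a - 1) (1 + t * I) * h t -
      (-2 * I) ^ ((a - 1 : ℝ) : ℂ) * h 0 * ((t ^ (a - 1) : ℝ) : ℂ)‖ ≤ C * t ^ (a + 1 - 1) := by
  have hcd : ContDiff ℝ 1 (fun t : ℝ => ((t : ℂ) - 2 * I) ^ ((a - 1 : ℝ) : ℂ) * h t) := by
    refine ContDiff.mul ?_ hh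
    rw [contDiff_iff_contDiffAt]
    intro t
    have h1 : AnalyticAt ℝ (fun t : ℝ => ((t : ℂ) - 2 * I)) t := by
      exact (Complex.ofRealCLM.analyticAt t).sub analyticAt_const
    have h2 : AnalyticAt ℂ (fun z : ℂ => z ^ ((a - 1 : ℝ) : ℂ)) ((t : ℂ) - 2 * I) :=
      AnalyticAt.cpow analyticAt_id analyticAt_const (sub_two_I_mem_slitPlane t)
    exact (AnalyticAt.fun_comp (f := fun t : ℝ => ((t : ℂ) - 2 * I))
      (h2.restrictScalars (𝕜 := ℝ)) h1).contDiffAt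
  obtain ⟨C, hC0, hC⟩ := exists_norm_sub_le_mul hcd.contDiffOn hb
  refine ⟨C, hC0, fun t ht => ?_⟩
  have := hC t ⟨ht.1.le, ht.2.le⟩
  rw [jac_one_add_mul_I _ ht.1, show ((t ^ (a - 1) : ℝ) : ℂ) * ((t : ℂ) - 2 * I) ^ ((a - 1 : ℝ) : ℂ) * h t -
      (-2 * I) ^ ((a - 1 : ℝ) : ℂ) * h 0 * ((t ^ (a - 1) : ℝ) : ℂ) = ((t ^ (a - 1) : ℝ) : ℂ) *
      (((t : ℂ) - 2 * I) ^ ((a - 1 : ℝ) : ℂ) * h t - (((0 : ℝ) : ℂ) - 2 * I) ^ ((a - 1 : ℝ) : ℂ) * h 0)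
      by rw [Complex.ofReal_zero, zero_sub, ← neg_mul]; ring, norm_mul, Complex.norm_real,
    Real.norm_of_nonneg (Real.rpow_nonneg ht.1.le _)]
  calc _ ≤ t ^ (a - 1) * (C * t) := by gcongr; exact Real.rpow_nonneg ht.1.le _
    _ = C * t ^ (a + 1 - 1) := by
      rw [show a + 1 - 1 = (a - 1) + 1 by ring, Real.rpow_add_one ht.1.ne']; ring

theorem cpow_neg_ofReal_natCast (ζ : ℂ) (d : ℕ) : ζ ^ (-((d : ℝ) : ℂ)) = (ζ ^ d)⁻¹ := by
  rw [Complex.cpow_neg, Complex.ofReal_natCast, Complex.cpow_natCast]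

/-- On a compact interval, `(1 + κ t²) ^ a - 1` is of order `t²`. -/
theorem exists_one_add_rpow_bound (a : ℝ) {κ b : ℝ} (hb : 0 < b)
    (h : ∀ t ∈ Icc 0 (b ^ 2), 0 < 1 + κ * t) :
    ∃ C, 0 ≤ C ∧ ∀ t ∈ Icc 0 b, ‖(((1 + κ * t ^ 2) ^ a : ℝ) : ℂ) - 1‖ ≤ C * t ^ 2 := by
  have hcd : ContDiffOn ℝ 1 (fun t : ℝ => (((1 + κ * t) ^ a : ℝ) : ℂ)) (Icc 0 (b ^ 2)) := by
    refine Complex.ofRealCLM.contDiff.comp_contDiffOn ?_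
    refine ContDiffOn.rpow_const_of_ne (by fun_prop) fun t ht => (h t ht).ne'
  obtain ⟨C, hC0, hC⟩ := exists_norm_sub_le_mul hcd (by positivity)
  refine ⟨C, hC0, fun t ht => ?_⟩
  have := hC (t ^ 2) ⟨by positivity, pow_le_pow_left₀ ht.1 ht.2 2⟩
  simpa using this

theorem rpow_two_mul_natCast (q : ℕ) (t : ℝ) : t ^ ((((2 * q : ℕ) : ℝ) + 1) - 1) = t ^ (2 * q) := by
  rw [add_sub_cancel_right, Real.rpow_natCast]

/-- The local expansion at the endpoint `0`, in the form that `watson` requires. Evenness of the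
weight makes the relative error quadratic. -/
theorem exists_even_bound (q : ℕ) {g : ℝ → ℂ} {b C : ℝ} {G : ℂ}
    (hg : ∀ t ∈ Icc 0 b, ‖g t - G‖ ≤ C * t ^ 2) :
    ∀ t ∈ Ioo 0 b, ‖g t * (t : ℂ) ^ (2 * q) -
      G * ((t ^ ((((2 * q : ℕ) : ℝ) + 1) - 1) : ℝ) : ℂ)‖ ≤
      C * t ^ ((((2 * q : ℕ) : ℝ) + 1) + 2 - 1) := by
  intro t ht
  rw [rpow_two_mul_natCast, Complex.ofReal_pow, ← sub_mul, norm_mul, norm_pow, Complex.norm_real,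
    Real.norm_of_nonneg ht.1.le, show (((2 * q : ℕ) : ℝ) + 1) + 2 - 1 = ((2 * q + 2 : ℕ) : ℝ) by
      push_cast; ring, Real.rpow_natCast, pow_add]
  have ht0 := ht.1.le
  calc _ ≤ C * t ^ 2 * t ^ (2 * q) := by
        gcongr; exact hg t ⟨ht.1.le, ht.2.le⟩
    _ = _ := by ring

theorem mul_I_pow_two_mul (q : ℕ) (y : ℂ) : (y * I) ^ (2 * q) = (-1) ^ q * y ^ (2 * q) := by
  rw [mul_pow, pow_mul I, I_sq]; ring

/-- Asymptotics of `weightTransform` near the real axis: the segment `[0, 1]` is deformed into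
`0 → i → 1 + i → 1`, and Watson's lemma is applied to both vertical sides. -/
theorem weightTransform_asymp {μ : ℝ} (hμ : 0 < μ) (q : ℕ) {c : ℝ} (hc : 0 < c) :
    ∃ K, 0 ≤ K ∧ ∀ ζ : ℂ, 1 ≤ ‖ζ‖ → c * ‖ζ‖ ≤ ζ.re →
      ‖weightTransform μ q ζ - algCoeff q * (ζ ^ (2 * q + 1))⁻¹ -
        expCoeff μ * cexp (I * ζ) * ζ ^ (-μ : ℂ)‖ ≤
      K * ‖ζ‖ ^ (-((2 * q + 1 : ℕ) : ℝ) - 2) + K * (‖ζ‖ ^ (-μ - 1) * Real.exp (-ζ.im)) := by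
  have hμ1 : -1 < μ - 1 := by linarith
  -- the side from `0` to `i`
  obtain ⟨C₁, hC₁, hb₁⟩ := exists_one_add_rpow_bound (μ - 1) (κ := 1) zero_lt_one
    (fun t ht => by linarith [ht.1])
  have hcont₁ : Continuous fun y : ℝ => (((1 + 1 * y ^ 2) ^ (μ - 1) : ℝ) : ℂ) := by
    refine Complex.continuous_ofReal.comp (Continuous.rpow_const (by fun_prop) fun y => Or.inl ?_)
    positivity
  obtain ⟨K₁, hK₁, hw₁⟩ := watson (a := ((2 * q : ℕ) : ℝ) + 1) (r := 2) (by positivity) zero_lt_two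
    zero_lt_one hC₁ (g := fun y => (((1 + 1 * y ^ 2) ^ (μ - 1) : ℝ) : ℂ) * (y : ℂ) ^ (2 * q)) (G := 1)
    (Continuous.intervalIntegrable (by fun_prop) _ _)
    (exists_even_bound q (by simpa using hb₁)) hc
  -- the side from `1` to `1 + i`
  obtain ⟨C₃, hC₃, hb₃⟩ := exists_leg_bound μ (h := fun y : ℝ => (1 + (y : ℂ) * I) ^ (2 * q))
    (by
      have : ContDiff ℝ 1 (fun y : ℝ => (y : ℂ)) := Complex.ofRealCLM.contDiff
      fun_prop) zero_lt_one
  obtain ⟨K₃, hK₃, hw₃⟩ := watson (a := μ) (r := 1) hμ zero_lt_one zero_lt_one hC₃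
    ((intervalIntegrable_jac_leg hμ1 zero_lt_one).mul_continuousOn (by fun_prop)) hb₃ hc
  -- the side from `i` to `1 + i`
  obtain ⟨M, hM⟩ := (isCompact_Icc (a := (0 : ℝ)) (b := 1)).exists_bound_of_continuousOn
    (f := fun σ : ℝ => jac (μ - 1) (σ + (1 : ℝ) * I) * ((σ : ℂ) + (1 : ℝ) * I) ^ (2 * q))
    ((continuousOn_jac_top _ zero_lt_one).mul (by fun_prop))
  have hM0 : 0 ≤ M := (norm_nonneg _).trans (hM 0 ⟨le_rfl, zero_le_one⟩)
  obtain ⟨K₄, hK₄, he₄⟩ := exists_exp_neg_le_rpow hc (((2 * q + 1 : ℕ) : ℝ) + 2)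
  obtain ⟨K₅, hK₅, he₅⟩ := exists_exp_neg_le_rpow hc (μ + 1)
  refine ⟨K₁ + K₃ + M * K₄ + M * K₅, by positivity, fun ζ hζ1 hζ => ?_⟩
  have hζ0 : ζ ≠ 0 := norm_pos_iff.mp (by linarith)
  have hcorner := integral_jac_mul_eq (a := μ - 1) hμ1 zero_lt_one
    (H := fun s => s ^ (2 * q) * cexp (I * (ζ * s))) (by fun_prop)
  have e₁ : (∫ y in (0 : ℝ)..1, jac (μ - 1) (y * I) * (((y : ℂ) * I) ^ (2 * q) *
      cexp (I * (ζ * (y * I))))) = (-1) ^ q * ∫ y in (0 : ℝ)..1, cexp (-(ζ * y)) *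
        ((((1 + 1 * y ^ 2) ^ (μ - 1) : ℝ) : ℂ) * (y : ℂ) ^ (2 * q)) := by
    rw [← intervalIntegral.integral_const_mul]
    refine intervalIntegral.integral_congr fun y _ => ?_
    rw [jac_mul_I, mul_I_pow_two_mul, show I * (ζ * ((y : ℂ) * I)) = -(ζ * y) by
      linear_combination (ζ * y) * I_mul_I, one_mul]
    ring
  have e₃ : (∫ y in (0 : ℝ)..1, jac (μ - 1) (1 + y * I) * ((1 + (y : ℂ) * I) ^ (2 * q) *
      cexp (I * (ζ * (1 + y * I))))) = cexp (I * ζ) * ∫ y in (0 : ℝ)..1, cexp (-(ζ * y)) *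
        (jac (μ - 1) (1 + y * I) * (1 + (y : ℂ) * I) ^ (2 * q)) := by
    rw [← intervalIntegral.integral_const_mul]
    refine intervalIntegral.integral_congr fun y _ => ?_
    rw [show I * (ζ * (1 + (y : ℂ) * I)) = I * ζ + -(ζ * y) by
      linear_combination (ζ * y) * I_mul_I, Complex.exp_add]
    ring
  have htop : ‖∫ σ in (0 : ℝ)..1, jac (μ - 1) (σ + (1 : ℝ) * I) * (((σ : ℂ) + (1 : ℝ) * I) ^ (2 * q) *
      cexp (I * (ζ * (σ + (1 : ℝ) * I))))‖ ≤
        M * (Real.exp (-(c * ‖ζ‖)) * (1 + Real.exp (-ζ.im))) := by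
    have := intervalIntegral.norm_integral_le_of_norm_le_const (a := (0 : ℝ)) (b := 1)
      (C := M * (Real.exp (-(c * ‖ζ‖)) * (1 + Real.exp (-ζ.im))))
      (f := fun σ : ℝ => jac (μ - 1) (σ + (1 : ℝ) * I) * (((σ : ℂ) + (1 : ℝ) * I) ^ (2 * q) *
        cexp (I * (ζ * (σ + (1 : ℝ) * I))))) ?_
    · simpa using this
    · intro σ hσ
      rw [uIoc_of_le zero_le_one] at hσ
      rw [← mul_assoc, norm_mul, norm_cexp_I_mul]
      refine mul_le_mul (hM σ ⟨hσ.1.le, hσ.2⟩) ?_ (Real.exp_pos _).le hM0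
      have e : -(ζ * ((σ : ℂ) + (1 : ℝ) * I)).im = -ζ.re + -(ζ.im * σ) := by simp; ring
      rw [e, Real.exp_add]
      refine mul_le_mul (Real.exp_le_exp.mpr (by linarith)) ?_ (Real.exp_pos _).le (Real.exp_pos _).le
      rcases le_total 0 ζ.im with h | h
      · have : Real.exp (-(ζ.im * σ)) ≤ 1 := Real.exp_le_one_iff.mpr (by nlinarith [hσ.1])
        linarith [Real.exp_pos (-ζ.im)]
      · have : Real.exp (-(ζ.im * σ)) ≤ Real.exp (-ζ.im) :=
          Real.exp_le_exp.mpr (by nlinarith [hσ.2])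
        linarith
  have w₁ := hw₁ ζ hζ0 hζ
  have w₃ := hw₃ ζ hζ0 hζ
  rw [Real.Gamma_nat_eq_factorial, show -((((2 * q : ℕ) : ℝ) + 1 : ℝ) : ℂ) = -(((2 * q + 1 : ℕ) : ℝ) : ℂ) by
    push_cast; ring, cpow_neg_ofReal_natCast, show -(((2 * q : ℕ) : ℝ) + 1) - 2 =
      -((2 * q + 1 : ℕ) : ℝ) - 2 by push_cast; ring] at w₁
  rw [weightTransform, hcorner, cornerIntegral, e₁, e₃]
  set A := ∫ y in (0 : ℝ)..1, cexp (-(ζ * y)) *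
        ((((1 + 1 * y ^ 2) ^ (μ - 1) : ℝ) : ℂ) * (y : ℂ) ^ (2 * q))
  set B := ∫ y in (0 : ℝ)..1, cexp (-(ζ * y)) *
        (jac (μ - 1) (1 + y * I) * (1 + (y : ℂ) * I) ^ (2 * q))
  set T := ∫ σ in (0 : ℝ)..1, jac (μ - 1) (σ + (1 : ℝ) * I) * (((σ : ℂ) + (1 : ℝ) * I) ^ (2 * q) *
      cexp (I * (ζ * (σ + (1 : ℝ) * I))))
  have hf := he₄ ‖ζ‖ hζ1
  have hf' := he₅ ‖ζ‖ hζ1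
  rw [show -(((2 * q + 1 : ℕ) : ℝ) + 2) = -((2 * q + 1 : ℕ) : ℝ) - 2 by ring] at hf
  rw [show -(μ + 1) = -μ - 1 by ring] at hf'
  set P := ‖ζ‖ ^ (-((2 * q + 1 : ℕ) : ℝ) - 2)
  set Q := ‖ζ‖ ^ (-μ - 1)
  have hP : 0 ≤ P := Real.rpow_nonneg (norm_nonneg _) _
  have hQ : 0 ≤ Q := Real.rpow_nonneg (norm_nonneg _) _
  have hE : 0 < Real.exp (-ζ.im) := Real.exp_pos _
  have n₁ : ‖(I * (-1) ^ q : ℂ)‖ = 1 := by simp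
  have n₂ : ‖-(I * cexp (I * ζ))‖ = Real.exp (-ζ.im) := by
    rw [norm_neg, norm_mul, norm_I, one_mul, norm_cexp_I_mul]
  calc _ = ‖(I * (-1) ^ q) * (A - 1 * (((2 * q).factorial : ℝ) * (ζ ^ (2 * q + 1))⁻¹)) +
        -(I * cexp (I * ζ)) * (B - (-2 * I) ^ ((μ - 1 : ℝ) : ℂ) * (1 + ((0 : ℝ) : ℂ) * I) ^ (2 * q) *
          ((Real.Gamma μ : ℂ) * ζ ^ (-μ : ℂ))) + T‖ := by
        congr 1
        rw [algCoeff, expCoeff]; push_cast; ring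
    _ ≤ ‖(I * (-1) ^ q) * (A - 1 * (((2 * q).factorial : ℝ) * (ζ ^ (2 * q + 1))⁻¹))‖ +
        ‖-(I * cexp (I * ζ)) * (B - (-2 * I) ^ ((μ - 1 : ℝ) : ℂ) * (1 + ((0 : ℝ) : ℂ) * I) ^ (2 * q) *
          ((Real.Gamma μ : ℂ) * ζ ^ (-μ : ℂ)))‖ + ‖T‖ := norm_add₃_le
    _ ≤ K₁ * P + Real.exp (-ζ.im) * (K₃ * Q) + M * (K₄ * P + K₅ * Q * Real.exp (-ζ.im)) := by
        refine add_le_add (add_le_add ?_ ?_) (htop.trans ?_)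
        · rw [norm_mul, n₁, one_mul]; exact w₁
        · rw [norm_mul, n₂]; gcongr
        · refine mul_le_mul_of_nonneg_left ?_ hM0
          rw [mul_add, mul_one]
          exact add_le_add hf (mul_le_mul_of_nonneg_right hf' hE.le)
    _ ≤ _ := by
        have h1 := mul_nonneg (mul_nonneg hM0 hK₅) hP
        have h2 := mul_nonneg (mul_nonneg hM0 hK₄) (mul_nonneg hQ hE.le)
        have h4 := mul_nonneg hK₁ (mul_nonneg hQ hE.le)
        nlinarith

/-- In the upper half-plane only the endpoint `0` contributes: the transform is a Laplace integral
in `-i ζ`, and the part over `[1 / 2, 1]` is exponentially small. -/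
theorem weightTransform_asymp_upper {μ : ℝ} (hμ : 0 < μ) (q : ℕ) {c : ℝ} (hc : 0 < c) :
    ∃ K, 0 ≤ K ∧ ∀ ζ : ℂ, 1 ≤ ‖ζ‖ → c * ‖ζ‖ ≤ ζ.im →
      ‖weightTransform μ q ζ - algCoeff q * (ζ ^ (2 * q + 1))⁻¹‖ ≤
      K * ‖ζ‖ ^ (-((2 * q + 1 : ℕ) : ℝ) - 2) := by
  have hμ1 : -1 < μ - 1 := by linarith
  obtain ⟨C₁, hC₁, hb₁⟩ := exists_one_add_rpow_bound (μ - 1) (κ := -1) (b := 1 / 2) (by norm_num)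
    (fun t ht => by linarith [ht.2])
  have hint : IntervalIntegrable (fun t : ℝ => jac (μ - 1) t * (t : ℂ) ^ (2 * q)) volume 0 1 :=
    (intervalIntegrable_jac hμ1).mul_continuousOn (by fun_prop)
  have hi₁ : IntervalIntegrable (fun t : ℝ => jac (μ - 1) t * (t : ℂ) ^ (2 * q)) volume 0 (1 / 2) :=
    hint.mono_set (by rw [uIcc_of_le zero_le_one, uIcc_of_le (by norm_num)]
                      exact Icc_subset_Icc le_rfl (by norm_num))
  have hi₂ : IntervalIntegrable (fun t : ℝ => jac (μ - 1) t * (t : ℂ) ^ (2 * q)) volume (1 / 2) 1 :=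
    hint.mono_set (by rw [uIcc_of_le zero_le_one, uIcc_of_le (by norm_num)]
                      exact Icc_subset_Icc (by norm_num) le_rfl)
  obtain ⟨K₁, hK₁, hw₁⟩ := watson (a := ((2 * q : ℕ) : ℝ) + 1) (r := 2) (b := 1 / 2) (by positivity)
    zero_lt_two (by norm_num) hC₁ (G := 1) hi₁
    (exists_even_bound q (fun t ht => by
      rw [jac_ofReal _ (by linarith [ht.1]) (by linarith [ht.2])]
      simpa [sub_eq_add_neg] using hb₁ t ht)) hc
  set M := ∫ t in (1 / 2 : ℝ)..1, ‖jac (μ - 1) t * (t : ℂ) ^ (2 * q)‖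
  have hM0 : 0 ≤ M := intervalIntegral.integral_nonneg (by norm_num) fun _ _ => norm_nonneg _
  obtain ⟨K₄, hK₄, he₄⟩ := exists_exp_neg_le_rpow (half_pos hc) (((2 * q + 1 : ℕ) : ℝ) + 2)
  refine ⟨K₁ + M * K₄, by positivity, fun ζ hζ1 hζ => ?_⟩
  have hζ0 : ζ ≠ 0 := norm_pos_iff.mp (by linarith)
  have w₁ := hw₁ (-I * ζ) (by simp [hζ0]) (by simpa using hζ)
  rw [Real.Gamma_nat_eq_factorial, show -((((2 * q : ℕ) : ℝ) + 1 : ℝ) : ℂ) = -(((2 * q + 1 : ℕ) : ℝ) : ℂ) by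
    push_cast; ring, cpow_neg_ofReal_natCast, show -(((2 * q : ℕ) : ℝ) + 1) - 2 =
      -((2 * q + 1 : ℕ) : ℝ) - 2 by push_cast; ring, norm_mul, norm_neg, norm_I, one_mul,
    one_mul] at w₁
  have hexp : ∀ t : ℝ, cexp (-(-I * ζ * t)) = cexp (I * (ζ * t)) := fun t => by ring_nf
  have e₁ : (((2 * q).factorial : ℝ) : ℂ) * ((-I * ζ) ^ (2 * q + 1))⁻¹ =
      algCoeff q * (ζ ^ (2 * q + 1))⁻¹ := by
    have : ((-I) ^ (2 * q + 1))⁻¹ = I * (-1) ^ q := by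
      rw [← inv_pow, inv_neg, inv_I, neg_neg, pow_succ, pow_mul, I_sq, mul_comm]
    rw [mul_pow, mul_inv, this, algCoeff]; push_cast; ring
  rw [e₁] at w₁
  simp_rw [hexp] at w₁
  have h₂ : ‖∫ t in (1 / 2 : ℝ)..1, cexp (I * (ζ * t)) * (jac (μ - 1) t * (t : ℂ) ^ (2 * q))‖ ≤
      M * (K₄ * ‖ζ‖ ^ (-((2 * q + 1 : ℕ) : ℝ) - 2)) := by
    have h1 := intervalIntegral.norm_integral_le_of_norm_le (a := (1 / 2 : ℝ)) (b := 1) (μ := volume)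
      (f := fun t : ℝ => cexp (I * (ζ * t)) * (jac (μ - 1) t * (t : ℂ) ^ (2 * q)))
      (g := fun t => Real.exp (-(c / 2 * ‖ζ‖)) * ‖jac (μ - 1) t * (t : ℂ) ^ (2 * q)‖) (by norm_num)
      (Filter.Eventually.of_forall fun t ht => by
        rw [norm_mul, norm_cexp_I_mul]
        refine mul_le_mul_of_nonneg_right (Real.exp_le_exp.mpr ?_) (norm_nonneg _)
        have : (ζ * t).im = ζ.im * t := by simp
        rw [this]
        nlinarith [ht.1, mul_pos hc (norm_pos_iff.mpr hζ0)]) (hi₂.norm.const_mul _)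
    rw [intervalIntegral.integral_const_mul] at h1
    have h2 := he₄ ‖ζ‖ hζ1
    rw [show -(((2 * q + 1 : ℕ) : ℝ) + 2) = -((2 * q + 1 : ℕ) : ℝ) - 2 by ring] at h2
    calc _ ≤ _ := h1
      _ ≤ _ := by rw [mul_comm]; gcongr
  have hsplit : weightTransform μ q ζ =
      (∫ t in (0 : ℝ)..(1 / 2), cexp (I * (ζ * t)) * (jac (μ - 1) t * (t : ℂ) ^ (2 * q))) +
      ∫ t in (1 / 2 : ℝ)..1, cexp (I * (ζ * t)) * (jac (μ - 1) t * (t : ℂ) ^ (2 * q)) := by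
    rw [intervalIntegral.integral_add_adjacent_intervals (hi₁.continuousOn_mul (by fun_prop))
      (hi₂.continuousOn_mul (by fun_prop)), weightTransform]
    exact intervalIntegral.integral_congr fun t _ => by ring
  rw [hsplit, add_sub_right_comm, add_mul, mul_assoc]
  exact (norm_add_le _ _).trans (add_le_add w₁ h₂)

/-! ### Asymptotics along the corner path -/

theorem mul_cpow_of_re_pos {z w : ℂ} (hz : 0 < z.re) (hw : 0 < w.re) (r : ℂ) :
    (z * w) ^ r = z ^ r * w ^ r := by
  have hz0 : z ≠ 0 := fun h => by simp [h] at hz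
  have hw0 : w ≠ 0 := fun h => by simp [h] at hw
  have h1 := abs_lt.mp (Complex.abs_arg_lt_pi_div_two_iff.mpr (Or.inl hz))
  have h2 := abs_lt.mp (Complex.abs_arg_lt_pi_div_two_iff.mpr (Or.inl hw))
  rw [Complex.cpow_def_of_ne_zero (mul_ne_zero hz0 hw0), Complex.cpow_def_of_ne_zero hz0,
    Complex.cpow_def_of_ne_zero hw0, Complex.log_mul hz0 hw0 ⟨by linarith, by linarith⟩,
    ← Complex.exp_add, add_mul]

theorem one_le_norm_one_add_mul_I (y : ℝ) : 1 ≤ ‖1 + (y : ℂ) * I‖ := by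
  have := Complex.abs_re_le_norm (1 + (y : ℂ) * I)
  simpa using this

theorem one_add_mul_I_ne_zero (y : ℝ) : 1 + (y : ℂ) * I ≠ 0 :=
  norm_pos_iff.mp (lt_of_lt_of_le one_pos (one_le_norm_one_add_mul_I y))

theorem norm_one_add_mul_I_le {y : ℝ} (h0 : 0 ≤ y) (h1 : y ≤ 1) : ‖1 + (y : ℂ) * I‖ ≤ 2 := by
  refine (norm_add_le _ _).trans ?_
  simp only [norm_one, norm_mul, norm_I, mul_one, Complex.norm_real, Real.norm_of_nonneg h0]
  linarith

theorem contDiff_one_add_mul_I_cpow (r : ℂ) : ContDiff ℝ 1 (fun y : ℝ => (1 + (y : ℂ) * I) ^ r) := by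
  rw [contDiff_iff_contDiffAt]
  intro t
  have h1 : AnalyticAt ℝ (fun t : ℝ => 1 + (t : ℂ) * I) t :=
    analyticAt_const.add ((Complex.ofRealCLM.analyticAt t).mul analyticAt_const)
  have h2 : AnalyticAt ℂ (fun z : ℂ => z ^ r) (1 + (t : ℂ) * I) :=
    AnalyticAt.cpow analyticAt_id analyticAt_const (Or.inl (by simp))
  exact (AnalyticAt.fun_comp (f := fun t : ℝ => 1 + (t : ℂ) * I)
    (h2.restrictScalars (𝕜 := ℝ)) h1).contDiffAt

/-- An entire function behaves like `α ζ ^ (-d)` plus an oscillatory term of amplitude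
`m ζ ^ (-μ) e ^ (i ζ)` in sectors about the positive real axis, and like `α ζ ^ (-d)` alone, up to
terms of size `e ^ (-Im ζ)`, in sectors about the positive imaginary axis. The factor `δ` marks
the algebraic error, so that `δ = 0` means that there is none. -/
structure HasExpAlgAsymptotics (J : ℂ → ℂ) (α m : ℂ) (d : ℕ) (μ δ : ℝ) : Prop where
  differentiable : Differentiable ℂ J
  right : ∀ c : ℝ, 0 < c → ∃ K, 0 ≤ K ∧ ∀ ζ : ℂ, 1 ≤ ‖ζ‖ → c * ‖ζ‖ ≤ ζ.re →
    ‖J ζ - α * (ζ ^ d)⁻¹ - m * cexp (I * ζ) * ζ ^ (-μ : ℂ)‖ ≤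
      δ * (K * ‖ζ‖ ^ (-(d : ℝ) - 2)) + K * (‖ζ‖ ^ (-μ - 1) * Real.exp (-ζ.im))
  upper : ∀ c : ℝ, 0 < c → ∃ K, 0 ≤ K ∧ ∀ ζ : ℂ, 1 ≤ ‖ζ‖ → c * ‖ζ‖ ≤ ζ.im →
    ‖J ζ - α * (ζ ^ d)⁻¹‖ ≤ δ * (K * ‖ζ‖ ^ (-(d : ℝ) - 2)) + K * Real.exp (-ζ.im)

/-- For `s` on the side `i b → 1 + i b` and `x` in a sector about the positive real axis, the point
`x s` stays in one of the two kinds of sectors of `HasExpAlgAsymptotics`. -/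
theorem re_or_im_large {c b σ : ℝ} (hc : 0 < c) (hb : 0 < b) (hb1 : b ≤ 1) (hσ0 : 0 ≤ σ)
    (hσ1 : σ ≤ 1) {x : ℂ} (hx : c * ‖x‖ ≤ x.re) :
    b ^ 2 * c / 4 * ‖x * (σ + b * I)‖ ≤ (x * (σ + b * I)).re ∨
      b ^ 2 * c / 4 * ‖x * (σ + b * I)‖ ≤ (x * (σ + b * I)).im := by
  have hre : (x * (σ + b * I)).re = σ * x.re - b * x.im := by simp; ring
  have him : (x * (σ + b * I)).im = σ * x.im + b * x.re := by simp; ring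
  have hn : ‖x * (σ + b * I)‖ ≤ 2 * ‖x‖ := by
    rw [norm_mul]
    have : ‖(σ : ℂ) + b * I‖ ≤ 2 := by
      refine (norm_add_le _ _).trans ?_
      simp only [norm_mul, norm_I, mul_one, Complex.norm_real, Real.norm_of_nonneg hσ0,
        Real.norm_of_nonneg hb.le]
      linarith
    nlinarith [norm_nonneg x]
  have hn' : b ^ 2 * c / 4 * ‖x * (σ + b * I)‖ ≤ b ^ 2 * c / 2 * ‖x‖ := by
    have : 0 < b ^ 2 * c / 4 := by positivity
    nlinarith
  rw [hre, him]
  have hbx : b * (c * ‖x‖) ≤ b * x.re := by gcongr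
  have hbb : b ^ 2 * c / 2 * ‖x‖ ≤ b * (c * ‖x‖) / 2 := by
    have : b * (b * (c * ‖x‖)) ≤ 1 * (b * (c * ‖x‖)) := by gcongr
    nlinarith
  have hxr : 0 ≤ x.re := le_trans (by positivity) hx
  rcases le_total 0 x.im with h | h
  · right
    nlinarith [mul_nonneg hσ0 h]
  · by_cases h2 : σ * (-x.im) ≤ b * x.re / 2
    · right; linarith
    · left
      push Not at h2
      have h3 : b * x.re / 2 ≤ -x.im := by nlinarith
      nlinarith [mul_nonneg hσ0 hxr]

/-- The contribution of the side `i b → 1 + i b`: there the oscillatory part is exponentially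
smaller than `e ^ |Im x|`. -/
theorem HasExpAlgAsymptotics.top {J : ℂ → ℂ} {α m : ℂ} {d : ℕ} {μ δ : ℝ}
    (h : HasExpAlgAsymptotics J α m d μ δ) (hμ : 0 ≤ μ) (hδ : 0 ≤ δ) (a : ℝ)
    {c b : ℝ} (hc : 0 < c) (hb : 0 < b) (hb1 : b ≤ 1) (N : ℝ) :
    ∃ K, 0 ≤ K ∧ ∀ x : ℂ, b⁻¹ ≤ ‖x‖ → c * ‖x‖ ≤ x.re →
      ‖(∫ σ in (0 : ℝ)..1, jac a (σ + b * I) * J (x * (σ + b * I))) -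
        α * (∫ σ in (0 : ℝ)..1, jac a (σ + b * I) * (((σ : ℂ) + b * I) ^ d)⁻¹) * (x ^ d)⁻¹‖ ≤
      δ * (K * ‖x‖ ^ (-(d : ℝ) - 2)) + K * (‖x‖ ^ (-N) * Real.exp |x.im|) := by
  set c' := b ^ 2 * c / 4
  have hc'0 : 0 < c' := by positivity
  obtain ⟨K₁, hK₁, h₁⟩ := h.right c' hc'0
  obtain ⟨K₂, hK₂, h₂⟩ := h.upper c' hc'0
  obtain ⟨M, hM⟩ := (isCompact_Icc (a := (0 : ℝ)) (b := 1)).exists_bound_of_continuousOn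
    (continuousOn_jac_top a hb)
  have hM0 : 0 ≤ M := (norm_nonneg _).trans (hM 0 ⟨le_rfl, zero_le_one⟩)
  obtain ⟨K₅, hK₅, h₅⟩ := exists_exp_neg_le_rpow (mul_pos hb hc) N
  set K := K₁ + K₂ + ‖m‖ with hK
  refine ⟨M * (K * b ^ (-(d : ℝ) - 2)) + M * (K * K₅), by positivity, fun x hxb hx => ?_⟩
  have hx0 : 0 < ‖x‖ := (inv_pos.mpr hb).trans_le hxb
  have hx1 : 1 ≤ ‖x‖ := (one_le_inv₀ hb |>.mpr hb1).trans hxb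
  have hcont : Continuous fun σ : ℝ => (σ : ℂ) + b * I := by fun_prop
  have hne : ∀ σ : ℝ, (σ : ℂ) + b * I ≠ 0 := fun σ hσ => hb.ne' (by
    simpa using congrArg Complex.im hσ)
  have hic : ContinuousOn (fun σ : ℝ => jac a (σ + b * I)) (uIcc 0 1) := by
    rw [uIcc_of_le zero_le_one]; exact continuousOn_jac_top a hb
  have i1 : IntervalIntegrable (fun σ : ℝ => jac a (σ + b * I) * J (x * (σ + b * I))) volume 0 1 :=
    (hic.mul (h.differentiable.continuous.comp (by fun_prop)).continuousOn).intervalIntegrable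
  have i2 : IntervalIntegrable (fun σ : ℝ => jac a (σ + b * I) * (((σ : ℂ) + b * I) ^ d)⁻¹)
      volume 0 1 :=
    (hic.mul ((hcont.pow d).inv₀ fun σ => pow_ne_zero _ (hne σ)).continuousOn).intervalIntegrable
  rw [mul_assoc, ← intervalIntegral.integral_mul_const, ← intervalIntegral.integral_const_mul,
    ← intervalIntegral.integral_sub i1 ((i2.mul_const _).const_mul _)]
  have hpt : ∀ σ ∈ uIoc (0 : ℝ) 1, ‖jac a (σ + b * I) * J (x * (σ + b * I)) -
      α * (jac a (σ + b * I) * (((σ : ℂ) + b * I) ^ d)⁻¹ * (x ^ d)⁻¹)‖ ≤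
      M * (δ * (K * (b ^ (-(d : ℝ) - 2) * ‖x‖ ^ (-(d : ℝ) - 2))) +
        K * (K₅ * (‖x‖ ^ (-N) * Real.exp |x.im|))) := by
    intro σ hσ
    rw [uIoc_of_le zero_le_one] at hσ
    set ζ := x * (σ + b * I) with hζ
    have e : jac a (σ + b * I) * J ζ - α * (jac a (σ + b * I) * (((σ : ℂ) + b * I) ^ d)⁻¹ *
        (x ^ d)⁻¹) = jac a (σ + b * I) * (J ζ - α * (ζ ^ d)⁻¹) := by
      rw [hζ, mul_pow, mul_inv]; ring
    rw [e, norm_mul]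
    refine mul_le_mul (hM σ ⟨hσ.1.le, hσ.2⟩) ?_ (norm_nonneg _) hM0
    have hζn : b * ‖x‖ ≤ ‖ζ‖ := by
      have : b ≤ ‖(σ : ℂ) + b * I‖ := by
        have := Complex.abs_im_le_norm ((σ : ℂ) + b * I)
        simpa [abs_of_pos hb] using this
      rw [hζ, norm_mul, mul_comm]; gcongr
    have hζ1 : 1 ≤ ‖ζ‖ := le_trans (by rw [← div_le_iff₀' hb, one_div]; exact hxb) hζn
    have hζim : -ζ.im ≤ |x.im| - b * c * ‖x‖ := by
      have him : ζ.im = σ * x.im + b * x.re := by simp [hζ]; ring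
      have h3 : -(σ * x.im) ≤ |x.im| := by
        have := neg_abs_le x.im
        have := abs_nonneg x.im
        nlinarith [hσ.1, hσ.2]
      have h4 : b * (c * ‖x‖) ≤ b * x.re := by gcongr
      rw [him]; linarith
    -- `Im ζ` exceeds `-|Im x|` by a multiple of `‖x‖`, which leaves room for any power of `‖x‖`
    have hexp : Real.exp (-ζ.im) ≤ K₅ * (‖x‖ ^ (-N) * Real.exp |x.im|) := by
      calc _ ≤ Real.exp (|x.im| + -(b * c * ‖x‖)) := Real.exp_le_exp.mpr (by linarith)
        _ = Real.exp |x.im| * Real.exp (-(b * c * ‖x‖)) := Real.exp_add _ _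
        _ ≤ Real.exp |x.im| * (K₅ * ‖x‖ ^ (-N)) := by gcongr; exact h₅ _ hx1
        _ = _ := by ring
    have hpow : ‖ζ‖ ^ (-(d : ℝ) - 2) ≤ b ^ (-(d : ℝ) - 2) * ‖x‖ ^ (-(d : ℝ) - 2) := by
      rw [← Real.mul_rpow hb.le hx0.le]
      exact Real.rpow_le_rpow_of_nonpos (by positivity) hζn (by linarith)
    have hcomb : ‖J ζ - α * (ζ ^ d)⁻¹‖ ≤
        δ * (K * ‖ζ‖ ^ (-(d : ℝ) - 2)) + K * Real.exp (-ζ.im) := by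
      rcases re_or_im_large hc hb hb1 hσ.1.le hσ.2 hx with h3 | h3
      · have h4 := h₁ ζ hζ1 h3
        have h5 : ‖m * cexp (I * ζ) * ζ ^ (-μ : ℂ)‖ ≤ ‖m‖ * Real.exp (-ζ.im) := by
          rw [norm_mul, norm_mul, norm_cexp_I_mul, ← Complex.ofReal_neg, Complex.norm_cpow_real]
          have : ‖ζ‖ ^ (-μ) ≤ 1 := Real.rpow_le_one_of_one_le_of_nonpos hζ1 (by linarith)
          exact mul_le_of_le_one_right (by positivity) this
        have h6 : ‖ζ‖ ^ (-μ - 1) ≤ 1 := Real.rpow_le_one_of_one_le_of_nonpos hζ1 (by linarith)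
        calc _ = ‖(J ζ - α * (ζ ^ d)⁻¹ - m * cexp (I * ζ) * ζ ^ (-μ : ℂ)) +
              m * cexp (I * ζ) * ζ ^ (-μ : ℂ)‖ := by rw [sub_add_cancel]
          _ ≤ _ := norm_add_le _ _
          _ ≤ δ * (K₁ * ‖ζ‖ ^ (-(d : ℝ) - 2)) + K₁ * (1 * Real.exp (-ζ.im)) +
              ‖m‖ * Real.exp (-ζ.im) := by
                refine add_le_add (h4.trans ?_) h5
                gcongr
          _ = δ * (K₁ * ‖ζ‖ ^ (-(d : ℝ) - 2)) + (K₁ + ‖m‖) * Real.exp (-ζ.im) := by ring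
          _ ≤ _ := by
                gcongr
                · rw [hK]; linarith [norm_nonneg m]
                · rw [hK]; linarith
      · refine (h₂ ζ hζ1 h3).trans ?_
        have : K₂ ≤ K := by rw [hK]; linarith [norm_nonneg m]
        gcongr
    refine hcomb.trans ?_
    gcongr
  have := intervalIntegral.norm_integral_le_of_norm_le_const hpt
  rw [sub_zero, abs_one, mul_one] at this
  refine this.trans ?_
  set P := ‖x‖ ^ (-(d : ℝ) - 2)
  set Q := ‖x‖ ^ (-N) * Real.exp |x.im|
  have t1 : 0 ≤ δ * (M * (K * K₅) * P) := by positivity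
  have t2 : 0 ≤ M * (K * b ^ (-(d : ℝ) - 2)) * Q := by positivity
  linarith

theorem exists_norm_jac_leg_le (a : ℝ) (b : ℝ) : ∃ L, 0 ≤ L ∧ ∀ y ∈ Ioc 0 b,
    ‖jac (a - 1) (1 + y * I)‖ ≤ L * y ^ (a - 1) := by
  obtain ⟨L, hL⟩ := (isCompact_Icc (a := (0 : ℝ)) (b := b)).exists_bound_of_continuousOn
    (continuous_sub_two_I_cpow ((a - 1 : ℝ) : ℂ)).continuousOn
  refine ⟨max L 0, le_max_right _ _, fun y hy => ?_⟩
  rw [jac_one_add_mul_I _ hy.1, norm_mul, Complex.norm_real,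
    Real.norm_of_nonneg (Real.rpow_nonneg hy.1.le _), mul_comm]
  have := (hL y ⟨hy.1.le, hy.2⟩).trans (le_max_left _ 0)
  have h2 := Real.rpow_nonneg hy.1.le (a - 1)
  gcongr

theorem integral_rpow_mul_exp_le {a : ℝ} (ha : 0 < a) {b r : ℝ} (hb : 0 ≤ b) (hr : 0 < r) :
    ∫ y in (0 : ℝ)..b, y ^ (a - 1) * Real.exp (-(r * y)) ≤ Real.Gamma a * r ^ (-a) := by
  rw [intervalIntegral.integral_of_le hb]
  refine (setIntegral_mono_set (integrableOn_rpow_mul_exp ha hr) ?_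
    Ioc_subset_Ioi_self.eventuallyLE).trans ?_
  · filter_upwards [ae_restrict_mem measurableSet_Ioi] with t ht
    exact mul_nonneg (Real.rpow_nonneg (le_of_lt ht) _) (Real.exp_pos _).le
  · rw [Real.integral_rpow_mul_exp_neg_mul_Ioi ha hr, one_div, Real.inv_rpow hr.le,
      ← Real.rpow_neg hr.le, mul_comm]

/-- The contribution of the leg `1 + i b → 1`: the oscillatory part is evaluated with Watson's
lemma at the endpoint `1`. The bound `b ≤ c / 2` keeps `x s` in a sector about the positive real
axis. -/
theorem HasExpAlgAsymptotics.leg {J : ℂ → ℂ} {α m : ℂ} {d : ℕ} {μ δ : ℝ}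
    (h : HasExpAlgAsymptotics J α m d μ δ) (hμ : 0 ≤ μ) (hδ : 0 ≤ δ)
    {a : ℝ} (ha : 0 < a) {c b : ℝ} (hc : 0 < c) (hb : 0 < b) (hbc : b ≤ c / 2) (hb1 : b ≤ 1) :
    ∃ K, 0 ≤ K ∧ ∀ x : ℂ, 1 ≤ ‖x‖ → c * ‖x‖ ≤ x.re →
      ‖(∫ y in (0 : ℝ)..b, jac (a - 1) (1 + y * I) * J (x * (1 + y * I))) -
        α * (∫ y in (0 : ℝ)..b, jac (a - 1) (1 + y * I) * ((1 + (y : ℂ) * I) ^ d)⁻¹) * (x ^ d)⁻¹ -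
        m * ((-2 * I) ^ ((a - 1 : ℝ) : ℂ) * Real.Gamma a) * cexp (I * x) *
          x ^ (-(μ + a) : ℂ)‖ ≤
      δ * (K * ‖x‖ ^ (-(d : ℝ) - 2)) + K * (‖x‖ ^ (-(μ + a + 1)) * Real.exp |x.im|) := by
  have ha1 : -1 < a - 1 := by linarith
  obtain ⟨K₁, hK₁, h₁⟩ := h.right (c / 4) (by positivity)
  obtain ⟨C₃, hC₃, hb₃⟩ := exists_leg_bound a (contDiff_one_add_mul_I_cpow (-μ : ℂ)) hb
  have hjac := intervalIntegrable_jac_leg ha1 hb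
  obtain ⟨K₃, hK₃, hw₃⟩ := watson (r := 1) ha zero_lt_one hb hC₃
    (hjac.mul_continuousOn (contDiff_one_add_mul_I_cpow (-μ : ℂ)).continuous.continuousOn) hb₃ hc
  obtain ⟨L, hL0, hL⟩ := exists_norm_jac_leg_le a b
  set M := ∫ y in (0 : ℝ)..b, ‖jac (a - 1) (1 + y * I)‖
  have hM0 : 0 ≤ M := intervalIntegral.integral_nonneg hb.le fun _ _ => norm_nonneg _
  refine ⟨K₁ * M + ‖m‖ * K₃ + K₁ * (L * (Real.Gamma a * c ^ (-a))), by positivity,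
    fun x hx1 hx => ?_⟩
  have hx0 : 0 < ‖x‖ := by linarith
  have hxne : x ≠ 0 := norm_pos_iff.mp hx0
  have hxre : 0 < x.re := lt_of_lt_of_le (by positivity) hx
  -- the remainder of the expansion of `J` at the point `x (1 + i y)`
  set R : ℝ → ℂ := fun y => J (x * (1 + y * I)) - α * ((x * (1 + y * I)) ^ d)⁻¹ -
    m * cexp (I * (x * (1 + y * I))) * (x * (1 + y * I)) ^ (-μ : ℂ) with hR
  have hfac : ∀ y : ℝ, m * cexp (I * (x * (1 + y * I))) * (x * (1 + y * I)) ^ (-μ : ℂ) =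
      m * cexp (I * x) * x ^ (-μ : ℂ) * (cexp (-(x * y)) * (1 + (y : ℂ) * I) ^ (-μ : ℂ)) := by
    intro y
    rw [mul_cpow_of_re_pos hxre (by simp), show I * (x * (1 + (y : ℂ) * I)) = I * x + -(x * y) by
      linear_combination (x * y) * I_mul_I, Complex.exp_add]
    ring
  have hJdec : ∀ y : ℝ, jac (a - 1) (1 + y * I) * J (x * (1 + y * I)) =
      α * (jac (a - 1) (1 + y * I) * ((1 + (y : ℂ) * I) ^ d)⁻¹) * (x ^ d)⁻¹ +
      m * cexp (I * x) * x ^ (-μ : ℂ) *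
        (cexp (-(x * y)) * (jac (a - 1) (1 + y * I) * (1 + (y : ℂ) * I) ^ (-μ : ℂ))) +
      jac (a - 1) (1 + y * I) * R y := by
    intro y
    simp only [hR]
    rw [hfac y, mul_pow, mul_inv]; ring
  have hcd : Continuous fun y : ℝ => ((1 + (y : ℂ) * I) ^ d)⁻¹ :=
    Continuous.inv₀ (by fun_prop) fun y => pow_ne_zero _ (one_add_mul_I_ne_zero y)
  have hcμ := (contDiff_one_add_mul_I_cpow (-μ : ℂ)).continuous
  have hRc : Continuous R := by
    have e : R = fun y : ℝ => J (x * (1 + y * I)) - α * ((x ^ d)⁻¹ * ((1 + (y : ℂ) * I) ^ d)⁻¹) -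
        m * cexp (I * x) * x ^ (-μ : ℂ) * (cexp (-(x * y)) * (1 + (y : ℂ) * I) ^ (-μ : ℂ)) := by
      funext y; simp only [hR]; rw [hfac y, mul_pow, mul_inv]
    rw [e]
    have := h.differentiable.continuous
    fun_prop
  have j1 : IntervalIntegrable (fun y : ℝ => jac (a - 1) (1 + y * I) * ((1 + (y : ℂ) * I) ^ d)⁻¹)
      volume 0 b := hjac.mul_continuousOn hcd.continuousOn
  have j2 : IntervalIntegrable (fun y : ℝ => cexp (-(x * y)) *
      (jac (a - 1) (1 + y * I) * (1 + (y : ℂ) * I) ^ (-μ : ℂ))) volume 0 b :=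
    (hjac.mul_continuousOn hcμ.continuousOn).continuousOn_mul (by fun_prop)
  have j3 : IntervalIntegrable (fun y : ℝ => jac (a - 1) (1 + y * I) * R y) volume 0 b :=
    hjac.mul_continuousOn hRc.continuousOn
  have hsplit : (∫ y in (0 : ℝ)..b, jac (a - 1) (1 + y * I) * J (x * (1 + y * I))) =
      α * (∫ y in (0 : ℝ)..b, jac (a - 1) (1 + y * I) * ((1 + (y : ℂ) * I) ^ d)⁻¹) * (x ^ d)⁻¹ +
      m * cexp (I * x) * x ^ (-μ : ℂ) * (∫ y in (0 : ℝ)..b, cexp (-(x * y)) *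
        (jac (a - 1) (1 + y * I) * (1 + (y : ℂ) * I) ^ (-μ : ℂ))) +
      ∫ y in (0 : ℝ)..b, jac (a - 1) (1 + y * I) * R y := by
    rw [intervalIntegral.integral_congr (fun y _ => hJdec y), intervalIntegral.integral_add
      (((j1.const_mul _).mul_const _).add (j2.const_mul _)) j3, intervalIntegral.integral_add
      ((j1.const_mul _).mul_const _) (j2.const_mul _), intervalIntegral.integral_const_mul,
      intervalIntegral.integral_mul_const, intervalIntegral.integral_const_mul]
  have w₃ := hw₃ x hxne hx
  have hRb : ∀ y ∈ Ioc (0 : ℝ) b, ‖jac (a - 1) (1 + y * I) * R y‖ ≤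
      δ * (K₁ * ‖x‖ ^ (-(d : ℝ) - 2)) * ‖jac (a - 1) (1 + y * I)‖ +
      K₁ * (‖x‖ ^ (-μ - 1) * Real.exp |x.im|) * L *
        (y ^ (a - 1) * Real.exp (-(c * ‖x‖ * y))) := by
    intro y hy
    set ζ := x * (1 + (y : ℂ) * I) with hζ
    have hζx : ‖x‖ ≤ ‖ζ‖ := by
      rw [hζ, norm_mul]; exact le_mul_of_one_le_right hx0.le (one_le_norm_one_add_mul_I y)
    have hζx2 : ‖ζ‖ ≤ 2 * ‖x‖ := by
      rw [hζ, norm_mul, mul_comm]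
      have := norm_one_add_mul_I_le hy.1.le (hy.2.trans hb1)
      gcongr
    have hre : ζ.re = x.re - y * x.im := by simp [hζ]; ring
    have him : ζ.im = x.im + y * x.re := by simp [hζ]; ring
    have hζre : c / 4 * ‖ζ‖ ≤ ζ.re := by
      have h3 : y * x.im ≤ c / 2 * ‖x‖ := by
        have h5 : y * x.im ≤ y * ‖x‖ :=
          mul_le_mul_of_nonneg_left ((le_abs_self _).trans (Complex.abs_im_le_norm x)) hy.1.le
        have h6 : y * ‖x‖ ≤ c / 2 * ‖x‖ :=
          mul_le_mul_of_nonneg_right (hy.2.trans hbc) hx0.le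
        linarith
      rw [hre]; nlinarith
    have h4 : ‖R y‖ ≤ _ := h₁ ζ (hx1.trans hζx) hζre
    have p1 : ‖ζ‖ ^ (-(d : ℝ) - 2) ≤ ‖x‖ ^ (-(d : ℝ) - 2) :=
      Real.rpow_le_rpow_of_nonpos hx0 hζx (by linarith)
    have p2 : ‖ζ‖ ^ (-μ - 1) ≤ ‖x‖ ^ (-μ - 1) :=
      Real.rpow_le_rpow_of_nonpos hx0 hζx (by linarith)
    have p3 : Real.exp (-ζ.im) ≤ Real.exp |x.im| * Real.exp (-(c * ‖x‖ * y)) := by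
      rw [← Real.exp_add, him]
      refine Real.exp_le_exp.mpr ?_
      have := neg_abs_le x.im
      nlinarith [hy.1]
    have hj := hL y hy
    have hj0 := norm_nonneg (jac (a - 1) (1 + y * I))
    rw [norm_mul]
    calc _ ≤ ‖jac (a - 1) (1 + y * I)‖ * (δ * (K₁ * ‖x‖ ^ (-(d : ℝ) - 2)) +
            K₁ * (‖x‖ ^ (-μ - 1) * (Real.exp |x.im| * Real.exp (-(c * ‖x‖ * y))))) := by
          refine mul_le_mul_of_nonneg_left (h4.trans ?_) hj0
          gcongr
      _ = δ * (K₁ * ‖x‖ ^ (-(d : ℝ) - 2)) * ‖jac (a - 1) (1 + y * I)‖ +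
            ‖jac (a - 1) (1 + y * I)‖ * (K₁ * (‖x‖ ^ (-μ - 1) *
              (Real.exp |x.im| * Real.exp (-(c * ‖x‖ * y))))) := by ring
      _ ≤ δ * (K₁ * ‖x‖ ^ (-(d : ℝ) - 2)) * ‖jac (a - 1) (1 + y * I)‖ +
            (L * y ^ (a - 1)) * (K₁ * (‖x‖ ^ (-μ - 1) *
              (Real.exp |x.im| * Real.exp (-(c * ‖x‖ * y))))) := by gcongr
      _ = _ := by ring
  have hcx : 0 < c * ‖x‖ := by positivity
  have k2 : IntervalIntegrable (fun y : ℝ => y ^ (a - 1) * Real.exp (-(c * ‖x‖ * y))) volume 0 b :=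
    (intervalIntegral.intervalIntegrable_rpow' ha1).mul_continuousOn (by fun_prop)
  have hRint : ‖∫ y in (0 : ℝ)..b, jac (a - 1) (1 + y * I) * R y‖ ≤
      δ * (K₁ * ‖x‖ ^ (-(d : ℝ) - 2)) * M +
      K₁ * (L * (Real.Gamma a * c ^ (-a))) * (‖x‖ ^ (-(μ + a + 1)) * Real.exp |x.im|) := by
    have h3 := intervalIntegral.norm_integral_le_of_norm_le hb.le
      (Filter.Eventually.of_forall hRb)
      ((hjac.norm.const_mul _).add (k2.const_mul _))
    rw [intervalIntegral.integral_add (hjac.norm.const_mul _) (k2.const_mul _),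
      intervalIntegral.integral_const_mul, intervalIntegral.integral_const_mul] at h3
    refine h3.trans (add_le_add le_rfl ?_)
    have h4 := integral_rpow_mul_exp_le ha hb.le hcx
    calc _ ≤ K₁ * (‖x‖ ^ (-μ - 1) * Real.exp |x.im|) * L *
          (Real.Gamma a * (c * ‖x‖) ^ (-a)) := by gcongr
      _ = _ := by
        rw [Real.mul_rpow hc.le hx0.le, show -(μ + a + 1) = (-μ - 1) + -a by ring,
          Real.rpow_add hx0]
        ring
  have hcp : x ^ (-(μ + a) : ℂ) = x ^ (-μ : ℂ) * x ^ (-a : ℂ) := by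
    rw [← Complex.cpow_add _ _ hxne]; ring_nf
  rw [hsplit]
  set W := ∫ y in (0 : ℝ)..b, cexp (-(x * y)) *
        (jac (a - 1) (1 + y * I) * (1 + (y : ℂ) * I) ^ (-μ : ℂ))
  set S := ∫ y in (0 : ℝ)..b, jac (a - 1) (1 + y * I) * R y
  have hWb : ‖m * cexp (I * x) * x ^ (-μ : ℂ) * (W - (-2 * I) ^ ((a - 1 : ℝ) : ℂ) *
      (1 + ((0 : ℝ) : ℂ) * I) ^ (-μ : ℂ) * (Real.Gamma a * x ^ (-a : ℂ)))‖ ≤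
      ‖m‖ * K₃ * (‖x‖ ^ (-(μ + a + 1)) * Real.exp |x.im|) := by
    rw [norm_mul, norm_mul, norm_mul, norm_cexp_I_mul, ← Complex.ofReal_neg μ,
      Complex.norm_cpow_real]
    have hE : Real.exp (-x.im) ≤ Real.exp |x.im| := Real.exp_le_exp.mpr (neg_le_abs _)
    rw [← Complex.ofReal_neg μ] at w₃
    calc _ ≤ ‖m‖ * Real.exp |x.im| * ‖x‖ ^ (-μ) * (K₃ * ‖x‖ ^ (-a - 1)) := by
          gcongr
      _ = _ := by
        rw [show -(μ + a + 1) = -μ + (-a - 1) by ring, Real.rpow_add hx0]; ring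
  have hfin : ∀ Z : ℂ, Z + m * cexp (I * x) * x ^ (-μ : ℂ) * W + S - Z -
      m * ((-2 * I) ^ ((a - 1 : ℝ) : ℂ) * Real.Gamma a) * cexp (I * x) * x ^ (-(μ + a) : ℂ) =
      m * cexp (I * x) * x ^ (-μ : ℂ) * (W - (-2 * I) ^ ((a - 1 : ℝ) : ℂ) *
      (1 + ((0 : ℝ) : ℂ) * I) ^ (-μ : ℂ) * (Real.Gamma a * x ^ (-a : ℂ))) + S := by
    intro Z
    rw [hcp]; simp; ring
  rw [hfin]
  refine (norm_add_le _ _).trans ((add_le_add hWb hRint).trans ?_)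
  set P := ‖x‖ ^ (-(d : ℝ) - 2)
  set Q := ‖x‖ ^ (-(μ + a + 1)) * Real.exp |x.im|
  have t1 : 0 ≤ δ * ((‖m‖ * K₃ + K₁ * (L * (Real.Gamma a * c ^ (-a)))) * P) := by positivity
  have t2 : 0 ≤ K₁ * M * Q := by positivity
  linarith

/-! ### The symmetric integral -/

theorem integral_conj_ofReal {f : ℝ → ℂ} {a b : ℝ} :
    ∫ t in a..b, conj (f t) = conj (∫ t in a..b, f t) := by
  rw [intervalIntegral, intervalIntegral, integral_conj, integral_conj, map_sub]

/-- The coefficient of the oscillatory part of `∫ (1 - s²) ^ (a - 1) J (x s)` along the corner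
path. -/
def cornerCoeff (a : ℝ) (m : ℂ) : ℂ := -(I * (m * ((-2 * I) ^ ((a - 1 : ℝ) : ℂ) * Real.Gamma a)))

/-- The expansion of `J` may be integrated termwise over the corner path. -/
theorem HasExpAlgAsymptotics.corner {J : ℂ → ℂ} {α m : ℂ} {d : ℕ} {μ δ : ℝ}
    (h : HasExpAlgAsymptotics J α m d μ δ) (hμ : 0 ≤ μ) (hδ : 0 ≤ δ)
    {a : ℝ} (ha : 0 < a) {c b : ℝ} (hc : 0 < c) (hb : 0 < b) (hbc : b ≤ c / 2) (hb1 : b ≤ 1) :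
    ∃ K, 0 ≤ K ∧ ∀ x : ℂ, b⁻¹ ≤ ‖x‖ → c * ‖x‖ ≤ x.re →
      ‖cornerIntegral b (fun s => jac (a - 1) s * J (x * s)) -
        α * cornerIntegral b (fun s => jac (a - 1) s * (s ^ d)⁻¹) * (x ^ d)⁻¹ -
        cornerCoeff a m * cexp (I * x) * x ^ (-(μ + a) : ℂ)‖ ≤
      δ * (K * ‖x‖ ^ (-(d : ℝ) - 2)) + K * (‖x‖ ^ (-(μ + a + 1)) * Real.exp |x.im|) := by
  obtain ⟨K₁, hK₁, h₁⟩ := h.top hμ hδ (a - 1) hc hb hb1 (μ + a + 1)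
  obtain ⟨K₂, hK₂, h₂⟩ := h.leg hμ hδ ha hc hb hbc hb1
  refine ⟨K₁ + K₂, by positivity, fun x hxb hx => ?_⟩
  have e₁ := h₁ x hxb hx
  have e₂ := h₂ x ((one_le_inv₀ hb |>.mpr hb1).trans hxb) hx
  rw [cornerIntegral, cornerIntegral]
  set T := ∫ σ in (0 : ℝ)..1, jac (a - 1) (σ + b * I) * J (x * (σ + b * I))
  set T' := ∫ σ in (0 : ℝ)..1, jac (a - 1) (σ + b * I) * (((σ : ℂ) + b * I) ^ d)⁻¹
  set S := ∫ y in (0 : ℝ)..b, jac (a - 1) (1 + y * I) * J (x * (1 + y * I))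
  set S' := ∫ y in (0 : ℝ)..b, jac (a - 1) (1 + y * I) * ((1 + (y : ℂ) * I) ^ d)⁻¹
  set E := x ^ (-(μ + a) : ℂ)
  calc _ = ‖(T - α * T' * (x ^ d)⁻¹) + (-I) * (S - α * S' * (x ^ d)⁻¹ -
        m * ((-2 * I) ^ ((a - 1 : ℝ) : ℂ) * Real.Gamma a) * cexp (I * x) * E)‖ := by
        congr 1; rw [cornerCoeff]; ring
    _ ≤ _ := norm_add_le _ _
    _ = _ := by rw [norm_mul (-I), norm_neg, norm_I, one_mul]
    _ ≤ _ := add_le_add e₁ e₂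
    _ = _ := by ring

/-- The symmetric integral over `[0, 1]` is the sum of the corner integral and of its complex
conjugate: the integrals over the imaginary axis cancel because the weight is even. -/
theorem integral_symm_eq {J : ℂ → ℂ} (hJ : Differentiable ℂ J) (hsymm : ∀ ζ, J (-ζ) = conj (J (conj ζ)))
    {a : ℝ} (ha : 0 < a) {b : ℝ} (hb : 0 < b) (x : ℂ) :
    ∫ s in (0 : ℝ)..1, jac (a - 1) s * (J (x * s) + J (-(x * s))) =
      cornerIntegral b (fun s => jac (a - 1) s * J (x * s)) +
        conj (cornerIntegral b (fun s => jac (a - 1) s * J (conj x * s))) := by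
  have ha1 : -1 < a - 1 := by linarith
  have h₁ := integral_jac_mul_eq ha1 hb (H := fun s => J (x * s)) (hJ.comp (by fun_prop))
  have h₂ := integral_jac_mul_eq ha1 hb (H := fun s => J (conj x * s)) (hJ.comp (by fun_prop))
  have h₃ : (∫ s in (0 : ℝ)..1, jac (a - 1) s * J (-(x * s))) =
      conj (∫ s in (0 : ℝ)..1, jac (a - 1) s * J (conj x * s)) := by
    rw [← integral_conj_ofReal]
    refine intervalIntegral.integral_congr fun s hs => ?_
    rw [uIcc_of_le zero_le_one] at hs
    rw [jac_ofReal _ (by linarith [hs.1]) hs.2, hsymm]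
    simp
  have h₄ : (∫ y in (0 : ℝ)..b, jac (a - 1) (y * I) * J (conj x * (y * I))) =
      conj (∫ y in (0 : ℝ)..b, jac (a - 1) (y * I) * J (x * (y * I))) := by
    rw [← integral_conj_ofReal]
    refine intervalIntegral.integral_congr fun y _ => ?_
    rw [jac_mul_I, show conj x * ((y : ℂ) * I) = -(conj x * (-(y * I))) by ring, hsymm]
    simp
  have i₁ : IntervalIntegrable (fun s : ℝ => jac (a - 1) s * J (x * s)) volume 0 1 :=
    (intervalIntegrable_jac ha1).mul_continuousOn (hJ.continuous.comp (by fun_prop)).continuousOn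
  have i₂ : IntervalIntegrable (fun s : ℝ => jac (a - 1) s * J (-(x * s))) volume 0 1 :=
    (intervalIntegrable_jac ha1).mul_continuousOn (hJ.continuous.comp (by fun_prop)).continuousOn
  rw [intervalIntegral.integral_congr (g := fun s : ℝ => jac (a - 1) s * J (x * s) +
      jac (a - 1) s * J (-(x * s))) (fun s _ => mul_add _ _ _), intervalIntegral.integral_add i₁ i₂,
    h₃, h₂, h₁, h₄]
  simp only [map_add, map_mul, conj_I, conj_conj]
  ring

/-- Asymptotics of the symmetric integral, up to the evaluation of the constants. -/
theorem HasExpAlgAsymptotics.symm_integral {J : ℂ → ℂ} {α m : ℂ} {d : ℕ} {μ δ : ℝ}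
    (h : HasExpAlgAsymptotics J α m d μ δ) (hsymm : ∀ ζ, J (-ζ) = conj (J (conj ζ)))
    (hμ : 0 ≤ μ) (hδ : 0 ≤ δ) {a : ℝ} (ha : 0 < a) {c b : ℝ} (hc : 0 < c) (hb : 0 < b)
    (hbc : b ≤ c / 2) (hb1 : b ≤ 1) :
    ∃ K, 0 ≤ K ∧ ∀ x : ℂ, b⁻¹ ≤ ‖x‖ → c * ‖x‖ ≤ x.re →
      ‖(∫ s in (0 : ℝ)..1, jac (a - 1) s * (J (x * s) + J (-(x * s)))) -
        ((2 * (α * cornerIntegral b (fun s => jac (a - 1) s * (s ^ d)⁻¹)).re : ℝ) : ℂ) * (x ^ d)⁻¹ -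
        (cornerCoeff a m * cexp (I * x) + conj (cornerCoeff a m) * cexp (-(I * x))) *
          x ^ (-(μ + a) : ℂ)‖ ≤
      δ * (K * ‖x‖ ^ (-(d : ℝ) - 2)) + K * (‖x‖ ^ (-(μ + a + 1)) * Real.exp |x.im|) := by
  obtain ⟨K, hK, hk⟩ := h.corner hμ hδ ha hc hb hbc hb1
  refine ⟨2 * K, by positivity, fun x hxb hx => ?_⟩
  have e₁ := hk x hxb hx
  have e₂ := hk (conj x) (by simpa using hxb) (by simpa using hx)
  rw [integral_symm_eq h.differentiable hsymm ha hb]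
  have hxre : 0 < x.re := lt_of_lt_of_le (mul_pos hc ((inv_pos.mpr hb).trans_le hxb)) hx
  have harg : x.arg ≠ π := by
    have := abs_lt.mp (Complex.abs_arg_lt_pi_div_two_iff.mpr (Or.inl hxre))
    intro h'; rw [h'] at this; linarith [this.2, Real.pi_pos]
  set U := cornerIntegral b (fun s => jac (a - 1) s * J (x * s))
  set V := cornerIntegral b (fun s => jac (a - 1) s * J (conj x * s))
  set A := α * cornerIntegral b (fun s => jac (a - 1) s * (s ^ d)⁻¹)
  set B := cornerCoeff a m
  have hpow : conj (conj x ^ (-(μ + a) : ℂ)) = x ^ (-(μ + a) : ℂ) := by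
    have : (-(μ + a) : ℂ) = conj (-(μ + a) : ℂ) := by simp
    conv_rhs => rw [this, Complex.cpow_conj _ _ harg]
  have hexp : conj (cexp (I * conj x)) = cexp (-(I * x)) := by
    rw [← Complex.exp_conj]; simp
  rw [← Complex.norm_conj (V - _ - _)] at e₂
  have hV : conj (V - A * ((conj x) ^ d)⁻¹ - B * cexp (I * conj x) * conj x ^ (-(μ + a) : ℂ)) =
      conj V - conj A * (x ^ d)⁻¹ - conj B * cexp (-(I * x)) * x ^ (-(μ + a) : ℂ) := by
    rw [map_sub, map_sub, map_mul (starRingEnd ℂ) (B * _), map_mul (starRingEnd ℂ) B, hpow, hexp,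
      map_mul (starRingEnd ℂ) A, map_inv₀, map_pow, conj_conj]
  rw [hV, Complex.norm_conj, conj_im, abs_neg] at e₂
  have hA : ((2 * A.re : ℝ) : ℂ) = A + conj A := (Complex.add_conj A).symm
  rw [hA]
  calc _ = ‖(U - A * (x ^ d)⁻¹ - B * cexp (I * x) * x ^ (-(μ + a) : ℂ)) + (conj V -
        conj A * (x ^ d)⁻¹ - conj B * cexp (-(I * x)) * x ^ (-(μ + a) : ℂ))‖ := by
        congr 1; ring
    _ ≤ _ := norm_add_le _ _
    _ ≤ _ := add_le_add e₁ e₂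
    _ = _ := by ring

theorem differentiable_weightTransform {μ : ℝ} (hμ : 0 < μ) (q : ℕ) :
    Differentiable ℂ (weightTransform μ q) := by
  intro ζ₀
  have hi : IntervalIntegrable (fun t : ℝ => jac (μ - 1) t) volume 0 1 :=
    intervalIntegrable_jac (by linarith)
  have hic : ∀ {g : ℝ → ℂ}, Continuous g →
      IntervalIntegrable (fun t : ℝ => jac (μ - 1) t * g t) volume 0 1 :=
    fun hg => hi.mul_continuousOn hg.continuousOn
  have key := intervalIntegral.hasDerivAt_integral_of_dominated_loc_of_deriv_le (𝕜 := ℂ)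
    (μ := volume) (a := 0) (b := 1) (x₀ := ζ₀) (s := Metric.ball ζ₀ 1)
    (F := fun ζ t => jac (μ - 1) t * ((t : ℂ) ^ (2 * q) * cexp (I * (ζ * t))))
    (F' := fun ζ t => jac (μ - 1) t * ((t : ℂ) ^ (2 * q) * (cexp (I * (ζ * t)) * (I * t))))
    (bound := fun t => ‖jac (μ - 1) t‖ * Real.exp (‖ζ₀‖ + 1))
    (Metric.ball_mem_nhds _ one_pos)
    (Filter.Eventually.of_forall fun ζ => (hic (by fun_prop)).aestronglyMeasurable_restrict_uIoc)
    (hic (by fun_prop)) (hic (by fun_prop)).aestronglyMeasurable_restrict_uIoc ?_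
    (hi.norm.mul_const _) ?_
  · exact key.2.differentiableAt
  · refine Filter.Eventually.of_forall fun t ht ζ hζ => ?_
    rw [uIoc_of_le zero_le_one] at ht
    rw [norm_mul]
    refine mul_le_mul_of_nonneg_left ?_ (norm_nonneg _)
    have h1 : ‖(t : ℂ)‖ ≤ 1 := by
      rw [Complex.norm_real, Real.norm_of_nonneg ht.1.le]; exact ht.2
    have h2 : ‖ζ‖ ≤ ‖ζ₀‖ + 1 := by
      have := mem_ball_iff_norm.mp hζ
      linarith [norm_le_norm_add_norm_sub' ζ ζ₀]
    have h3 : ‖cexp (I * (ζ * t))‖ ≤ Real.exp (‖ζ₀‖ + 1) := by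
      refine (Complex.norm_exp_le_exp_norm _).trans (Real.exp_le_exp.mpr ?_)
      rw [norm_mul, norm_I, one_mul, norm_mul]
      exact (mul_le_of_le_one_right (norm_nonneg _) h1).trans h2
    rw [norm_mul, norm_mul, norm_mul, norm_I, one_mul, norm_pow]
    have h4 := pow_le_one₀ (n := 2 * q) (norm_nonneg _) h1
    calc _ ≤ 1 * (‖cexp (I * (ζ * t))‖ * 1) := by gcongr
      _ ≤ _ := by linarith
  · refine Filter.Eventually.of_forall fun t _ ζ _ => ?_
    have h1 : HasDerivAt (fun ζ : ℂ => I * (ζ * (t : ℂ))) (I * t) ζ := by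
      exact (((hasDerivAt_id' ζ).mul_const (t : ℂ)).const_mul I).congr_deriv (by simp)
    exact (h1.cexp.const_mul _).const_mul _

theorem weightTransform_neg (μ : ℝ) (q : ℕ) (ζ : ℂ) :
    weightTransform μ q (-ζ) = conj (weightTransform μ q (conj ζ)) := by
  rw [weightTransform, weightTransform, ← integral_conj_ofReal]
  refine intervalIntegral.integral_congr fun t ht => ?_
  rw [uIcc_of_le zero_le_one] at ht
  rw [jac_ofReal _ (by linarith [ht.1]) ht.2, map_mul, map_mul, ← Complex.exp_conj]
  simp

theorem hasExpAlgAsymptotics_weightTransform {μ : ℝ} (hμ : 0 < μ) (q : ℕ) :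
    HasExpAlgAsymptotics (weightTransform μ q) (algCoeff q) (expCoeff μ) (2 * q + 1) μ 1 where
  differentiable := differentiable_weightTransform hμ q
  right c hc := by
    obtain ⟨K, hK, h⟩ := weightTransform_asymp hμ q hc
    exact ⟨K, hK, fun ζ h1 h2 => by rw [one_mul]; exact h ζ h1 h2⟩
  upper c hc := by
    obtain ⟨K, hK, h⟩ := weightTransform_asymp_upper hμ q hc
    refine ⟨K, hK, fun ζ h1 h2 => ?_⟩
    rw [one_mul]
    have := h ζ h1 h2
    have := mul_nonneg hK (Real.exp_pos (-ζ.im)).le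
    linarith

/-- The exponential itself, the kernel for `μ = 0`, has no algebraic part; the exponent `d` is
irrelevant. -/
theorem hasExpAlgAsymptotics_cexp (d : ℕ) :
    HasExpAlgAsymptotics (fun ζ => cexp (I * ζ)) 0 1 d 0 0 where
  differentiable := by fun_prop
  right c hc := ⟨0, le_rfl, fun ζ _ _ => by simp⟩
  upper c hc := ⟨1, zero_le_one, fun ζ _ _ => by simp [norm_cexp_I_mul]⟩

/-! ### The algebraic moment along the corner path -/

theorem jac_one {a : ℝ} (ha : 0 < a) : jac a 1 = 0 := by
  rw [jac, one_pow, sub_self, Complex.zero_cpow (by exact_mod_cast ha.ne')]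

theorem continuous_jac_leg {a : ℝ} (ha : 0 < a) (b : ℝ) :
    ContinuousOn (fun y : ℝ => jac a (1 + y * I)) (Icc 0 b) := by
  have h : ContinuousOn (fun y : ℝ => ((y ^ a : ℝ) : ℂ) * ((y : ℂ) - 2 * I) ^ (a : ℂ)) (Icc 0 b) :=
    ((Complex.continuous_ofReal.comp (Real.continuous_rpow_const ha.le)).mul
      (continuous_sub_two_I_cpow a)).continuousOn
  refine h.congr fun y hy => ?_
  rcases hy.1.eq_or_lt with h0 | h0
  · rw [← h0]; simp [jac_one ha, Real.zero_rpow ha.ne']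
  · exact jac_one_add_mul_I a h0

theorem hasDerivAt_jac (a : ℝ) {s : ℂ} (h : 0 < (1 - s ^ 2).re) :
    HasDerivAt (jac a) (-(2 * a) * (jac (a - 1) s * s)) s := by
  have h1 : HasDerivAt (fun s : ℂ => 1 - s ^ 2) (-(2 * s)) s := by
    exact ((hasDerivAt_pow 2 s).const_sub 1).congr_deriv (by simp)
  refine (h1.cpow_const (c := (a : ℂ)) (Or.inl h)).congr_deriv ?_
  rw [jac]; push_cast; ring

theorem jac_add_one (a : ℝ) {s : ℂ} (h : 0 < (1 - s ^ 2).re) :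
    jac (a + 1) s = jac a s * (1 - s ^ 2) := by
  have h0 : 1 - s ^ 2 ≠ 0 := fun h' => by simp [h'] at h
  rw [jac, jac, Complex.ofReal_add, Complex.cpow_add _ _ h0, Complex.ofReal_one, Complex.cpow_one]

/-- The fundamental theorem of calculus along the corner path, for a primitive that is continuous
up to the endpoint `1`. -/
theorem cornerIntegral_eq_sub {Φ φ : ℂ → ℂ} {b : ℝ} (hb : 0 < b)
    (hd : ∀ s : ℂ, 0 ≤ s.re → 0 < (1 - s ^ 2).re → s ≠ 0 → HasDerivAt Φ (φ s) s)
    (hc : ContinuousOn (fun y : ℝ => Φ (1 + y * I)) (Icc 0 b))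
    (ht : ContinuousOn (fun σ : ℝ => φ (σ + b * I)) (Icc 0 1))
    (hi : IntervalIntegrable (fun y : ℝ => φ (1 + y * I)) volume 0 b) :
    cornerIntegral b φ = Φ 1 - Φ (b * I) := by
  have hdt : ∀ σ ∈ Icc (0 : ℝ) 1,
      HasDerivAt (fun σ : ℝ => Φ (σ + b * I)) (φ (σ + b * I)) σ := by
    intro σ hσ
    have h1 := hd ((σ : ℂ) + b * I) (by simpa using hσ.1) (one_sub_sq_re_pos (by simpa using hσ.1)
      (by simpa using hσ.2) (Or.inr (by simp [hb.ne']))) (fun h => hb.ne' (by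
        simpa using congrArg Complex.im h))
    have h2 : HasDerivAt (fun z : ℂ => z + b * I) 1 (σ : ℂ) := (hasDerivAt_id' _).add_const _
    exact ((h1.comp (σ : ℂ) h2).comp_ofReal).congr_deriv (by simp)
  have hdl : ∀ y ∈ Ioo (0 : ℝ) b,
      HasDerivAt (fun y : ℝ => Φ (1 + y * I)) (I * φ (1 + y * I)) y := by
    intro y hy
    have h1 := hd (1 + (y : ℂ) * I) (by simp) (one_sub_sq_re_pos (by simp)
      (by simp) (Or.inr (by simp [hy.1.ne']))) (one_add_mul_I_ne_zero y)
    have h2 : HasDerivAt (fun z : ℂ => 1 + z * I) I (y : ℂ) := by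
      exact (((hasDerivAt_id' (y : ℂ)).mul_const I).const_add 1).congr_deriv (by simp)
    exact ((h1.comp (y : ℂ) h2).comp_ofReal).congr_deriv (by ring)
  have e1 := intervalIntegral.integral_eq_sub_of_hasDerivAt_of_le zero_le_one
    (fun σ hσ => (hdt σ hσ).continuousAt.continuousWithinAt)
    (fun σ hσ => hdt σ ⟨hσ.1.le, hσ.2.le⟩)
    (ContinuousOn.intervalIntegrable (by rwa [uIcc_of_le zero_le_one]))
  have e2 := intervalIntegral.integral_eq_sub_of_hasDerivAt_of_le hb.le hc hdl (hi.const_mul I)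
  rw [intervalIntegral.integral_const_mul] at e2
  rw [cornerIntegral, e1, e2]
  simp

theorem intervalIntegrable_jac_mul_leg {a : ℝ} (ha : 0 < a) {b : ℝ} (hb : 0 < b) {g : ℂ → ℂ}
    (hg : ContinuousOn g {0}ᶜ) :
    IntervalIntegrable (fun y : ℝ => jac (a - 1) (1 + y * I) * g (1 + y * I)) volume 0 b :=
  (intervalIntegrable_jac_leg (by linarith) hb).mul_continuousOn
    ((hg.comp_continuous (by fun_prop) fun y => one_add_mul_I_ne_zero y).continuousOn)

theorem continuousOn_jac_mul_top (a : ℝ) {b : ℝ} (hb : 0 < b) {g : ℂ → ℂ}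
    (hg : ContinuousOn g {0}ᶜ) :
    ContinuousOn (fun σ : ℝ => jac a (σ + b * I) * g (σ + b * I)) (Icc 0 1) :=
  (continuousOn_jac_top a hb).mul (hg.comp_continuous (by fun_prop)
    fun σ h => hb.ne' (by simpa using congrArg Complex.im h)).continuousOn

theorem cornerIntegral_add {φ ψ : ℂ → ℂ} {b : ℝ}
    (h1 : IntervalIntegrable (fun σ : ℝ => φ (σ + b * I)) volume 0 1)
    (h2 : IntervalIntegrable (fun σ : ℝ => ψ (σ + b * I)) volume 0 1)
    (h3 : IntervalIntegrable (fun y : ℝ => φ (1 + y * I)) volume 0 b)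
    (h4 : IntervalIntegrable (fun y : ℝ => ψ (1 + y * I)) volume 0 b) :
    cornerIntegral b (fun s => φ s + ψ s) = cornerIntegral b φ + cornerIntegral b ψ := by
  simp only [cornerIntegral]
  rw [intervalIntegral.integral_add h1 h2, intervalIntegral.integral_add h3 h4]
  ring

theorem cornerIntegral_const_mul (k : ℂ) (φ : ℂ → ℂ) (b : ℝ) :
    cornerIntegral b (fun s => k * φ s) = k * cornerIntegral b φ := by
  simp only [cornerIntegral, intervalIntegral.integral_const_mul]; ring

theorem cornerIntegral_jac_add {a a' : ℝ} (ha : 0 < a) (ha' : 0 < a') {b : ℝ} (hb : 0 < b)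
    {g g' : ℂ → ℂ} (hg : ContinuousOn g {0}ᶜ) (hg' : ContinuousOn g' {0}ᶜ) (k k' : ℂ) :
    cornerIntegral b (fun s => k * (jac (a - 1) s * g s) + k' * (jac (a' - 1) s * g' s)) =
      k * cornerIntegral b (fun s => jac (a - 1) s * g s) +
        k' * cornerIntegral b (fun s => jac (a' - 1) s * g' s) := by
  have hu : ∀ {f : ℝ → ℂ}, ContinuousOn f (Icc 0 1) → IntervalIntegrable f volume 0 1 := fun h =>
    ContinuousOn.intervalIntegrable (by rwa [uIcc_of_le zero_le_one])
  rw [cornerIntegral_add ((hu (continuousOn_jac_mul_top _ hb hg)).const_mul k)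
    ((hu (continuousOn_jac_mul_top _ hb hg')).const_mul k')
    ((intervalIntegrable_jac_mul_leg ha hb hg).const_mul k)
    ((intervalIntegrable_jac_mul_leg ha' hb hg').const_mul k'),
    cornerIntegral_const_mul, cornerIntegral_const_mul]

/-- The algebraic moment of the Jacobi weight along the corner path. Only its imaginary part
enters the asymptotics, and this part does not depend on `b`. -/
def cornerMoment (b a : ℝ) (q : ℕ) : ℂ :=
  cornerIntegral b (fun s => jac (a - 1) s * (s ^ (2 * q + 1))⁻¹)

theorem continuousOn_pow_inv (k : ℕ) : ContinuousOn (fun s : ℂ => (s ^ k)⁻¹) {0}ᶜ :=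
  ContinuousOn.inv₀ (by fun_prop) fun _ hs => pow_ne_zero _ hs

/-- Integration by parts. The boundary term at `1` vanishes and the one at `i b` is real. -/
theorem cornerMoment_im_succ {b : ℝ} (hb : 0 < b) {a : ℝ} (ha : 0 < a) (q : ℕ) :
    (cornerMoment b (a + 1) (q + 1)).im = -(a / (q + 1)) * (cornerMoment b a q).im := by
  have hf := cornerIntegral_eq_sub (b := b) hb
    (Φ := fun s => jac a s * (s ^ (2 * (q + 1)))⁻¹)
    (φ := fun s => -(2 * a : ℂ) * (jac (a - 1) s * (s ^ (2 * q + 1))⁻¹) +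
      -(2 * (q + 1) : ℂ) * (jac ((a + 1) - 1) s * (s ^ (2 * (q + 1) + 1))⁻¹)) ?_ ?_ ?_ ?_
  · rw [cornerIntegral_jac_add ha (by linarith) hb (continuousOn_pow_inv _) (continuousOn_pow_inv _)]
      at hf
    change -(2 * a : ℂ) * cornerMoment b a q + -(2 * (q + 1) : ℂ) * cornerMoment b (a + 1) (q + 1) =
      _ at hf
    have him := congrArg Complex.im hf
    rw [jac_one ha, jac_mul_I, pow_mul ((b : ℂ) * I), mul_pow, I_sq,
      show ((((1 + b ^ 2) ^ a : ℝ) : ℂ) * ((((b : ℂ) ^ 2 * -1) ^ (q + 1)))⁻¹) =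
      (((1 + b ^ 2) ^ a * ((b ^ 2 * -1) ^ (q + 1))⁻¹ : ℝ) : ℂ) by push_cast; ring] at him
    rw [show -(2 * (a : ℂ)) = ((-(2 * a) : ℝ) : ℂ) by push_cast; ring,
      show -(2 * ((q : ℂ) + 1)) = ((-(2 * (q + 1)) : ℝ) : ℂ) by push_cast; ring, add_im, sub_im,
      Complex.im_ofReal_mul, Complex.im_ofReal_mul, Complex.ofReal_im] at him
    simp at him
    field_simp
    linarith
  · intro s _ hs hs0
    have h1 : HasDerivAt (fun s : ℂ => (s ^ (2 * (q + 1)))⁻¹)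
        (-((2 * (q + 1) : ℕ) * s ^ (2 * (q + 1) - 1)) / (s ^ (2 * (q + 1))) ^ 2) s :=
      (hasDerivAt_pow _ s).fun_inv (pow_ne_zero _ hs0)
    refine ((hasDerivAt_jac a hs).mul h1).congr_deriv ?_
    rw [show 2 * (q + 1) - 1 = 2 * q + 1 by omega, show 2 * (q + 1) = 2 * q + 2 by ring,
      add_sub_cancel_right]
    push_cast
    field_simp
    ring
  · exact (continuous_jac_leg ha b).mul ((continuousOn_pow_inv _).comp_continuous (by fun_prop)
      fun y => one_add_mul_I_ne_zero y).continuousOn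
  · exact ((continuousOn_jac_mul_top _ hb (continuousOn_pow_inv _)).const_mul _).add
      ((continuousOn_jac_mul_top _ hb (continuousOn_pow_inv _)).const_mul _)
  · exact ((intervalIntegrable_jac_mul_leg ha hb (continuousOn_pow_inv _)).const_mul _).add
      ((intervalIntegrable_jac_mul_leg (by linarith) hb (continuousOn_pow_inv _)).const_mul _)

/-- For `q = 0` the difference of the two integrands is `s (1 - s²) ^ (a - 1)`, whose primitive is
real at both ends of the path. -/
theorem cornerMoment_zero_im_add_one {b : ℝ} (hb : 0 < b) {a : ℝ} (ha : 0 < a) :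
    (cornerMoment b (a + 1) 0).im = (cornerMoment b a 0).im := by
  have hf := cornerIntegral_eq_sub (b := b) hb
    (Φ := fun s => -(2 * a : ℂ)⁻¹ * jac a s)
    (φ := fun s => 1 * (jac (a - 1) s * (s ^ (2 * 0 + 1))⁻¹) +
      (-1) * (jac ((a + 1) - 1) s * (s ^ (2 * 0 + 1))⁻¹)) ?_ ?_ ?_ ?_
  · rw [cornerIntegral_jac_add ha (by linarith) hb (continuousOn_pow_inv _) (continuousOn_pow_inv _)]
      at hf
    change 1 * cornerMoment b a 0 + -1 * cornerMoment b (a + 1) 0 = _ at hf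
    have him := congrArg Complex.im hf
    rw [jac_one ha, jac_mul_I, show -(2 * (a : ℂ))⁻¹ * (((1 + b ^ 2) ^ a : ℝ) : ℂ) =
      ((-(2 * a)⁻¹ * (1 + b ^ 2) ^ a : ℝ) : ℂ) by push_cast; ring] at him
    simp only [one_mul, neg_mul, add_im, neg_im, mul_zero, neg_zero, zero_sub, ofReal_im] at him
    linarith
  · intro s _ hs hs0
    refine ((hasDerivAt_jac a hs).const_mul _).congr_deriv ?_
    have ha0 : (a : ℂ) ≠ 0 := by exact_mod_cast ha.ne'
    have := jac_add_one (a - 1) hs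
    rw [sub_add_cancel] at this
    rw [add_sub_cancel_right, this]
    field_simp
    ring
  · exact (continuous_jac_leg ha b).const_mul _
  · exact ((continuousOn_jac_mul_top _ hb (continuousOn_pow_inv _)).const_mul _).add
      ((continuousOn_jac_mul_top _ hb (continuousOn_pow_inv _)).const_mul _)
  · exact ((intervalIntegrable_jac_mul_leg ha hb (continuousOn_pow_inv _)).const_mul _).add
      ((intervalIntegrable_jac_mul_leg (by linarith) hb (continuousOn_pow_inv _)).const_mul _)

theorem jac_half_re_nonneg (s : ℂ) : 0 ≤ (jac (1 / 2) s).re := by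
  rw [jac]
  rcases eq_or_ne (1 - s ^ 2) 0 with h | h
  · rw [h, Complex.zero_cpow (by norm_num)]; simp
  · rw [Complex.cpow_def_of_ne_zero h, Complex.exp_re]
    refine mul_nonneg (Real.exp_pos _).le (Real.cos_nonneg_of_mem_Icc ?_)
    rw [Complex.im_mul_ofReal, Complex.log_im]
    have h1 := Complex.neg_pi_lt_arg (1 - s ^ 2)
    have h2 := Complex.arg_le_pi (1 - s ^ 2)
    constructor <;> linarith

theorem one_add_jac_half_mem_slitPlane (s : ℂ) : 1 + jac (1 / 2) s ∈ slitPlane := Or.inl (by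
  have := jac_half_re_nonneg s
  simp only [add_re, one_re]; linarith)

theorem hasDerivAt_log_sub_log {s : ℂ} (hs : 0 < (1 - s ^ 2).re) (hslit : s ∈ slitPlane) :
    HasDerivAt (fun s => Complex.log s - Complex.log (1 + jac (1 / 2) s))
      (jac (1 / 2 - 1) s * (s ^ (2 * 0 + 1))⁻¹) s := by
  have hs0 : s ≠ 0 := slitPlane_ne_zero hslit
  have h1 := (hasDerivAt_jac (1 / 2) hs).const_add 1
  refine ((Complex.hasDerivAt_log hslit).sub
    (h1.clog (one_add_jac_half_mem_slitPlane s))).congr_deriv ?_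
  have h2 := jac_add_one (1 / 2 - 1) hs
  rw [sub_add_cancel] at h2
  have h3 : jac (1 / 2) s * jac (1 / 2) s = 1 - s ^ 2 := by
    have h0 : 1 - s ^ 2 ≠ 0 := fun h' => by simp [h'] at hs
    rw [jac, ← Complex.cpow_add _ _ h0]
    norm_num
  have h4 : 1 + jac (1 / 2) s ≠ 0 := slitPlane_ne_zero (one_add_jac_half_mem_slitPlane s)
  have h0 : jac (1 / 2) s ≠ 0 := by
    intro h'
    rw [h', zero_mul] at h3
    rw [← h3] at hs; simp at hs
  have h6 : jac (1 / 2 - 1) s = (jac (1 / 2) s)⁻¹ := by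
    refine eq_inv_of_mul_eq_one_left (mul_left_cancel₀ h0 ?_)
    rw [mul_left_comm, h3, ← h2, mul_one]
  rw [h6]
  generalize jac (1 / 2) s = r at *
  rw [show 2 * 0 + 1 = 1 from rfl, pow_one]
  push_cast
  field_simp
  linear_combination h3

/-- The base case, with the primitive `log s - log (1 + √(1 - s²))`; the imaginary part is the
jump of the argument of `s` along the path from `i b` to `1`. -/
theorem cornerMoment_half_zero_im {b : ℝ} (hb : 0 < b) :
    (cornerMoment b (1 / 2) 0).im = -(π / 2) := by
  have hf := cornerIntegral_eq_sub (b := b) hb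
    (Φ := fun s => Complex.log s - Complex.log (1 + jac (1 / 2) s))
    (φ := fun s => jac (1 / 2 - 1) s * (s ^ (2 * 0 + 1))⁻¹) ?_ ?_ ?_ ?_
  · rw [cornerMoment, hf, jac_one (by norm_num), jac_mul_I]
    have h1 : (Complex.log (b * I)).im = π / 2 := by
      rw [Complex.log_ofReal_mul hb I_ne_zero, Complex.log_I]
      simp
    have h2 : (Complex.log (1 + (((1 + b ^ 2) ^ (1 / 2 : ℝ) : ℝ) : ℂ))).im = 0 := by
      rw [← Complex.ofReal_one, ← Complex.ofReal_add, ← Complex.ofReal_log (by positivity),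
        Complex.ofReal_im]
    simp only [add_zero, Complex.log_one, sub_self, zero_sub, neg_im, sub_im, h1, h2, sub_zero]
  · intro s hre hs hs0
    have hslit : s ∈ slitPlane := by
      rcases hre.eq_or_lt with h | h
      · right
        intro h'
        exact hs0 (Complex.ext h.symm h')
      · left; exact h
    exact hasDerivAt_log_sub_log hs hslit
  · refine ContinuousOn.sub ?_ ?_
    · refine ContinuousOn.clog (by fun_prop) fun y _ => Or.inl (by simp)
    · exact ContinuousOn.clog (continuousOn_const.add (continuous_jac_leg (by norm_num) b))
        fun y _ => one_add_jac_half_mem_slitPlane _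
  · exact continuousOn_jac_mul_top _ hb (continuousOn_pow_inv _)
  · exact intervalIntegrable_jac_mul_leg one_half_pos hb (continuousOn_pow_inv _)

/-- The imaginary part of the algebraic moment: up to the factor `-π / 2`, the coefficient of
`s ^ (2 q)` in `(1 - s²) ^ (n - 1 / 2)`. -/
theorem cornerMoment_im {b : ℝ} (hb : 0 < b) {n q : ℕ} (hq : q ≤ n) :
    (cornerMoment b (n + 1 / 2) q).im =
      -(π / 2) * (-1) ^ q * Real.Gamma (n + 1 / 2) / (q.factorial * Real.Gamma (n + 1 / 2 - q)) := by
  induction q generalizing n with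
  | zero =>
    have h : (cornerMoment b (n + 1 / 2) 0).im = -(π / 2) := by
      induction n with
      | zero => simpa using cornerMoment_half_zero_im hb
      | succ n ih =>
        rw [show ((n + 1 : ℕ) : ℝ) + 1 / 2 = (n + 1 / 2) + 1 by push_cast; ring,
          cornerMoment_zero_im_add_one hb (by positivity), ih (Nat.zero_le n)]
    rw [h]; simp; field_simp
  | succ q ih =>
    obtain ⟨n, rfl⟩ : ∃ k, n = k + 1 := ⟨n - 1, by omega⟩
    have hqn : q ≤ n := by omega
    have hpos : (0 : ℝ) < n + 1 / 2 := by positivity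
    have hne : Real.Gamma (n + 1 / 2 - q) ≠ 0 := (Real.Gamma_pos_of_pos (by
      have : (q : ℝ) ≤ n := by exact_mod_cast hqn
      linarith)).ne'
    rw [show ((n + 1 : ℕ) : ℝ) + 1 / 2 = (n + 1 / 2) + 1 by push_cast; ring,
      cornerMoment_im_succ hb hpos, ih hqn, Real.Gamma_add_one hpos.ne',
      show (n : ℝ) + 1 / 2 + 1 - ((q + 1 : ℕ) : ℝ) = n + 1 / 2 - q by push_cast; ring,
      Nat.factorial_succ, pow_succ]
    push_cast
    field_simp

/-! ### Moments of the Jacobi weight and power series -/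

theorem integral_neg_one_one_eq {f : ℝ → ℂ} (h0 : IntervalIntegrable f volume 0 1)
    (h1 : IntervalIntegrable (fun t => f (-t)) volume 0 1) :
    ∫ t in (-1 : ℝ)..1, f t = ∫ t in (0 : ℝ)..1, (f t + f (-t)) := by
  have h2 : IntervalIntegrable f volume (-1) 0 := by
    have := h1.comp_sub_left 0
    simpa using this.symm
  rw [← intervalIntegral.integral_add_adjacent_intervals h2 h0, intervalIntegral.integral_add h0 h1,
    intervalIntegral.integral_comp_neg, neg_zero, add_comm]

theorem integral_jac {a : ℝ} (ha : 0 < a) :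
    ∫ s in (0 : ℝ)..1, jac (a - 1) s =
      ((√π * Real.Gamma a / (2 * Real.Gamma (a + 1 / 2)) : ℝ) : ℂ) := by
  have hi : IntervalIntegrable (fun s : ℝ => jac (a - 1) s) volume 0 1 :=
    intervalIntegrable_jac (by linarith)
  have hfold := integral_neg_one_one_eq hi (by simpa [jac_neg] using hi)
  have h2 : ∫ t in (-1 : ℝ)..1, jac (a - 1) t = 2 * ∫ s in (0 : ℝ)..1, jac (a - 1) s := by
    rw [hfold, ← intervalIntegral.integral_const_mul]
    refine intervalIntegral.integral_congr fun s _ => ?_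
    simp only [Complex.ofReal_neg, jac_neg]; ring
  -- the substitution `t = 2 v - 1` turns the integral over `[-1, 1]` into a Beta integral
  have hsub := intervalIntegral.integral_comp_mul_sub (a := 0) (b := 1)
    (fun t : ℝ => jac (a - 1) t) (two_ne_zero) 1
  have hbeta : ∫ v in (0 : ℝ)..1, jac (a - 1) ((2 * v - 1 : ℝ) : ℂ) =
      (((4 : ℝ) ^ (a - 1) : ℝ) : ℂ) * Complex.betaIntegral a a := by
    rw [Complex.betaIntegral, ← intervalIntegral.integral_const_mul]
    refine intervalIntegral.integral_congr fun v hv => ?_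
    rw [uIcc_of_le zero_le_one] at hv
    have hv1 : 0 ≤ 1 - v := by linarith [hv.2]
    rw [jac_ofReal _ (by linarith [hv.1]) (by linarith [hv.2]),
      show 1 - (2 * v - 1) ^ 2 = 4 * (v * (1 - v)) by ring,
      Real.mul_rpow (by norm_num) (mul_nonneg hv.1 hv1), Real.mul_rpow hv.1 hv1,
      Complex.ofReal_mul, Complex.ofReal_mul, Complex.ofReal_cpow hv.1, Complex.ofReal_cpow hv1]
    push_cast; rfl
  rw [hbeta] at hsub
  simp only [mul_zero, zero_sub, mul_one, show (2 : ℝ) - 1 = 1 by norm_num] at hsub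
  rw [h2] at hsub
  have hG := Complex.Gamma_mul_Gamma_eq_betaIntegral (s := a) (t := a) (by simpa) (by simpa)
  have hdup := Real.Gamma_mul_Gamma_add_half a
  have h2a : Real.Gamma (2 * a) ≠ 0 := (Real.Gamma_pos_of_pos (by linarith)).ne'
  have hah : Real.Gamma (a + 1 / 2) ≠ 0 := (Real.Gamma_pos_of_pos (by linarith)).ne'
  have hB : Complex.betaIntegral a a = ((Real.Gamma a * Real.Gamma a / Real.Gamma (2 * a) : ℝ) : ℂ) := by
    rw [show (a : ℂ) + a = ((2 * a : ℝ) : ℂ) by push_cast; ring, Complex.Gamma_ofReal,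
      Complex.Gamma_ofReal] at hG
    have : ((Real.Gamma (2 * a) : ℝ) : ℂ) ≠ 0 := by exact_mod_cast h2a
    push_cast
    field_simp
    rw [sq, hG]; ring
  have hpow : (4 : ℝ) ^ (a - 1) * 2 ^ (1 - 2 * a) * 2 = 1 := by
    rw [show (4 : ℝ) = 2 ^ (2 : ℝ) by norm_num, ← Real.rpow_mul zero_le_two,
      ← Real.rpow_add zero_lt_two, ← Real.rpow_add_one two_ne_zero]
    ring_nf; simp
  have hres : (∫ s in (0 : ℝ)..1, jac (a - 1) s) =
      (((4 : ℝ) ^ (a - 1) * (Real.Gamma a * Real.Gamma a / Real.Gamma (2 * a)) : ℝ) : ℂ) := by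
    rw [Complex.ofReal_mul, ← hB, hsub, Complex.real_smul]; push_cast; ring
  rw [hres]
  congr 1
  have h3 : Real.Gamma a * Real.Gamma (a + 1 / 2) * ((4 : ℝ) ^ (a - 1) * 2) =
      Real.Gamma (2 * a) * √π * ((4 : ℝ) ^ (a - 1) * 2 ^ (1 - 2 * a) * 2) := by
    rw [hdup]; ring
  rw [hpow] at h3
  rw [mul_div_assoc', div_eq_div_iff h2a (mul_ne_zero two_ne_zero hah)]
  linear_combination Real.Gamma a * h3

theorem continuousOn_jac_real {a : ℝ} (ha : 0 < a) :
    ContinuousOn (fun s : ℝ => jac a s) (Icc 0 1) := by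
  have h : ContinuousOn (fun s : ℝ => (((1 - s ^ 2) ^ a : ℝ) : ℂ)) (Icc 0 1) :=
    (Complex.continuous_ofReal.comp (Continuous.rpow_const (by fun_prop)
      fun s => Or.inr ha.le)).continuousOn
  exact h.congr fun s hs => jac_ofReal a (by linarith [hs.1]) hs.2

/-- The even moments of the Jacobi weight, by recursion on `k` through integration by parts. -/
theorem integral_jac_mul_pow {a : ℝ} (ha : 0 < a) (k : ℕ) :
    ∫ s in (0 : ℝ)..1, jac (a - 1) s * (s : ℂ) ^ (2 * k) =
      ((Real.Gamma (k + 1 / 2) * Real.Gamma a / (2 * Real.Gamma (k + 1 / 2 + a)) : ℝ) : ℂ) := by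
  induction k with
  | zero =>
    have := integral_jac ha
    simp only [mul_zero, pow_zero, mul_one]
    rw [this, Nat.cast_zero, zero_add, Real.Gamma_one_half_eq, add_comm]
  | succ k ih =>
    have hi : ∀ j : ℕ, IntervalIntegrable (fun s : ℝ => jac (a - 1) s * (s : ℂ) ^ j) volume 0 1 :=
      fun j => (intervalIntegrable_jac (by linarith)).mul_continuousOn (by fun_prop)
    have hftc := intervalIntegral.integral_eq_sub_of_hasDerivAt_of_le zero_le_one
      (f := fun s : ℝ => jac a s * (s : ℂ) ^ (2 * k + 1))
      (f' := fun s : ℝ => (2 * k + 1 : ℂ) * (jac (a - 1) s * (s : ℂ) ^ (2 * k)) -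
        (2 * k + 1 + 2 * a : ℂ) * (jac (a - 1) s * (s : ℂ) ^ (2 * (k + 1))))
      ((continuousOn_jac_real ha).mul (by fun_prop)) ?_
      (((hi _).const_mul _).sub ((hi _).const_mul _))
    · rw [intervalIntegral.integral_sub ((hi _).const_mul _) ((hi _).const_mul _),
        intervalIntegral.integral_const_mul, intervalIntegral.integral_const_mul, ih] at hftc
      simp only [Complex.ofReal_one, jac_one ha, Complex.ofReal_zero, ne_eq, Nat.add_eq_zero_iff,
        one_ne_zero, and_false, not_false_eq_true, zero_pow, mul_zero, zero_mul, sub_zero] at hftc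
      have hne : (2 * k + 1 + 2 * a : ℂ) ≠ 0 := by
        have : (2 * k + 1 + 2 * a : ℝ) ≠ 0 := by positivity
        exact_mod_cast this
      refine mul_left_cancel₀ hne ?_
      rw [← sub_eq_zero.mp hftc, show ((k + 1 : ℕ) : ℝ) + 1 / 2 = (k + 1 / 2) + 1 by push_cast; ring,
        Real.Gamma_add_one (by positivity), show (k : ℝ) + 1 / 2 + 1 + a = (k + 1 / 2 + a) + 1 by ring,
        Real.Gamma_add_one (by positivity)]
      have : (2 * (k : ℝ) + 1) * (Real.Gamma (k + 1 / 2) * Real.Gamma a /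
          (2 * Real.Gamma (k + 1 / 2 + a))) = (2 * k + 1 + 2 * a) * ((k + 1 / 2) *
          Real.Gamma (k + 1 / 2) * Real.Gamma a / (2 * ((k + 1 / 2 + a) *
          Real.Gamma (k + 1 / 2 + a)))) := by
        field_simp
      exact_mod_cast this
    · intro s hs
      have hs' : 0 < (1 - (s : ℂ) ^ 2).re := one_sub_sq_re_pos (by simpa using hs.1.le)
        (by simpa using hs.2.le) (Or.inl (by simpa using hs.2))
      have h1 := ((hasDerivAt_jac a hs').mul (hasDerivAt_pow (2 * k + 1) (s : ℂ))).comp_ofReal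
      refine h1.congr_deriv ?_
      have h2 := jac_add_one (a - 1) hs'
      rw [sub_add_cancel] at h2
      rw [h2]; push_cast
      rw [show 2 * (k + 1) = 2 * k + 2 by ring]
      ring

/-- Termwise integration of a power series in `t ^ 2` against a weight on `[0, 1]`. -/
theorem hasSum_integral_weight {w : ℝ → ℂ} (hw : IntervalIntegrable w volume 0 1) {c : ℕ → ℂ}
    (hc : Summable fun k => ‖c k‖) {F : ℝ → ℂ}
    (hF : ∀ t ∈ Ioc (0 : ℝ) 1, HasSum (fun k => c k * (t : ℂ) ^ (2 * k)) (F t)) :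
    HasSum (fun k => c k * ∫ t in (0 : ℝ)..1, w t * (t : ℂ) ^ (2 * k))
      (∫ t in (0 : ℝ)..1, w t * F t) := by
  have h := intervalIntegral.hasSum_integral_of_dominated_convergence (μ := volume) (a := 0) (b := 1)
    (F := fun k t => w t * (c k * (t : ℂ) ^ (2 * k))) (f := fun t => w t * F t)
    (fun k t => ‖w t‖ * ‖c k‖) ?_ ?_ ?_ ?_ ?_
  · convert! h using 1
    funext k
    rw [← intervalIntegral.integral_const_mul]
    exact intervalIntegral.integral_congr fun t _ => by ring
  · intro k
    exact (hw.mul_continuousOn (by fun_prop)).aestronglyMeasurable_restrict_uIoc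
  · refine fun k => Filter.Eventually.of_forall fun t ht => ?_
    rw [uIoc_of_le zero_le_one] at ht
    rw [norm_mul, norm_mul, norm_pow, Complex.norm_real, Real.norm_of_nonneg ht.1.le]
    exact mul_le_mul_of_nonneg_left (mul_le_of_le_one_right (norm_nonneg _)
      (pow_le_one₀ ht.1.le ht.2)) (norm_nonneg _)
  · exact Filter.Eventually.of_forall fun t _ => hc.mul_left _
  · simp_rw [tsum_mul_left]
    exact hw.norm.mul_const _
  · refine Filter.Eventually.of_forall fun t ht => ?_
    rw [uIoc_of_le zero_le_one] at ht
    exact (hF t ht).mul_left _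

/-- The even part of `weightTransform` is the cosine transform of the Jacobi weight. -/
theorem weightTransform_add_neg {μ : ℝ} (hμ : 0 < μ) (q : ℕ) (z : ℂ) :
    weightTransform μ q z + weightTransform μ q (-z) =
      ∫ t in (0 : ℝ)..1, jac (μ - 1) t * ((t : ℂ) ^ (2 * q) * (2 * Complex.cos (z * t))) := by
  have hi := intervalIntegrable_jac (a := μ - 1) (by linarith)
  rw [weightTransform, weightTransform, ← intervalIntegral.integral_add
    (hi.mul_continuousOn (by fun_prop)) (hi.mul_continuousOn (by fun_prop))]
  refine intervalIntegral.integral_congr fun t _ => ?_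
  simp only [Complex.two_cos]
  rw [show I * (z * (t : ℂ)) = z * t * I by ring, show I * (-z * (t : ℂ)) = -(z * t) * I by ring]
  ring

/-- The power series of the cosine transform, a normalized Bessel function of order `a - 1 / 2`. -/
theorem hasSum_weightTransform {a : ℝ} (ha : 0 < a) (z : ℂ) :
    HasSum (fun k : ℕ => 2 * ((-1) ^ k * z ^ (2 * k) / ((2 * k).factorial : ℂ)) *
      ((Real.Gamma (k + 1 / 2) * Real.Gamma a / (2 * Real.Gamma (k + 1 / 2 + a)) : ℝ) : ℂ))
      (weightTransform a 0 z + weightTransform a 0 (-z)) := by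
  rw [weightTransform_add_neg ha]
  simp_rw [← integral_jac_mul_pow ha, mul_zero, pow_zero, one_mul]
  refine hasSum_integral_weight (intervalIntegrable_jac (by linarith)) ?_ fun t _ => ?_
  · have h := (Complex.hasSum_cos z).summable.norm.mul_left 2
    refine h.congr fun k => ?_
    rw [norm_mul, Complex.norm_ofNat]
  · refine ((Complex.hasSum_cos (z * t)).mul_left 2).congr_fun fun k => ?_
    rw [mul_pow]; ring

/-! ### Integral representations of both deformations -/

theorem Gamma_natCast_add_half (k : ℕ) :
    Real.Gamma (k + 1 / 2) = (2 * k).factorial * √π / (4 ^ k * k.factorial) := by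
  induction k with
  | zero => simpa using Real.Gamma_one_half_eq
  | succ k ih =>
    rw [show ((k + 1 : ℕ) : ℝ) + 1 / 2 = (k + 1 / 2) + 1 by push_cast; ring,
      Real.Gamma_add_one (by positivity), ih, show 2 * (k + 1) = 2 * k + 1 + 1 by ring,
      Nat.factorial_succ, Nat.factorial_succ, Nat.factorial_succ]
    push_cast
    field_simp
    ring

/-- Poisson's integral for the Bessel function of integer order. -/
theorem besselJ_eq (n : ℕ) (z : ℂ) :
    besselJ n z = (z / 2) ^ n / ((Real.Gamma (1 / 2) * Real.Gamma (n + 1 / 2) : ℝ) : ℂ) *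
      (weightTransform (n + 1 / 2) 0 z + weightTransform (n + 1 / 2) 0 (-z)) := by
  have h := (hasSum_weightTransform (a := n + 1 / 2) (by positivity) z).mul_left
    ((z / 2) ^ n / ((Real.Gamma (1 / 2) * Real.Gamma (n + 1 / 2) : ℝ) : ℂ))
  rw [besselJ, ← h.tsum_eq]
  refine tsum_congr fun k => ?_
  have hreal : 1 / ((k.factorial : ℝ) * (k + n).factorial) / 4 ^ k =
      (Real.Gamma (1 / 2) * Real.Gamma (n + 1 / 2))⁻¹ * (2 * (((2 * k).factorial : ℝ))⁻¹ *
      (Real.Gamma (k + 1 / 2) * Real.Gamma (n + 1 / 2) /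
        (2 * Real.Gamma (k + 1 / 2 + (n + 1 / 2))))) := by
    rw [show (k : ℝ) + 1 / 2 + (n + 1 / 2) = ((k + n : ℕ) : ℝ) + 1 by push_cast; ring,
      Real.Gamma_nat_eq_factorial, Gamma_natCast_add_half k, Real.Gamma_one_half_eq]
    field_simp
  have hc := congrArg (fun r : ℝ => (r : ℂ)) hreal
  simp only [Complex.ofReal_mul, Complex.ofReal_div, Complex.ofReal_inv, Complex.ofReal_one,
    Complex.ofReal_natCast, Complex.ofReal_pow, Complex.ofReal_ofNat] at hc
  calc _ = (-1) ^ k * z ^ (2 * k) * (z / 2) ^ n *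
        (1 / ((k.factorial : ℂ) * (k + n).factorial) / 4 ^ k) := by
        rw [pow_add, div_pow z 2 (2 * k), pow_mul 2 2 k]; norm_num; ring
    _ = _ := by rw [hc]; push_cast; ring

theorem besselJ_neg (n : ℕ) (z : ℂ) : besselJ n (-z) = (-1) ^ n * besselJ n z := by
  rw [besselJ_eq, besselJ_eq, neg_neg, neg_div, neg_pow]; ring

theorem continuous_besselJ (n : ℕ) : Continuous (besselJ n) := by
  have h := (differentiable_weightTransform (μ := n + 1 / 2) (by positivity) 0).continuous
  have : besselJ n = fun z => (z / 2) ^ n / ((Real.Gamma (1 / 2) * Real.Gamma (n + 1 / 2) : ℝ) : ℂ) *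
      (weightTransform (n + 1 / 2) 0 z + weightTransform (n + 1 / 2) 0 (-z)) :=
    funext (besselJ_eq n)
  rw [this]
  fun_prop

theorem factorial_le_dunklFactorial {μ : ℝ} (hμ : 0 ≤ μ) (m : ℕ) :
    (m.factorial : ℝ) ≤ dunklFactorial μ m := by
  rw [dunklFactorial, ← Finset.prod_range_add_one_eq_factorial, Nat.cast_prod]
  refine Finset.prod_le_prod (fun i _ => Nat.cast_nonneg _) fun i _ => ?_
  rw [dunklNat]
  have : (-1 : ℝ) ^ (i + 1) ≤ 1 := by
    rcases neg_one_pow_eq_or ℝ (i + 1) with h | h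
    · rw [h]
    · rw [h]; norm_num
  nlinarith

theorem norm_dunklExp_term_le {μ : ℝ} (hμ : 0 ≤ μ) (m : ℕ) (z : ℂ) :
    ‖z ^ m / (dunklFactorial μ m : ℂ)‖ ≤ ‖z‖ ^ m / m.factorial := by
  have h := factorial_le_dunklFactorial hμ m
  have h0 : (0 : ℝ) < m.factorial := by positivity
  rw [norm_div, norm_pow, Complex.norm_real, Real.norm_of_nonneg (h0.le.trans h)]
  gcongr

theorem summable_dunklExp {μ : ℝ} (hμ : 0 ≤ μ) (z : ℂ) :
    Summable fun m : ℕ => z ^ m / (dunklFactorial μ m : ℂ) :=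
  Summable.of_norm_bounded (Real.summable_pow_div_factorial ‖z‖)
    fun m => norm_dunklExp_term_le hμ m z

theorem continuous_dunklExp {μ : ℝ} (hμ : 0 ≤ μ) : Continuous (dunklExp μ) := by
  refine continuous_iff_continuousAt.mpr fun z => ?_
  have : ContinuousOn (dunklExp μ) (Metric.ball 0 (‖z‖ + 1)) := by
    refine continuousOn_tsum (fun m => by fun_prop) (Real.summable_pow_div_factorial (‖z‖ + 1))
      fun m w hw => (norm_dunklExp_term_le hμ m w).trans ?_
    have := (mem_ball_zero_iff.mp hw).le
    gcongr
  exact this.continuousAt (Metric.isOpen_ball.mem_nhds (by simp))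

theorem dunklFactorial_two_mul {μ : ℝ} (hμ : 0 ≤ μ) (k : ℕ) :
    dunklFactorial μ (2 * k) = (2 * k).factorial * Real.Gamma (k + 1 / 2 + μ) *
      Real.Gamma (1 / 2) / (Real.Gamma (k + 1 / 2) * Real.Gamma (μ + 1 / 2)) := by
  induction k with
  | zero =>
    simp only [dunklFactorial, mul_zero, Finset.range_zero, Finset.prod_empty, Nat.factorial_zero,
      Nat.cast_one, Nat.cast_zero, zero_add, one_mul, add_comm (1 / 2) μ]
    field_simp
  | succ k ih =>
    have he : (-1 : ℝ) ^ (2 * k + 1) = -1 := by rw [pow_succ, pow_mul]; norm_num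
    have he' : (-1 : ℝ) ^ (2 * k + 1 + 1) = 1 := by rw [pow_succ, he]; norm_num
    rw [dunklFactorial, show 2 * (k + 1) = 2 * k + 1 + 1 by ring, Finset.prod_range_succ,
      Finset.prod_range_succ, ← dunklFactorial, ih, dunklNat, dunklNat, he, he',
      show ((k + 1 : ℕ) : ℝ) + 1 / 2 + μ = (k + 1 / 2 + μ) + 1 by push_cast; ring,
      show ((k + 1 : ℕ) : ℝ) + 1 / 2 = (k + 1 / 2) + 1 by push_cast; ring,
      Real.Gamma_add_one (by positivity), Real.Gamma_add_one (by positivity),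
      Nat.factorial_succ, Nat.factorial_succ]
    push_cast
    field_simp
    ring

theorem two_div_dunklFactorial {μ : ℝ} (hμ : 0 < μ) (k : ℕ) :
    2 / dunklFactorial μ (2 * k) = 2 * Real.Gamma (μ + 1 / 2) /
      (Real.Gamma (1 / 2) * Real.Gamma μ) * (2 / ((2 * k).factorial : ℝ) *
        (Real.Gamma (k + 1 / 2) * Real.Gamma μ / (2 * Real.Gamma (k + 1 / 2 + μ)))) := by
  rw [dunklFactorial_two_mul hμ.le]
  field_simp

/-- The even part of the deformed exponential on the imaginary axis: both sides are multiples of a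
normalized Bessel function of order `μ - 1 / 2`. -/
theorem dunklExp_add_neg {μ : ℝ} (hμ : 0 < μ) (w : ℂ) :
    dunklExp μ (I * w) + dunklExp μ (-(I * w)) =
      ((2 * Real.Gamma (μ + 1 / 2) / (Real.Gamma (1 / 2) * Real.Gamma μ) : ℝ) : ℂ) *
        (weightTransform μ 0 w + weightTransform μ 0 (-w)) := by
  have hs := (hasSum_weightTransform hμ w).mul_left
    ((2 * Real.Gamma (μ + 1 / 2) / (Real.Gamma (1 / 2) * Real.Gamma μ) : ℝ) : ℂ)
  set S := ((2 * Real.Gamma (μ + 1 / 2) / (Real.Gamma (1 / 2) * Real.Gamma μ) : ℝ) : ℂ) *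
        (weightTransform μ 0 w + weightTransform μ 0 (-w))
  set f : ℕ → ℂ := fun m => (I * w) ^ m / (dunklFactorial μ m : ℂ) +
    (-(I * w)) ^ m / (dunklFactorial μ m : ℂ) with hf
  have h1 : HasSum f (dunklExp μ (I * w) + dunklExp μ (-(I * w))) :=
    (summable_dunklExp hμ.le (I * w)).hasSum.add (summable_dunklExp hμ.le (-(I * w))).hasSum
  have heven : HasSum (fun k : ℕ => f (2 * k)) S := by
    refine hs.congr_fun fun k => ?_
    have hc := congrArg (fun r : ℝ => (r : ℂ)) (two_div_dunklFactorial hμ k)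
    beta_reduce at hc
    rw [Complex.ofReal_mul, Complex.ofReal_mul, Complex.ofReal_div 2, Complex.ofReal_div 2,
      Complex.ofReal_ofNat, Complex.ofReal_natCast] at hc
    have hI : (I * w) ^ (2 * k) = (-1) ^ k * w ^ (2 * k) := by
      rw [mul_comm, mul_I_pow_two_mul]
    rw [hf]
    beta_reduce
    rw [Even.neg_pow (even_two_mul k), hI]
    linear_combination (-1) ^ k * w ^ (2 * k) * hc
  have hodd : HasSum (fun k : ℕ => f (2 * k + 1)) 0 := by
    have : (fun k : ℕ => f (2 * k + 1)) = fun _ => 0 := by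
      funext k
      rw [hf]
      beta_reduce
      rw [Odd.neg_pow (odd_two_mul_add_one k)]; ring
    rw [this]; exact hasSum_zero
  have h2 := heven.even_add_odd hodd
  rw [add_zero] at h2
  exact h1.unique h2

theorem dunklExp_zero (z : ℂ) : dunklExp 0 z = cexp z := by
  rw [Complex.exp_eq_exp_ℂ, NormedSpace.exp_eq_tsum_div, dunklExp]
  refine tsum_congr fun m => ?_
  congr 1
  rw [dunklFactorial, ← Finset.prod_range_add_one_eq_factorial]
  push_cast
  refine Finset.prod_congr rfl fun i _ => ?_
  rw [dunklNat]; push_cast; ring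

theorem secondBessel_eq_integral {μ : ℝ} (hμ : 0 ≤ μ) (n : ℕ) (x : ℂ) :
    secondBessel μ n x = (x / 2) ^ n / ((Real.Gamma (1 / 2) * Real.Gamma (n + 1 / 2) : ℝ) : ℂ) *
      ∫ s in (0 : ℝ)..1, jac ((n + 1 / 2) - 1) s *
        (dunklExp μ (I * (x * s)) + dunklExp μ (-(I * (x * s)))) := by
  have hn : (-1 : ℝ) < (n + 1 / 2) - 1 := by
    linarith
  have hc := continuous_dunklExp hμ
  rw [secondBessel]
  congr 1
  have e : (∫ s in (-1 : ℝ)..1, dunklExp μ (I * (s : ℂ) * x) *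
      (((1 - s ^ 2) ^ ((n : ℝ) - 1 / 2) : ℝ) : ℂ)) =
      ∫ s in (-1 : ℝ)..1, jac ((n + 1 / 2) - 1) s * dunklExp μ (I * (x * s)) := by
    refine intervalIntegral.integral_congr fun s hs => ?_
    rw [uIcc_of_le (by norm_num)] at hs
    rw [jac_ofReal _ hs.1 hs.2, show (n : ℝ) + 1 / 2 - 1 = n - 1 / 2 by ring,
      show I * (s : ℂ) * x = I * (x * s) by ring, mul_comm]
  have hi := intervalIntegrable_jac hn
  have i₁ : IntervalIntegrable (fun s : ℝ => jac ((n + 1 / 2) - 1) s * dunklExp μ (I * (x * s)))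
      volume 0 1 := hi.mul_continuousOn (by fun_prop)
  have i₂ : IntervalIntegrable (fun s : ℝ => jac ((n + 1 / 2) - 1) ((-s : ℝ) : ℂ) *
      dunklExp μ (I * (x * ((-s : ℝ) : ℂ)))) volume 0 1 := by
    simp only [Complex.ofReal_neg, jac_neg]
    exact hi.mul_continuousOn (by fun_prop)
  rw [e, integral_neg_one_one_eq i₁ i₂]
  refine intervalIntegral.integral_congr fun s _ => ?_
  simp only [Complex.ofReal_neg, jac_neg, mul_neg]; ring

/-- The second deformation as a symmetric Jacobi integral of a one-dimensional transform. -/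
theorem secondBessel_eq {μ : ℝ} (hμ : 0 < μ) (n : ℕ) (x : ℂ) :
    secondBessel μ n x =
      ((2 * Real.Gamma (μ + 1 / 2) / (Real.Gamma (1 / 2) * Real.Gamma μ) : ℝ) : ℂ) *
      ((x / 2) ^ n / ((Real.Gamma (1 / 2) * Real.Gamma (n + 1 / 2) : ℝ) : ℂ)) *
      ∫ s in (0 : ℝ)..1, jac ((n + 1 / 2) - 1) s *
        (weightTransform μ 0 (x * s) + weightTransform μ 0 (-(x * s))) := by
  rw [secondBessel_eq_integral hμ.le]
  simp_rw [dunklExp_add_neg hμ, mul_left_comm (jac _ _), intervalIntegral.integral_const_mul]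
  ring

theorem secondBessel_zero (n : ℕ) (x : ℂ) :
    secondBessel 0 n x = (x / 2) ^ n / ((Real.Gamma (1 / 2) * Real.Gamma (n + 1 / 2) : ℝ) : ℂ) *
      ∫ s in (0 : ℝ)..1, jac ((n + 1 / 2) - 1) s * (cexp (I * (x * s)) + cexp (I * -(x * s))) := by
  rw [secondBessel_eq_integral le_rfl]
  simp_rw [dunklExp_zero, mul_neg]

theorem firstBessel_zero (n : ℕ) (x : ℂ) :
    firstBessel 0 n x = (x / 2) ^ n / ((Real.Gamma (1 / 2) * Real.Gamma (n + 1 / 2) : ℝ) : ℂ) *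
      ∫ s in (0 : ℝ)..1, jac ((n + 1 / 2) - 1) s * (cexp (I * (x * s)) + cexp (I * -(x * s))) := by
  rw [firstBessel, dunklV, if_pos rfl, besselJ_eq, weightTransform_add_neg (by positivity)]
  congr 1
  refine intervalIntegral.integral_congr fun s _ => ?_
  simp only [Complex.two_cos]
  rw [show I * (x * (s : ℂ)) = x * s * I by ring, show I * -(x * (s : ℂ)) = -(x * s) * I by ring]
  ring

/-- Fubini's theorem: the roles of the weights in `s` and in `t` are exchanged. -/
theorem integral_weightTransform_swap {μ a : ℝ} (hμ : 0 < μ) (ha : 0 < a) (q : ℕ) (x : ℂ) :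
    ∫ t in (0 : ℝ)..1, jac (μ - 1) t * ((t : ℂ) ^ (2 * q) * weightTransform a 0 (x * t)) =
      ∫ s in (0 : ℝ)..1, jac (a - 1) s * weightTransform μ q (x * s) := by
  have h₁ := (intervalIntegrable_jac (a := μ - 1) (by linarith)).1
  have h₂ := (intervalIntegrable_jac (a := a - 1) (by linarith)).1
  simp only [weightTransform, ← intervalIntegral.integral_const_mul]
  simp only [intervalIntegral.integral_of_le zero_le_one]
  rw [integral_integral_swap]
  · refine integral_congr_ae (Filter.Eventually.of_forall fun s => integral_congr_ae
      (Filter.Eventually.of_forall fun t => ?_))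
    simp only
    rw [show x * (t : ℂ) * s = x * s * t by ring]; ring
  · have hg : Continuous fun p : ℝ × ℝ => (p.1 : ℂ) ^ (2 * q) *
        ((p.2 : ℂ) ^ (2 * 0) * cexp (I * (x * p.1 * p.2))) := by fun_prop
    obtain ⟨M, hM⟩ := (isCompact_Icc (a := (0 : ℝ)) (b := 1)).prod
      (isCompact_Icc (a := (0 : ℝ)) (b := 1)) |>.exists_bound_of_continuousOn hg.continuousOn
    have h := (h₁.mul_prod h₂).mul_bdd (c := M) hg.aestronglyMeasurable ?_
    · refine h.congr (Filter.Eventually.of_forall fun p => ?_)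
      simp only [Function.uncurry]; ring
    · rw [Measure.prod_restrict]
      filter_upwards [ae_restrict_mem (measurableSet_Ioc.prod measurableSet_Ioc)] with p hp
      exact hM p ⟨⟨hp.1.1.le, hp.1.2⟩, ⟨hp.2.1.le, hp.2.2⟩⟩

theorem betaIntegral_half {μ : ℝ} (hμ : 0 < μ) :
    (Complex.betaIntegral (1 / 2) (μ : ℂ))⁻¹ =
      ((Real.Gamma (μ + 1 / 2) / (Real.Gamma (1 / 2) * Real.Gamma μ) : ℝ) : ℂ) := by
  have h := Complex.Gamma_mul_Gamma_eq_betaIntegral (s := ((1 / 2 : ℝ) : ℂ)) (t := μ)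
    (by rw [Complex.ofReal_re]; norm_num) (by simpa)
  rw [← Complex.ofReal_add, Complex.Gamma_ofReal, Complex.Gamma_ofReal, Complex.Gamma_ofReal] at h
  have hG : ((Real.Gamma (1 / 2 + μ) : ℝ) : ℂ) ≠ 0 := by
    exact_mod_cast (Real.Gamma_pos_of_pos (by positivity)).ne'
  have hh : ((1 / 2 : ℝ) : ℂ) = 1 / 2 := by push_cast; rfl
  rw [hh] at h
  rw [Complex.ofReal_div, Complex.ofReal_mul, h, add_comm μ, div_mul_cancel_left₀ hG]

/-- The first deformation as a symmetric Jacobi integral of a one-dimensional transform. The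
parity of `besselJ n` turns the weight of the intertwining operator into an even one, and Fubini
exchanges the two integrals. -/
theorem firstBessel_eq {μ : ℝ} (hμ : 0 < μ) (n : ℕ) (x : ℂ) :
    firstBessel μ n x =
      ((2 * Real.Gamma (μ + 1 / 2) / (Real.Gamma (1 / 2) * Real.Gamma μ) : ℝ) : ℂ) *
      ((x / 2) ^ n / ((Real.Gamma (1 / 2) * Real.Gamma (n + 1 / 2) : ℝ) : ℂ)) *
      ∫ s in (0 : ℝ)..1, jac ((n + 1 / 2) - 1) s *
        (weightTransform μ ((n + 1) / 2) (x * s) + weightTransform μ ((n + 1) / 2) (-(x * s))) := by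
  set q := (n + 1) / 2
  set G : ℂ := ((Real.Gamma (1 / 2) * Real.Gamma (n + 1 / 2) : ℝ) : ℂ) with hG
  have hi := intervalIntegrable_jac (a := μ - 1) (by linarith)
  have hJ := continuous_besselJ n
  have ha : (0 : ℝ) < n + 1 / 2 := by positivity
  have hw : ∀ t ∈ Ioo (0 : ℝ) 1, (((1 - t) ^ (μ - 1) * (1 + t) ^ μ : ℝ) : ℂ) =
      jac (μ - 1) t * (1 + t) := by
    intro t ht
    have h1 : 0 < 1 + t := by linarith [ht.1]
    rw [jac_ofReal _ (by linarith [ht.1]) ht.2.le, show 1 - t ^ 2 = (1 - t) * (1 + t) by ring,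
      Real.mul_rpow (by linarith [ht.2]) h1.le]
    have : (1 + t) ^ μ = (1 + t) ^ (μ - 1) * (1 + t) := by
      rw [← Real.rpow_add_one h1.ne', sub_add_cancel]
    rw [this]; push_cast; ring
  have hw' : ∀ t ∈ Ioo (0 : ℝ) 1, (((1 - -t) ^ (μ - 1) * (1 + -t) ^ μ : ℝ) : ℂ) =
      jac (μ - 1) t * (1 - t) := by
    intro t ht
    have h1 : 0 < 1 + -t := by linarith [ht.2]
    rw [jac_ofReal _ (by linarith [ht.1]) ht.2.le, show 1 - t ^ 2 = (1 - -t) * (1 + -t) by ring,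
      Real.mul_rpow (by linarith [ht.1]) h1.le]
    have : (1 + -t) ^ μ = (1 + -t) ^ (μ - 1) * (1 + -t) := by
      rw [← Real.rpow_add_one h1.ne', sub_add_cancel]
    rw [this]; push_cast; ring
  -- at `t = 1` a base vanishes, and the splitting of the real powers is not available
  have hae : ∀ᵐ t : ℝ, t ≠ 1 := by simp [ae_iff]
  have i₁ : IntervalIntegrable (fun t : ℝ => besselJ n (x * t) *
      (((1 - t) ^ (μ - 1) * (1 + t) ^ μ : ℝ) : ℂ)) volume 0 1 := by
    have h : IntervalIntegrable (fun t : ℝ => jac (μ - 1) t * ((1 + t) * besselJ n (x * t)))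
        volume 0 1 := hi.mul_continuousOn (by fun_prop)
    refine h.congr_ae ?_
    rw [Filter.EventuallyEq, ae_restrict_iff' measurableSet_uIoc]
    filter_upwards [hae] with t h1 ht
    rw [uIoc_of_le zero_le_one] at ht
    rw [hw t ⟨ht.1, lt_of_le_of_ne ht.2 h1⟩]; ring
  have i₂ : IntervalIntegrable (fun t : ℝ => besselJ n (x * ((-t : ℝ) : ℂ)) *
      (((1 - -t) ^ (μ - 1) * (1 + -t) ^ μ : ℝ) : ℂ)) volume 0 1 := by
    have h : IntervalIntegrable (fun t : ℝ => jac (μ - 1) t *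
        ((1 - t) * besselJ n (x * ((-t : ℝ) : ℂ)))) volume 0 1 :=
      hi.mul_continuousOn (by fun_prop)
    refine h.congr_ae ?_
    rw [Filter.EventuallyEq, ae_restrict_iff' measurableSet_uIoc]
    filter_upwards [hae] with t h1 ht
    rw [uIoc_of_le zero_le_one] at ht
    rw [hw' t ⟨ht.1, lt_of_le_of_ne ht.2 h1⟩]; ring
  -- only the part of `1 + t` with the parity of `n` survives; it is `t ^ (2 q - n)`
  have hpar : ∀ t : ℂ, (1 + t) + (-1) ^ n * (1 - t) = 2 * t ^ (2 * q - n) := by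
    intro t
    rcases Nat.even_or_odd' n with ⟨r, h | h⟩
    · rw [show 2 * q - n = 0 by omega, h, pow_mul]; norm_num
    · rw [show 2 * q - n = 1 by omega, h, pow_succ, pow_mul]; norm_num; ring
  have hfold : (∫ t in (-1 : ℝ)..1, besselJ n (x * t) *
      (((1 - t) ^ (μ - 1) * (1 + t) ^ μ : ℝ) : ℂ)) = ∫ t in (0 : ℝ)..1,
      2 * ((x / 2) ^ n / G) * (jac (μ - 1) t * ((t : ℂ) ^ (2 * q) *
        weightTransform (n + 1 / 2) 0 (x * t)) + jac (μ - 1) t * ((t : ℂ) ^ (2 * q) *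
        weightTransform (n + 1 / 2) 0 (-x * t))) := by
    rw [integral_neg_one_one_eq i₁ i₂]
    refine intervalIntegral.integral_congr_ae ?_
    filter_upwards [hae] with t h1 ht
    rw [uIoc_of_le zero_le_one] at ht
    have ht' : t ∈ Ioo (0 : ℝ) 1 := ⟨ht.1, lt_of_le_of_ne ht.2 h1⟩
    rw [hw t ht', hw' t ht', Complex.ofReal_neg, mul_neg, besselJ_neg]
    have e : (t : ℂ) ^ (2 * q) = (t : ℂ) ^ (2 * q - n) * (t : ℂ) ^ n := by
      rw [← pow_add]; congr 1; omega
    calc _ = besselJ n (x * t) * jac (μ - 1) t * ((1 + (t : ℂ)) + (-1) ^ n * (1 - t)) := by ring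
      _ = _ := by
        rw [hpar, besselJ_eq, ← hG, e, show x * (t : ℂ) / 2 = t * (x / 2) by ring, mul_pow, neg_mul]
        ring
  have hT := (differentiable_weightTransform ha 0).continuous
  have hT' := (differentiable_weightTransform hμ q).continuous
  have hia := intervalIntegrable_jac (a := (n + 1 / 2 : ℝ) - 1) (by linarith)
  rw [firstBessel, dunklV, if_neg hμ.ne', hfold, intervalIntegral.integral_const_mul,
    intervalIntegral.integral_add (hi.mul_continuousOn (by fun_prop))
      (hi.mul_continuousOn (by fun_prop)), integral_weightTransform_swap hμ ha,
    integral_weightTransform_swap hμ ha, ← intervalIntegral.integral_add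
      (hia.mul_continuousOn (by fun_prop)) (hia.mul_continuousOn (by fun_prop)), betaIntegral_half hμ]
  have e2 : ((2 * Real.Gamma (μ + 1 / 2) / (Real.Gamma (1 / 2) * Real.Gamma μ) : ℝ) : ℂ) =
      ((Real.Gamma (μ + 1 / 2) / (Real.Gamma (1 / 2) * Real.Gamma μ) : ℝ) : ℂ) * 2 := by
    push_cast; ring
  rw [e2]
  simp_rw [neg_mul, mul_add]
  ring

/-! ### Evaluation of the constants -/

theorem neg_two_I_cpow (r : ℝ) :
    (-2 * I) ^ (r : ℂ) = ((2 ^ r : ℝ) : ℂ) * cexp (-(I * ((π / 2 * r : ℝ) : ℂ))) := by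
  have h : (-2 * I : ℂ) = ((2 : ℝ) : ℂ) * -I := by push_cast; ring
  rw [h, ofReal_mul_cpow two_pos, ← Complex.ofReal_cpow zero_le_two,
    Complex.cpow_def_of_ne_zero (neg_ne_zero.mpr I_ne_zero), Complex.log_neg_I]
  congr 2
  push_cast; ring

/-- The phase of the leading oscillatory term. -/
def phase (μ : ℝ) (n : ℕ) : ℝ := π / 2 * (1 / 2 + n + μ)

theorem cornerCoeff_one (n : ℕ) : cornerCoeff (n + 1 / 2) 1 =
    ((Real.Gamma (n + 1 / 2) * 2 ^ ((n : ℝ) - 1 / 2) : ℝ) : ℂ) * cexp (-(I * (phase 0 n : ℂ))) := by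
  rw [cornerCoeff, neg_two_I_cpow, phase, show (n : ℝ) + 1 / 2 - 1 = n - 1 / 2 by ring]
  have h : cexp (-(I * ((π / 2 * (1 / 2 + n + 0) : ℝ) : ℂ))) =
      -I * cexp (-(I * ((π / 2 * (n - 1 / 2) : ℝ) : ℂ))) := by
    rw [show -(I * ((π / 2 * (1 / 2 + n + 0) : ℝ) : ℂ)) = -(π / 2 * I) +
      -(I * ((π / 2 * (n - 1 / 2) : ℝ) : ℂ)) by push_cast; ring, Complex.exp_add, Complex.exp_neg,
      Complex.exp_pi_div_two_mul_I, inv_I]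
  rw [h]; push_cast; ring

theorem cornerCoeff_expCoeff (μ : ℝ) (n : ℕ) : cornerCoeff (n + 1 / 2) (expCoeff μ) =
    ((Real.Gamma μ * Real.Gamma (n + 1 / 2) * 2 ^ (μ + n - 3 / 2) : ℝ) : ℂ) *
      cexp (-(I * (phase μ n : ℂ))) := by
  rw [cornerCoeff, expCoeff, neg_two_I_cpow, neg_two_I_cpow, phase]
  have h : cexp (-(I * ((π / 2 * (1 / 2 + n + μ) : ℝ) : ℂ))) =
      -(cexp (-(I * ((π / 2 * (μ - 1) : ℝ) : ℂ))) *
        cexp (-(I * ((π / 2 * (n + 1 / 2 - 1) : ℝ) : ℂ)))) := by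
    rw [← Complex.exp_add, show -(I * ((π / 2 * (1 / 2 + n + μ) : ℝ) : ℂ)) = -(π * I) +
      (-(I * ((π / 2 * (μ - 1) : ℝ) : ℂ)) + -(I * ((π / 2 * (n + 1 / 2 - 1) : ℝ) : ℂ))) by
        push_cast; ring, Complex.exp_add (-(π * I)), Complex.exp_neg, Complex.exp_pi_mul_I]
    norm_num
  have h2 : (2 : ℝ) ^ (μ + n - 3 / 2) = 2 ^ (μ - 1) * 2 ^ ((n : ℝ) + 1 / 2 - 1) := by
    rw [← Real.rpow_add two_pos]; ring_nf
  rw [h, h2]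
  push_cast
  linear_combination (-(((2 : ℝ) ^ (μ - 1) : ℝ) : ℂ) * cexp (-(I * ((π / 2 * (μ - 1)))))
    * (Real.Gamma μ : ℂ) * (((2 : ℝ) ^ ((n : ℝ) + 1 / 2 - 1) : ℝ) : ℂ) *
    cexp (-(I * ((π / 2 * (n + 1 / 2 - 1))))) * (Real.Gamma (n + 1 / 2) : ℂ)) * (-I_mul_I)

theorem exp_add_conj_exp (ρ θ : ℝ) (x : ℂ) :
    (ρ : ℂ) * cexp (-(I * (θ : ℂ))) * cexp (I * x) +
      conj ((ρ : ℂ) * cexp (-(I * (θ : ℂ)))) * cexp (-(I * x)) =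
    2 * ρ * Complex.cos (x - θ) := by
  rw [map_mul, conj_ofReal, ← Complex.exp_conj, map_neg, map_mul, conj_I, conj_ofReal,
    show 2 * (ρ : ℂ) * Complex.cos (x - θ) = ρ * (2 * Complex.cos (x - θ)) by ring, Complex.two_cos,
    mul_assoc, mul_assoc, ← Complex.exp_add, ← Complex.exp_add]
  ring_nf

theorem half_pow_mul_cpow (μ : ℝ) (n : ℕ) {x : ℂ} (hx : x ≠ 0) :
    (x / 2) ^ n * x ^ (-(μ + ((n + 1 / 2 : ℝ) : ℂ))) =
      ((2 ^ (-(μ + n + 1 / 2)) : ℝ) : ℂ) * (x / 2) ^ ((-μ - 1 / 2 : ℝ) : ℂ) := by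
  have hx2 : x / 2 ≠ 0 := div_ne_zero hx two_ne_zero
  have h : x = ((2 : ℝ) : ℂ) * (x / 2) := by push_cast; ring
  conv_lhs => rw [h]
  rw [show -((μ : ℂ) + ((n + 1 / 2 : ℝ) : ℂ)) = ((-(μ + n + 1 / 2) : ℝ) : ℂ) by push_cast; ring,
    ofReal_mul_cpow two_pos, ← Complex.ofReal_cpow zero_le_two, ← h, mul_left_comm]
  congr 1
  rw [← Complex.cpow_natCast, ← Complex.cpow_add _ _ hx2]
  congr 1; push_cast; ring

/-- The oscillatory part for `μ > 0`, with its constants evaluated. -/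
theorem cosTerm_eq {μ : ℝ} (hμ : 0 < μ) (n : ℕ) {x : ℂ} (hx : x ≠ 0) :
    ((2 * Real.Gamma (μ + 1 / 2) / (Real.Gamma (1 / 2) * Real.Gamma μ) : ℝ) : ℂ) *
      ((x / 2) ^ n / ((Real.Gamma (1 / 2) * Real.Gamma (n + 1 / 2) : ℝ) : ℂ)) *
      ((cornerCoeff (n + 1 / 2) (expCoeff μ) * cexp (I * x) +
        conj (cornerCoeff (n + 1 / 2) (expCoeff μ)) * cexp (-(I * x))) *
          x ^ (-(μ + ((n + 1 / 2 : ℝ) : ℂ)))) = cosTerm μ n x := by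
  have h2 : (2 : ℝ) ^ (μ + n - 3 / 2) * 2 ^ (-(μ + n + 1 / 2)) = 1 / 4 := by
    rw [← Real.rpow_add two_pos, show μ + n - 3 / 2 + -(μ + n + 1 / 2) = -2 by ring]
    norm_num [Real.rpow_neg]
  have hreal : 2 * Real.Gamma (μ + 1 / 2) / (Real.Gamma (1 / 2) * Real.Gamma μ) *
      (Real.Gamma (1 / 2) * Real.Gamma (n + 1 / 2))⁻¹ *
      (2 * (Real.Gamma μ * Real.Gamma (n + 1 / 2) * 2 ^ (μ + n - 3 / 2))) *
      2 ^ (-(μ + n + 1 / 2)) = Real.Gamma (μ + 1 / 2) / π := by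
    have hs := Real.mul_self_sqrt Real.pi_pos.le
    rw [Real.Gamma_one_half_eq]
    calc _ = Real.Gamma (μ + 1 / 2) / (√π * √π) *
          (4 * ((2 : ℝ) ^ (μ + n - 3 / 2) * 2 ^ (-(μ + n + 1 / 2)))) := by field_simp; ring
      _ = _ := by rw [h2, hs]; ring
  rw [cornerCoeff_expCoeff, exp_add_conj_exp, cosTerm, ← hreal, ← phase]
  have h := half_pow_mul_cpow μ n hx
  rw [div_eq_mul_inv ((x / 2) ^ n)]
  push_cast at h ⊢
  linear_combination (2 * (Real.Gamma (μ + 1 / 2) : ℂ) / (Real.Gamma (1 / 2) * Real.Gamma μ) *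
    (Real.Gamma (1 / 2) * Real.Gamma (n + 1 / 2) : ℂ)⁻¹ *
    (2 * (Real.Gamma μ * Real.Gamma (n + 1 / 2) * (((2 : ℝ) ^ (μ + n - 3 / 2) : ℝ) : ℂ))) *
    Complex.cos (x - phase μ n)) * h

/-- The oscillatory part for `μ = 0`, with its constants evaluated. -/
theorem cosTerm_zero_eq (n : ℕ) {x : ℂ} (hx : x ≠ 0) :
    (x / 2) ^ n / ((Real.Gamma (1 / 2) * Real.Gamma (n + 1 / 2) : ℝ) : ℂ) *
      ((cornerCoeff (n + 1 / 2) 1 * cexp (I * x) +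
        conj (cornerCoeff (n + 1 / 2) 1) * cexp (-(I * x))) *
          x ^ (-(((0 : ℝ) : ℂ) + ((n + 1 / 2 : ℝ) : ℂ)))) = cosTerm 0 n x := by
  have h2 : (2 : ℝ) ^ ((n : ℝ) - 1 / 2) * 2 ^ (-(0 + n + 1 / 2) : ℝ) = 1 / 2 := by
    rw [← Real.rpow_add two_pos, show (n : ℝ) - 1 / 2 + -(0 + n + 1 / 2) = -1 by ring]
    norm_num [Real.rpow_neg]
  have hreal : (Real.Gamma (1 / 2) * Real.Gamma (n + 1 / 2))⁻¹ *
      (2 * (Real.Gamma (n + 1 / 2) * 2 ^ ((n : ℝ) - 1 / 2))) *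
      2 ^ (-(0 + n + 1 / 2) : ℝ) = Real.Gamma (0 + 1 / 2) / π := by
    have hs := Real.mul_self_sqrt Real.pi_pos.le
    rw [zero_add ((1 : ℝ) / 2), Real.Gamma_one_half_eq]
    calc _ = 1 / √π * (2 * ((2 : ℝ) ^ ((n : ℝ) - 1 / 2) * 2 ^ (-(0 + n + 1 / 2) : ℝ))) := by
          field_simp
      _ = √π / (√π * √π) := by rw [h2]; field_simp
      _ = _ := by rw [hs]
  rw [cornerCoeff_one, exp_add_conj_exp, cosTerm, ← hreal, ← phase]
  have h := half_pow_mul_cpow 0 n hx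
  rw [div_eq_mul_inv ((x / 2) ^ n)]
  push_cast at h ⊢
  linear_combination ((Real.Gamma (1 / 2) * Real.Gamma (n + 1 / 2) : ℂ)⁻¹ *
    (2 * (Real.Gamma (n + 1 / 2) * (((2 : ℝ) ^ ((n : ℝ) - 1 / 2) : ℝ) : ℂ))) *
    Complex.cos (x - phase 0 n)) * h

/-- The common form of both algebraic terms: `q = ⌊(n + 1) / 2⌋` for the first deformation and
`q = 0` for the second. -/
def algTerm (μ : ℝ) (n q : ℕ) (z : ℂ) : ℂ :=
  ((Real.Gamma (q + 1 / 2) * Real.Gamma (μ + 1 / 2) /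
      (Real.Gamma (n + 1 / 2 - q) * Real.Gamma μ * Real.Gamma (1 / 2)) : ℝ) : ℂ) *
    (z / 2) ^ ((n : ℤ) - 2 * q - 1)

theorem firstAlgTerm_eq (μ : ℝ) (n : ℕ) : firstAlgTerm μ n = algTerm μ n ((n + 1) / 2) := rfl

theorem secondAlgTerm_eq (μ : ℝ) (n : ℕ) : secondAlgTerm μ n = algTerm μ n 0 := by
  funext z
  have h : Real.Gamma (1 / 2) ≠ 0 := (Real.Gamma_pos_of_pos (by norm_num)).ne'
  have hreal : Real.Gamma (μ + 1 / 2) / (Real.Gamma (n + 1 / 2) * Real.Gamma μ) =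
      Real.Gamma ((0 : ℕ) + 1 / 2) * Real.Gamma (μ + 1 / 2) /
      (Real.Gamma (n + 1 / 2 - (0 : ℕ)) * Real.Gamma μ * Real.Gamma (1 / 2)) := by
    rw [Nat.cast_zero, zero_add, sub_zero, mul_comm (Real.Gamma (1 / 2)), mul_div_mul_right _ _ h]
  rw [secondAlgTerm, algTerm, hreal]
  simp

/-- For `μ = 0` the factor `Γ(μ) = Γ(0)` in the denominator has the value `0` in Lean, so that the
quotient is `0`, in accordance with the convention `1 / Γ(0) = 0`. -/
theorem algTerm_zero (n q : ℕ) (z : ℂ) : algTerm 0 n q z = 0 := by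
  simp [algTerm, Real.Gamma_zero]

theorem half_zpow_eq (n q : ℕ) {x : ℂ} (hx : x ≠ 0) :
    (x / 2) ^ ((n : ℤ) - 2 * q - 1) = 2 ^ (2 * q + 1) * ((x / 2) ^ n * (x ^ (2 * q + 1))⁻¹) := by
  have hx2 : x / 2 ≠ 0 := div_ne_zero hx two_ne_zero
  rw [show (n : ℤ) - 2 * q - 1 = (n : ℤ) - ((2 * q + 1 : ℕ) : ℤ) by push_cast; ring,
    zpow_sub₀ hx2, zpow_natCast, zpow_natCast, div_pow x 2 (2 * q + 1)]
  field_simp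

/-- The coefficient of the algebraic term. As `algCoeff q` is imaginary, the real part only involves
the imaginary part of the moment. -/
theorem algCoeff_mul_cornerMoment_re {b : ℝ} (hb : 0 < b) {n q : ℕ} (hq : q ≤ n) :
    2 * (algCoeff q * cornerMoment b (n + 1 / 2) q).re =
      π * (2 * q).factorial * Real.Gamma (n + 1 / 2) /
        (q.factorial * Real.Gamma (n + 1 / 2 - q)) := by
  have e : algCoeff q = I * (((-1) ^ q * ((2 * q).factorial : ℝ) : ℝ) : ℂ) := by
    rw [algCoeff]; push_cast; ring
  have hs : ((-1 : ℝ) ^ q) * (-1) ^ q = 1 := by rw [← mul_pow]; norm_num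
  rw [e, mul_assoc, I_mul_re, Complex.im_ofReal_mul, cornerMoment_im hb hq]
  calc _ = ((-1 : ℝ) ^ q * (-1) ^ q) * (π * (2 * q).factorial * Real.Gamma (n + 1 / 2) /
        (q.factorial * Real.Gamma (n + 1 / 2 - q))) := by ring
    _ = _ := by rw [hs, one_mul]

/-- The algebraic part for `μ > 0`, with its constants evaluated. -/
theorem algTerm_eq {μ : ℝ} {b : ℝ} (hb : 0 < b) {n q : ℕ} (hq : q ≤ n) {x : ℂ} (hx : x ≠ 0) :
    ((2 * Real.Gamma (μ + 1 / 2) / (Real.Gamma (1 / 2) * Real.Gamma μ) : ℝ) : ℂ) *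
      ((x / 2) ^ n / ((Real.Gamma (1 / 2) * Real.Gamma (n + 1 / 2) : ℝ) : ℂ)) *
      (((2 * (algCoeff q * cornerMoment b (n + 1 / 2) q).re : ℝ) : ℂ) * (x ^ (2 * q + 1))⁻¹) =
    algTerm μ n q x := by
  rw [algTerm, half_zpow_eq n q hx, algCoeff_mul_cornerMoment_re hb hq]
  have hGn : Real.Gamma (n + 1 / 2) ≠ 0 := (Real.Gamma_pos_of_pos (by positivity)).ne'
  have hπ : √π ≠ 0 := by positivity
  have hs := Real.mul_self_sqrt Real.pi_pos.le
  have hreal : 2 * Real.Gamma (μ + 1 / 2) / (Real.Gamma (1 / 2) * Real.Gamma μ) *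
      (Real.Gamma (1 / 2) * Real.Gamma (n + 1 / 2))⁻¹ *
      (π * (2 * q).factorial * Real.Gamma (n + 1 / 2) /
        (q.factorial * Real.Gamma (n + 1 / 2 - q))) =
      Real.Gamma (q + 1 / 2) * Real.Gamma (μ + 1 / 2) /
      (Real.Gamma (n + 1 / 2 - q) * Real.Gamma μ * Real.Gamma (1 / 2)) * 2 ^ (2 * q + 1) := by
    rw [Real.Gamma_one_half_eq, Gamma_natCast_add_half q, pow_succ, pow_mul]
    have h4 : ((2 : ℝ) ^ 2) ^ q = 4 ^ q := by norm_num
    have h40 : (4 : ℝ) ^ q ≠ 0 := by positivity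
    rw [h4]
    calc _ = (π / (√π * √π)) * (2 * Real.Gamma (μ + 1 / 2) * (2 * q).factorial /
          (q.factorial * Real.Gamma μ * Real.Gamma (n + 1 / 2 - q))) *
          (Real.Gamma (n + 1 / 2) * (Real.Gamma (n + 1 / 2))⁻¹) := by ring
      _ = 2 * Real.Gamma (μ + 1 / 2) * (2 * q).factorial /
          (q.factorial * Real.Gamma μ * Real.Gamma (n + 1 / 2 - q)) := by
          rw [hs, div_self Real.pi_ne_zero, mul_inv_cancel₀ hGn]; ring
      _ = 2 * Real.Gamma (μ + 1 / 2) * (2 * q).factorial /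
          (q.factorial * Real.Gamma μ * Real.Gamma (n + 1 / 2 - q)) *
          (√π * (√π)⁻¹ * (4 ^ q * (4 ^ q)⁻¹)) := by
          rw [mul_inv_cancel₀ hπ, mul_inv_cancel₀ h40]; ring
      _ = _ := by ring
  have hc := congrArg (fun r : ℝ => (r : ℂ)) hreal
  beta_reduce at hc
  rw [Complex.ofReal_mul, Complex.ofReal_mul, Complex.ofReal_inv, Complex.ofReal_mul _ (2 ^ _)] at hc
  rw [div_eq_mul_inv ((x / 2) ^ n)]
  have h2 : (((2 : ℝ) ^ (2 * q + 1) : ℝ) : ℂ) = 2 ^ (2 * q + 1) := by push_cast; rfl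
  rw [h2] at hc
  linear_combination ((x / 2) ^ n * (x ^ (2 * q + 1))⁻¹) * hc

/-- The exact size of the algebraic term, which absorbs the algebraic error when `μ > 0`. -/
theorem norm_algTerm_div {μ : ℝ} (hμ : 0 < μ) {n q : ℕ} (hq : q ≤ n) :
    ∃ A, 0 < A ∧ ∀ x : ℂ, x ≠ 0 →
      ‖algTerm μ n q x‖ / ‖x‖ ^ 2 = A * (‖x‖ ^ n * ‖x‖ ^ (-((2 * q + 1 : ℕ) : ℝ) - 2)) := by
  have hqn : (q : ℝ) ≤ n := by exact_mod_cast hq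
  have h3 := Real.Gamma_pos_of_pos (s := n + 1 / 2 - q) (by linarith)
  refine ⟨Real.Gamma (q + 1 / 2) * Real.Gamma (μ + 1 / 2) /
      (Real.Gamma (n + 1 / 2 - q) * Real.Gamma μ * Real.Gamma (1 / 2)) *
      (2 ^ (2 * q + 1) * (2 ^ n)⁻¹), by positivity, fun x hx => ?_⟩
  have hx0 : 0 < ‖x‖ := norm_pos_iff.mpr hx
  rw [algTerm, half_zpow_eq n q hx, norm_mul, Complex.norm_real, Real.norm_of_nonneg (by positivity),
    show -((2 * q + 1 : ℕ) : ℝ) - 2 = -((2 * q + 1 + 2 : ℕ) : ℝ) by push_cast; ring,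
    Real.rpow_neg hx0.le, Real.rpow_natCast]
  simp only [norm_mul, norm_pow, norm_div, norm_inv, Complex.norm_ofNat]
  rw [div_pow, pow_add ‖x‖ (2 * q + 1) 2]
  field_simp

/-! ### The asymptotic formulas -/

/-- In the sector `|arg x| ≤ π / 2 - ε` one has `Re x ≥ c |x|` with `c = sin (min ε (π / 2))`. -/
theorem isBigO_sectorAtInfinity {f : ℂ → ℂ} {g : ℂ → ℝ} {ε : ℝ} (hε : 0 < ε)
    (h : ∀ c : ℝ, 0 < c → c ≤ 1 → ∃ K R : ℝ, ∀ x : ℂ, R ≤ ‖x‖ → c * ‖x‖ ≤ x.re → ‖f x‖ ≤ K * g x)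
    (hg : ∀ x, 0 ≤ g x) : f =O[sectorAtInfinity ε] g := by
  set δ := min ε (π / 2)
  have hδ0 : 0 < δ := lt_min hε (by positivity)
  have hδ1 : δ ≤ π / 2 := min_le_right _ _
  obtain ⟨K, R, hK⟩ := h (Real.sin δ) (Real.sin_pos_of_pos_of_lt_pi hδ0 (by linarith [Real.pi_pos]))
    (Real.sin_le_one δ)
  refine Asymptotics.IsBigO.of_bound K ?_
  rw [sectorAtInfinity, Filter.eventually_inf_principal]
  have hlarge : ∀ᶠ x : ℂ in Bornology.cobounded ℂ, R ≤ ‖x‖ :=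
    tendsto_norm_cobounded_atTop.eventually_ge_atTop R
  filter_upwards [hlarge] with x hx harg
  rw [Real.norm_of_nonneg (hg x)]
  refine hK x hx ?_
  have h2 : δ ≤ ε := min_le_left _ _
  have h3 : Real.sin δ ≤ Real.cos x.arg := by
    rw [← Real.cos_pi_div_two_sub, ← Real.cos_abs x.arg]
    exact Real.cos_le_cos_of_nonneg_of_le_pi (abs_nonneg _) (by linarith [Real.pi_pos])
      (by linarith)
  calc Real.sin δ * ‖x‖ ≤ Real.cos x.arg * ‖x‖ := by gcongr
    _ = x.re := by rw [mul_comm, Complex.norm_mul_cos_arg]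

/-- The asymptotics for `μ > 0` of the common integral representation of both deformations. -/
theorem asymp_of_pos {μ : ℝ} (hμ : 0 < μ) {n q : ℕ} (hq : q ≤ n) {c : ℝ} (hc : 0 < c)
    (hc1 : c ≤ 1) :
    ∃ K R : ℝ, ∀ x : ℂ, R ≤ ‖x‖ → c * ‖x‖ ≤ x.re →
      ‖((2 * Real.Gamma (μ + 1 / 2) / (Real.Gamma (1 / 2) * Real.Gamma μ) : ℝ) : ℂ) *
        ((x / 2) ^ n / ((Real.Gamma (1 / 2) * Real.Gamma (n + 1 / 2) : ℝ) : ℂ)) *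
        (∫ s in (0 : ℝ)..1, jac ((n + 1 / 2) - 1) s *
          (weightTransform μ q (x * s) + weightTransform μ q (-(x * s)))) -
        (cosTerm μ n x + algTerm μ n q x)‖ ≤
      K * (‖x‖ ^ (-μ - 3 / 2) * Real.exp |x.im| + ‖algTerm μ n q x‖ / ‖x‖ ^ 2) := by
  -- the height of the corner path
  have hb : 0 < c / 2 := by positivity
  obtain ⟨K, hK, hk⟩ := (hasExpAlgAsymptotics_weightTransform hμ q).symm_integral
    (weightTransform_neg μ q) hμ.le zero_le_one (a := n + 1 / 2) (by positivity) hc hb le_rfl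
    (by linarith)
  obtain ⟨A, hA, hAx⟩ := norm_algTerm_div hμ hq
  set P : ℝ := 2 * Real.Gamma (μ + 1 / 2) / (Real.Gamma (1 / 2) * Real.Gamma μ) *
    ((1 / 2) ^ n / (Real.Gamma (1 / 2) * Real.Gamma (n + 1 / 2))) with hP
  -- the factor `1 + 1 / A` expresses the algebraic error through the algebraic term
  refine ⟨P * K * (1 + 1 / A), (c / 2)⁻¹, fun x hxR hx => ?_⟩
  have hx0 : 0 < ‖x‖ := (inv_pos.mpr hb).trans_le hxR
  have hxne : x ≠ 0 := norm_pos_iff.mp hx0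
  have hmain := hk x hxR hx
  rw [one_mul] at hmain
  rw [← cosTerm_eq hμ n hxne, hAx x hxne, ← algTerm_eq hb hq hxne, ← mul_add, ← mul_sub, norm_mul]
  have hpre : ‖((2 * Real.Gamma (μ + 1 / 2) / (Real.Gamma (1 / 2) * Real.Gamma μ) : ℝ) : ℂ) *
        ((x / 2) ^ n / ((Real.Gamma (1 / 2) * Real.Gamma (n + 1 / 2) : ℝ) : ℂ))‖ = P * ‖x‖ ^ n := by
    rw [norm_mul, norm_div, Complex.norm_real, Complex.norm_real, Real.norm_of_nonneg (by positivity),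
      Real.norm_of_nonneg (by positivity), norm_pow, norm_div, Complex.norm_ofNat, div_pow, hP,
      div_pow, one_pow]
    ring
  rw [hpre, sub_add_eq_sub_sub_swap]
  change ‖_ - ((2 * (algCoeff q * cornerMoment (c / 2) (n + 1 / 2) q).re : ℝ) : ℂ) * _ - _‖ ≤ _
    at hmain
  refine (mul_le_mul_of_nonneg_left hmain (by positivity)).trans ?_
  have hpow : ‖x‖ ^ n * ‖x‖ ^ (-(μ + (n + 1 / 2) + 1)) = ‖x‖ ^ (-μ - 3 / 2) := by
    rw [← Real.rpow_natCast, ← Real.rpow_add hx0]; ring_nf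
  set Q := ‖x‖ ^ n * ‖x‖ ^ (-((2 * q + 1 : ℕ) : ℝ) - 2)
  set E := ‖x‖ ^ (-μ - 3 / 2) * Real.exp |x.im|
  calc _ = P * K * (Q + ‖x‖ ^ n * ‖x‖ ^ (-(μ + (n + 1 / 2) + 1)) * Real.exp |x.im|) := by ring
    _ = P * K * (Q + E) := by rw [hpow]
    _ ≤ P * K * ((1 + 1 / A) * (E + A * Q)) := by
        refine mul_le_mul_of_nonneg_left ?_ (by positivity)
        have : (1 + 1 / A) * (E + A * Q) = Q + E + (E / A + A * Q) := by field_simp; ring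
        rw [this]
        have : 0 ≤ E / A + A * Q := by positivity
        linarith
    _ = _ := by ring

/-- The asymptotics for `μ = 0`, where both deformations reduce to the classical Bessel function. -/
theorem asymp_zero (n : ℕ) {c : ℝ} (hc : 0 < c) (hc1 : c ≤ 1) :
    ∃ K R : ℝ, ∀ x : ℂ, R ≤ ‖x‖ → c * ‖x‖ ≤ x.re →
      ‖(x / 2) ^ n / ((Real.Gamma (1 / 2) * Real.Gamma (n + 1 / 2) : ℝ) : ℂ) *
        (∫ s in (0 : ℝ)..1, jac ((n + 1 / 2) - 1) s *
          (cexp (I * (x * s)) + cexp (I * -(x * s)))) - cosTerm 0 n x‖ ≤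
      K * (‖x‖ ^ (-0 - 3 / 2 : ℝ) * Real.exp |x.im|) := by
  -- the height of the corner path
  have hb : 0 < c / 2 := by positivity
  obtain ⟨K, hK, hk⟩ := (hasExpAlgAsymptotics_cexp 0).symm_integral
    (fun ζ => by rw [← Complex.exp_conj]; simp) le_rfl le_rfl (a := n + 1 / 2) (by positivity) hc hb
    le_rfl (by linarith)
  set P : ℝ := (1 / 2) ^ n / (Real.Gamma (1 / 2) * Real.Gamma (n + 1 / 2)) with hP
  refine ⟨P * K, (c / 2)⁻¹, fun x hxR hx => ?_⟩
  have hx0 : 0 < ‖x‖ := (inv_pos.mpr hb).trans_le hxR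
  have hxne : x ≠ 0 := norm_pos_iff.mp hx0
  have hmain := hk x hxR hx
  rw [zero_mul, zero_add, zero_mul, Complex.zero_re, mul_zero, Complex.ofReal_zero, zero_mul,
    sub_zero] at hmain
  rw [← cosTerm_zero_eq n hxne, ← mul_sub, norm_mul]
  have hpre : ‖(x / 2) ^ n / ((Real.Gamma (1 / 2) * Real.Gamma (n + 1 / 2) : ℝ) : ℂ)‖ =
      P * ‖x‖ ^ n := by
    rw [norm_div, Complex.norm_real, Real.norm_of_nonneg (by positivity), norm_pow, norm_div,
      Complex.norm_ofNat, div_pow, hP, div_pow, one_pow]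
    ring
  rw [hpre]
  refine (mul_le_mul_of_nonneg_left hmain (by positivity)).trans ?_
  have hpow : ‖x‖ ^ n * ‖x‖ ^ (-(0 + ((n : ℝ) + 1 / 2) + 1)) = ‖x‖ ^ (-0 - 3 / 2 : ℝ) := by
    rw [← Real.rpow_natCast, ← Real.rpow_add hx0]; ring_nf
  rw [← hpow]
  exact le_of_eq (by ring_nf)

end DeformedBessel

end

theorem mainTheorem11 (μ : ℝ) (hμ : 0 ≤ μ) (n : ℕ) (ε : ℝ) (hε : 0 < ε) :
    ((fun x : ℂ => DeformedBessel.firstBessel μ n x -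
        (DeformedBessel.cosTerm μ n x + DeformedBessel.firstAlgTerm μ n x))
      =O[DeformedBessel.sectorAtInfinity ε]
      (fun x : ℂ => ‖x‖ ^ (-μ - 3 / 2) * Real.exp |x.im| +
        ‖DeformedBessel.firstAlgTerm μ n x‖ / ‖x‖ ^ 2)) ∧
    ((fun x : ℂ => DeformedBessel.secondBessel μ n x -
        (DeformedBessel.cosTerm μ n x + DeformedBessel.secondAlgTerm μ n x))
      =O[DeformedBessel.sectorAtInfinity ε]
      (fun x : ℂ => ‖x‖ ^ (-μ - 3 / 2) * Real.exp |x.im| +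
        ‖DeformedBessel.secondAlgTerm μ n x‖ / ‖x‖ ^ 2)) := by
  rw [DeformedBessel.firstAlgTerm_eq, DeformedBessel.secondAlgTerm_eq]
  refine ⟨DeformedBessel.isBigO_sectorAtInfinity hε (fun c hc hc1 => ?_) fun x => by positivity,
    DeformedBessel.isBigO_sectorAtInfinity hε (fun c hc hc1 => ?_) fun x => by positivity⟩
  · rcases hμ.eq_or_lt with rfl | hμ0
    · simp only [DeformedBessel.algTerm_zero, DeformedBessel.firstBessel_zero, add_zero, norm_zero,
        zero_div]
      exact DeformedBessel.asymp_zero n hc hc1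
    · simp only [DeformedBessel.firstBessel_eq hμ0]
      exact DeformedBessel.asymp_of_pos hμ0 (by omega) hc hc1
  · rcases hμ.eq_or_lt with rfl | hμ0
    · simp only [DeformedBessel.algTerm_zero, DeformedBessel.secondBessel_zero, add_zero, norm_zero,
        zero_div]
      exact DeformedBessel.asymp_zero n hc hc1
    · simp only [DeformedBessel.secondBessel_eq hμ0]
      exact DeformedBessel.asymp_of_pos hμ0 n.zero_le hc hc1
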